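/- **Setting.** A *T-mesh* $\mathsf T$ is a partition of $[\underline m,\overline m]\times[\underline n,\overline n]$ (integer bounds, $\underline m<\overline m$, $\underline n<\overline n$) into open rectangles with integer corners. Its vertices are the corners of the rectangles; its vertical (horizontal) skeleton $v\mathsf S$ ($h\mathsf S$) is the union of the closed vertical (horizontal) sides, and $\mathsf S=h\mathsf S\cup v\mathsf S$. Put $h\mathsf J(j)=\{k\in\mathbb Z:(k,j)\in v\mathsf S\}$, $v\mathsf J(i)=\{k\in\mathbb Z:(i,k)\in h\mathsf S\}$. The active region is $[\underline m+2,\overline m-2]\times[\underline n+2,\overline n-2]$, and the *anchors* are the vertices in it. $\mathsf T$ is *admissible* if (a) $\mathsf S$ contains $\{i\}\times[\underline n,\overline n]$ for $i=\underline m,\underline m+1,\underline m+2,\overline m-2,\overline m-1,\overline m$ and $\{i\}\times[\underline n+2,\overline n-2]$ for $i=\underline m+3,\overline m-3$, and likewise with the coordinates interchanged; and (b) any two vertices on the boundary of one rectangle that share a coordinate are joined by a straight segment in $\mathsf S$. A T-junction is an anchor at which exactly one of the four edges is missing; it is horizontal (vertical) if the missing edge is horizontal (vertical). The extension of a horizontal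 T-junction $(i,j)$ is $[i_1,i_4]\times\{j\}$, where $i_1<\dots<i_4$ are consecutive in $h\mathsf J(j)$ and $i=i_3$ if the left edge is missing, $i=i_2$ if the right edge is missing; vertical extensions are defined likewise. $\mathsf T$ is *analysis-suitable* if it is admissible and no horizontal extension meets a vertical one. Let $\Xi=(\xi_{\underline m}\le\dots\le\xi_{\overline m})$ and $\Pi=(\eta_{\underline n}\le\dots\le\eta_{\overline n})$ be real knot vectors in which end values have multiplicity at most $4$ and all other values at most $3$, with $\underline m+3<\overline m-3$, $\xi_{\underline m+3}<\xi_{\overline m-3}$, and the same for $\Pi$. Let $\hat\Omega=[\xi_{\underline m+3},\xi_{\overline m-3}]\times[\eta_{\underline n+3},\eta_{\overline n-3}]$. For an anchor $A=(a,b)$ let $i_1<\dots<i_5$ be consecutive in $h\mathsf J(b)$ with $i_3=a$, let $j_1<\dots<j_5$ be consecutive in $v\mathsf J(a)$ with $j_3=b$, and let $N_A(\xi,\eta)=B[\xi_{i_1},\dots,\xi_{i_5}](\xi)\,B[\eta_{j_1},\dots,\eta_{j_5}](\eta)$ on $\hat\Omega$, where $B$ is the cubic B-spline (at the right ends of $\hat\Omega$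 left limits are taken). The *T-spline space* $\mathcal T$ is the span of the $N_A$ over all anchors; it is an analysis-suitable T-spline (ASTS) space if $\mathsf T$ is analysis-suitable. *Perturbation.* A vertical segment is a maximal contiguous vertical line of $v\mathsf S$. List all vertical segments by column and, within a column, from bottom to top, and number them consecutively starting with $\underline m$; let $h\pi(k)$ be the column of the $k$-th one. Given constants $c_k\ge 0$ and $\delta>0$, the perturbed knots are $\xi[\delta]_k=\xi_{\underline m}+\sum_{\underline m<p\le k}\Delta_p$ with $\Delta_p=c_p\delta$ if $\xi_{h\pi(p)}=\xi_{h\pi(p-1)}$ and $\Delta_p=\xi_{h\pi(p)}-\xi_{h\pi(p-1)}$ otherwise. Proceed likewise in the vertical direction, with its own constants. The perturbed T-mesh is obtained by moving every vertical (horizontal) side of every rectangle to the index of the vertical (horizontal) segment that contains it, and $\mathcal T[\boldsymbol\delta]$ is the T-spline space of the perturbed mesh and knot vectors. **Lemma.** Let $\mathcal T^1,\mathcal T^2$ be two ASTS spaces and fix constants $c\ge0$ defining their perturbations (not necessarily the same for the two spaces). If $\mathcal T^1[\boldsymbol\delta]\subseteq\mathcal T^2[\boldsymbol\delta]$ for arbitrarily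 small $\delta>0$, then $\mathcal T^1\subseteq\mathcal T^2$. (Inclusion is that of spaces of functions on the same domain: $\mathcal T^1[\boldsymbol\delta]\subseteq\mathcal T^2[\boldsymbol\delta]$ includes equality of the two perturbed domains, and $\mathcal T^1\subseteq\mathcal T^2$ includes $\hat\Omega^1=\hat\Omega^2$.) -/

import Mathlib

open Filter Topology

/-- The open rectangle `]l, r[ × ]b, t[` with integer corners. -/
structure IndexRect where
  l : ℤ
  r : ℤ
  b : ℤ
  t : ℤ

/-- The raw data of a T-mesh: the index domain `[mlo, mhi] × [nlo, nhi]` and the set of its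
open rectangles. The axioms of a T-mesh are collected in `IndexMesh.IsTMesh`. -/
structure IndexMesh where
  mlo : ℤ
  mhi : ℤ
  nlo : ℤ
  nhi : ℤ
  cells : Set IndexRect

namespace IndexMesh

/-- The mesh with the two coordinates interchanged. It is used to obtain each "horizontal" notion
from the corresponding "vertical" one. -/
def transpose (T : IndexMesh) : IndexMesh where
  mlo := T.nlo
  mhi := T.nhi
  nlo := T.mlo
  nhi := T.mhi
  cells := (fun Q : IndexRect => ⟨Q.b, Q.t, Q.l, Q.r⟩) '' T.cells

/-- `T` is a T-mesh: the rectangles are nondegenerate, lie in the index domain and partition it.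
As all corners are integral, the last condition says that each unit square
`[x, x+1] × [y, y+1]` of the index domain lies in the closure of exactly one rectangle. -/
structure IsTMesh (T : IndexMesh) : Prop where
  dom_x : T.mlo < T.mhi
  dom_y : T.nlo < T.nhi
  cell : ∀ Q ∈ T.cells,
    T.mlo ≤ Q.l ∧ Q.l < Q.r ∧ Q.r ≤ T.mhi ∧ T.nlo ≤ Q.b ∧ Q.b < Q.t ∧ Q.t ≤ T.nhi
  partition : ∀ x y : ℤ, T.mlo ≤ x → x + 1 ≤ T.mhi → T.nlo ≤ y → y + 1 ≤ T.nhi →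
    ∃! Q : IndexRect, Q ∈ T.cells ∧ Q.l ≤ x ∧ x + 1 ≤ Q.r ∧ Q.b ≤ y ∧ y + 1 ≤ Q.t

/-- The vertices are the corners of the rectangles. -/
def IsVertex (T : IndexMesh) (i j : ℤ) : Prop :=
  ∃ Q ∈ T.cells, (Q.l = i ∨ Q.r = i) ∧ (Q.b = j ∨ Q.t = j)

/-- The vertical unit segment `{i} × [j, j+1]` lies in the skeleton. -/
def VEdge (T : IndexMesh) (i j : ℤ) : Prop :=
  ∃ Q ∈ T.cells, (Q.l = i ∨ Q.r = i) ∧ Q.b ≤ j ∧ j + 1 ≤ Q.t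

/-- The horizontal unit segment `[i, i+1] × {j}` lies in the skeleton. -/
def HEdge (T : IndexMesh) (i j : ℤ) : Prop := T.transpose.VEdge j i

/-- The integer point `(i, j)` lies in the vertical skeleton, which is the union of the closed
vertical sides of the rectangles (that is, of all vertical edges and all vertices). -/
def InVSkeleton (T : IndexMesh) (i j : ℤ) : Prop :=
  ∃ Q ∈ T.cells, (Q.l = i ∨ Q.r = i) ∧ Q.b ≤ j ∧ j ≤ Q.t

/-- `hJ(j)`: the indices `i` for which `(i, j)` lies in the vertical skeleton. -/
def hJ (T : IndexMesh) (j : ℤ) : Set ℤ := {i | T.InVSkeleton i j}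

/-- `vJ(i)`: the indices `j` for which `(i, j)` lies in the horizontal skeleton. -/
def vJ (T : IndexMesh) (i : ℤ) : Set ℤ := T.transpose.hJ i

/-- The active region `[mlo + 2, mhi - 2] × [nlo + 2, nhi - 2]`. -/
def InActive (T : IndexMesh) (i j : ℤ) : Prop :=
  T.mlo + 2 ≤ i ∧ i ≤ T.mhi - 2 ∧ T.nlo + 2 ≤ j ∧ j ≤ T.nhi - 2

/-- The anchors are the vertices in the active region. -/
def IsAnchor (T : IndexMesh) (i j : ℤ) : Prop := T.IsVertex i j ∧ T.InActive i j

/-- The admissibility conditions on vertical lines. -/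
structure VAdmissible (T : IndexMesh) : Prop where
  frame : ∀ i : ℤ, (i = T.mlo ∨ i = T.mlo + 1 ∨ i = T.mlo + 2 ∨
      i = T.mhi - 2 ∨ i = T.mhi - 1 ∨ i = T.mhi) →
    ∀ j : ℤ, T.nlo ≤ j → j + 1 ≤ T.nhi → T.VEdge i j
  active : ∀ i : ℤ, (i = T.mlo + 2 ∨ i = T.mlo + 3 ∨ i = T.mhi - 3 ∨ i = T.mhi - 2) →
    ∀ j : ℤ, T.nlo + 2 ≤ j → j + 1 ≤ T.nhi - 2 → T.VEdge i j
  /-- Two vertices on the boundary of one rectangle with the same first coordinate are joined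
  by the skeleton. -/
  joined : ∀ Q ∈ T.cells, ∀ i j₁ j₂ : ℤ, Q.l ≤ i → i ≤ Q.r →
    (i = Q.l ∨ i = Q.r ∨ ((j₁ = Q.b ∨ j₁ = Q.t) ∧ (j₂ = Q.b ∨ j₂ = Q.t))) →
    Q.b ≤ j₁ → j₂ ≤ Q.t → T.IsVertex i j₁ → T.IsVertex i j₂ →
    ∀ j : ℤ, j₁ ≤ j → j + 1 ≤ j₂ → T.VEdge i j

/-- Admissible T-meshes. -/
def Admissible (T : IndexMesh) : Prop := T.VAdmissible ∧ T.transpose.VAdmissible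

/-- `v` consists of `n` consecutive elements of `H`, in increasing order. -/
def Consecutive (H : Set ℤ) {n : ℕ} (v : Fin n → ℤ) : Prop :=
  StrictMono v ∧ (∀ k, v k ∈ H) ∧
    ∀ x ∈ H, ∀ k l : Fin n, v k ≤ x → x ≤ v l → ∃ p, v p = x

/-- T-junction of type `⊢`: only the left edge is missing. -/
def IsTLeft (T : IndexMesh) (i j : ℤ) : Prop :=
  T.IsAnchor i j ∧ ¬ T.HEdge (i - 1) j ∧ T.HEdge i j ∧ T.VEdge i (j - 1) ∧ T.VEdge i j

/-- T-junction of type `⊣`: only the right edge is missing. -/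
def IsTRight (T : IndexMesh) (i j : ℤ) : Prop :=
  T.IsAnchor i j ∧ T.HEdge (i - 1) j ∧ ¬ T.HEdge i j ∧ T.VEdge i (j - 1) ∧ T.VEdge i j

/-- `[e₀, e₃] × {j}` is the extension of the horizontal T-junction at `(i, j)`: it spans four
consecutive indices of `hJ(j)`, two of them on the side of the missing edge and one on the
other side. -/
def IsHExtension (T : IndexMesh) (i j : ℤ) (e : Fin 4 → ℤ) : Prop :=
  Consecutive (T.hJ j) e ∧ ((T.IsTLeft i j ∧ e 2 = i) ∨ (T.IsTRight i j ∧ e 1 = i))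

/-- `{i} × [e₀, e₃]` is the extension of the vertical T-junction (type `⊥` or `⊤`) at `(i, j)`. -/
def IsVExtension (T : IndexMesh) (i j : ℤ) (e : Fin 4 → ℤ) : Prop :=
  T.transpose.IsHExtension j i e

/-- A T-mesh is analysis-suitable if it is admissible and no horizontal T-junction extension
`[e₀, e₃] × {j}` meets a vertical one `{i'} × [f₀, f₃]`. -/
structure AnalysisSuitable (T : IndexMesh) : Prop where
  isTMesh : T.IsTMesh
  admissible : T.Admissible
  no_cross : ∀ (i j i' j' : ℤ) (e f : Fin 4 → ℤ), T.IsHExtension i j e → T.IsVExtension i' j' f →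
    ¬ (e 0 ≤ i' ∧ i' ≤ e 3 ∧ f 0 ≤ j ∧ j ≤ f 3)

/-! ### Segments and the perturbed mesh -/

/-- `(i, j)` is the lowest vertex of a vertical segment, i.e. of a maximal contiguous vertical
line of the skeleton. A segment is identified with its lowest vertex; segments are ordered
by column first and then by lowest vertex. -/
def IsVSegment (T : IndexMesh) (s : ℤ × ℤ) : Prop := T.VEdge s.1 s.2 ∧ ¬ T.VEdge s.1 (s.2 - 1)

/-- The number of vertical segments. -/
noncomputable def numVSegments (T : IndexMesh) : ℕ := {s | T.IsVSegment s}.ncard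

/-- The index, in the perturbed horizontal knot vector, of the vertical segment through `(i, j)`:
the segments are numbered consecutively from `mlo` in their order, and the segment through
`(i, j)` is the last one whose lowest vertex is not after `(i, j)`. -/
noncomputable def colIndex (T : IndexMesh) (i j : ℤ) : ℤ :=
  T.mlo - 1 + ({s : ℤ × ℤ | T.IsVSegment s ∧ (s.1 < i ∨ s.1 = i ∧ s.2 ≤ j)}.ncard : ℤ)

/-- The index, in the perturbed vertical knot vector, of the horizontal segment through `(i, j)`. -/
noncomputable def rowIndex (T : IndexMesh) (i j : ℤ) : ℤ := T.transpose.colIndex j i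

/-- The index map `hπ`: the column of the vertical segment with perturbed index `k`. -/
noncomputable def colOf (T : IndexMesh) (k : ℤ) : ℤ :=
  Classical.epsilon fun i => ∃ j, T.IsVSegment (i, j) ∧ T.colIndex i j = k

/-- The perturbed mesh: there is one column per vertical segment and one row per horizontal
segment, and each side of each rectangle is moved to the index of the segment containing it. -/
noncomputable def perturb (T : IndexMesh) : IndexMesh where
  mlo := T.mlo
  mhi := T.mlo - 1 + T.numVSegments
  nlo := T.nlo
  nhi := T.nlo - 1 + T.transpose.numVSegments
  cells := (fun Q : IndexRect => ⟨T.colIndex Q.l Q.b, T.colIndex Q.r Q.b,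
    T.rowIndex Q.l Q.b, T.rowIndex Q.l Q.t⟩) '' T.cells

/-- The perturbed horizontal knot vector `Ξ[δ]`, with constants `c`: the knot of every vertical
segment of column `i` is initialised as `ξ i`, and then each vanishing knot interval is replaced
by one of length `c k * δ` while the other knot intervals are kept. -/
noncomputable def perturbKnots (T : IndexMesh) (ξ : ℤ → ℝ) (c : ℤ → ℝ) (δ : ℝ) (k : ℤ) : ℝ :=
  ξ T.mlo + ∑ p ∈ Finset.Ioc T.mlo k,
    if ξ (T.colOf p) - ξ (T.colOf (p - 1)) = 0 then c p * δ
    else ξ (T.colOf p) - ξ (T.colOf (p - 1))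

end IndexMesh

/-! ### B-splines and T-spline spaces -/

/-- The Cox-de Boor recursion for the B-spline of degree `p` on the knots `t i, …, t (i+p+1)`,
with `0 / 0 = 0`. It takes right limits at knots, except at the right end `R` of the parametric
domain, where it takes left limits. -/
noncomputable def coxDeBoor (R : ℝ) (t : ℕ → ℝ) : ℕ → ℕ → ℝ → ℝ
  | 0, i, x => open Classical in
      if (if x = R then t i < x ∧ x ≤ t (i + 1) else t i ≤ x ∧ x < t (i + 1)) then 1 else 0
  | p + 1, i, x =>
      (x - t i) / (t (i + p + 1) - t i) * coxDeBoor R t p i x +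
        (t (i + p + 2) - x) / (t (i + p + 2) - t (i + 1)) * coxDeBoor R t p (i + 1) x

/-- The cubic B-spline with local knot vector `[t 0, …, t 4]`. -/
noncomputable def cubicBSpline (R : ℝ) (t : Fin 5 → ℝ) (x : ℝ) : ℝ :=
  coxDeBoor R (fun k => t (Fin.ofNat 5 k)) 3 0 x

/-- `ξ lo ≤ … ≤ ξ hi` is a global knot vector: knots have multiplicity at most four,
those different from the two end knots at most three, and the reduced parametric interval
`[ξ (lo+3), ξ (hi-3)]` is nondegenerate. Values of `ξ` outside `[lo, hi]` are irrelevant. -/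
structure IsKnotVector (lo hi : ℤ) (ξ : ℤ → ℝ) : Prop where
  index : lo + 3 < hi - 3
  mono : MonotoneOn ξ (Set.Icc lo hi)
  mult_le_four : ∀ x : ℝ, {i ∈ Set.Icc lo hi | ξ i = x}.ncard ≤ 4
  mult_le_three : ∀ x : ℝ, ξ lo < x → x < ξ hi → {i ∈ Set.Icc lo hi | ξ i = x}.ncard ≤ 3
  nondegenerate : ξ (lo + 3) < ξ (hi - 3)

/-- The data of a T-spline: a mesh with a horizontal and a vertical global knot vector. -/
structure TSpline where
  mesh : IndexMesh
  xi : ℤ → ℝ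
  eta : ℤ → ℝ

namespace TSpline

/-- An analysis-suitable T-spline: the T-mesh is analysis-suitable and both knot vectors are
global knot vectors. -/
structure IsAnalysisSuitable (T : TSpline) : Prop where
  mesh : T.mesh.AnalysisSuitable
  xi : IsKnotVector T.mesh.mlo T.mesh.mhi T.xi
  eta : IsKnotVector T.mesh.nlo T.mesh.nhi T.eta

/-- The reduced parametric domain. -/
def domain (T : TSpline) : Set (ℝ × ℝ) :=
  Set.Icc (T.xi (T.mesh.mlo + 3)) (T.xi (T.mesh.mhi - 3)) ×ˢ
    Set.Icc (T.eta (T.mesh.nlo + 3)) (T.eta (T.mesh.nhi - 3))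

/-- `v` and `w` are the horizontal and the vertical index vector of the anchor `(a, b)`. -/
def IsIndexVectors (T : TSpline) (a b : ℤ) (v w : Fin 5 → ℤ) : Prop :=
  IndexMesh.Consecutive (T.mesh.hJ b) v ∧ v 2 = a ∧
    IndexMesh.Consecutive (T.mesh.vJ a) w ∧ w 2 = b

/-- The blending function with index vectors `v`, `w`, as a function on the reduced
parametric domain, extended by zero. -/
noncomputable def blending (T : TSpline) (v w : Fin 5 → ℤ) : ℝ × ℝ → ℝ :=
  T.domain.indicator fun z =>
    cubicBSpline (T.xi (T.mesh.mhi - 3)) (fun k => T.xi (v k)) z.1 *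
      cubicBSpline (T.eta (T.mesh.nhi - 3)) (fun k => T.eta (w k)) z.2

/-- The T-spline space: the span of the blending functions of all anchors. -/
noncomputable def space (T : TSpline) : Submodule ℝ (ℝ × ℝ → ℝ) :=
  Submodule.span ℝ {f | ∃ (a b : ℤ) (v w : Fin 5 → ℤ),
    T.mesh.IsAnchor a b ∧ T.IsIndexVectors a b v w ∧ f = T.blending v w}

/-- Inclusion of T-spline spaces, as spaces of functions on a common reduced
parametric domain. -/
def Nested (T₁ T₂ : TSpline) : Prop := T₁.domain = T₂.domain ∧ T₁.space ≤ T₂.space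

/-- The perturbed T-spline with constants `c` (horizontal) and `d` (vertical). -/
noncomputable def perturb (T : TSpline) (c d : ℤ → ℝ) (δ : ℝ) : TSpline where
  mesh := T.mesh.perturb
  xi := T.mesh.perturbKnots T.xi c δ
  eta := T.mesh.transpose.perturbKnots T.eta d δ

end TSpline

/-!
For `δ → 0` each perturbed knot tends to the knot of the column from which its segment comes
(`IndexMesh.perturbKnots_tendsto`), and the perturbation moves anchors and index vectors entry by
entry (`IndexMesh.AnalysisSuitable.consecutive_perturb`). Hence the perturbed blending function of
an anchor tends to the original one, pointwise off the finitely many knot lines. The point is that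
membership in a span is in general not preserved by such limits, since the coefficients may blow
up. It is preserved if the limits of the spanning functions are linearly independent, because
linear independence is an open condition (`mem_span_of_tendsto`). Blending functions of the limit
that vanish identically, as multiple knots permit, do no harm: off the knot lines their
perturbations vanish as well, eventually at each point.

The core is therefore that the nonvanishing blending functions of an analysis-suitable T-spline are
linearly independent (`TSpline.IsAnalysisSuitable.linearIndependent`). Tensor products of blossoms,
evaluated on a knot-free rectangle inside the support, form a dual basis, provided that any two
different anchors have different and *overlapping* index vectors in one of the two directions
(`TSpline.IsAnalysisSuitable.dualCompatible`): then the univariate functional of that direction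
annihilates the other B-spline.

Overlap is a purely combinatorial statement about the edges of the mesh
(`EdgeGrid.Suitable.overlap`). Take two anchors of minimal distance that overlap in neither
direction, the second one to the upper right of the first. Failure of horizontal overlap can only
arise while moving up from the first anchor to the next vertex, so it produces a vertical T-junction
pointing into the band of rows between the two; failure of vertical overlap likewise produces a
horizontal one. Both T-junctions are close enough to the first anchor for their extensions to meet,
which analysis-suitability forbids. Crossings are searched for inside one quadrant, to which the
other ones are reduced by reflection and transposition.

Finally, a linear relation between blending functions off the knot lines extends to the whole
parametric domain, because each coordinate can be approached from the side from which the
B-splines are continuous (`TSpline.blending_eq_sum_of_generic`).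
-/

/-! ### Counting lines between two indices -/

/-- `p` lies strictly between `a` and `b`, in either order. -/
def StrictlyBetween (a b p : ℤ) : Prop := (a < p ∧ p < b) ∨ (b < p ∧ p < a)

/-- No element of `S` lies strictly between `a` and `b`. -/
def NoneBetween (S : ℤ → Prop) (a b : ℤ) : Prop := ∀ p, StrictlyBetween a b p → ¬ S p

/-- At most one element of `S` lies strictly between `a` and `b`. If `S` is a set of lines and
`a ∈ S`, these are the `b` that lie in the span of the five consecutive lines around `a`. -/
def AtMostOneBetween (S : ℤ → Prop) (a b : ℤ) : Prop :=
  ∀ p q, StrictlyBetween a b p → StrictlyBetween a b q → S p → S q → p = q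

theorem NoneBetween.atMostOne {S : ℤ → Prop} {a b : ℤ} (h : NoneBetween S a b) :
    AtMostOneBetween S a b := fun p _ hp _ hS => absurd hS (h p hp)

theorem AtMostOneBetween.mono {S : ℤ → Prop} {a b a' b' : ℤ} (h : AtMostOneBetween S a b)
    (hs : ∀ p, StrictlyBetween a' b' p → StrictlyBetween a b p) : AtMostOneBetween S a' b' :=
  fun p q hp hq => h p q (hs p hp) (hs q hq)

theorem noneBetween_neg {S : ℤ → Prop} {a b : ℤ} :
    NoneBetween (fun p => S (-p)) a b ↔ NoneBetween S (-a) (-b) := by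
  constructor
  · intro h p hp hS
    exact h (-p) (by unfold StrictlyBetween at *; omega) (by simpa using hS)
  · intro h p hp
    exact h (-p) (by unfold StrictlyBetween at *; omega)

theorem atMostOneBetween_neg {S : ℤ → Prop} {a b : ℤ} :
    AtMostOneBetween (fun p => S (-p)) a b ↔ AtMostOneBetween S (-a) (-b) := by
  constructor
  · intro h p q hp hq hSp hSq
    have := h (-p) (-q) (by unfold StrictlyBetween at *; omega)
      (by unfold StrictlyBetween at *; omega)
      (by simpa using hSp) (by simpa using hSq)
    omega
  · intro h p q hp hq hSp hSq
    have := h (-p) (-q) (by unfold StrictlyBetween at *; omega)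
      (by unfold StrictlyBetween at *; omega) hSp hSq
    omega

theorem exists_first {P : ℤ → Prop} {x y : ℤ} (hxy : x ≤ y) (hy : P y) :
    ∃ f, x ≤ f ∧ f ≤ y ∧ P f ∧ ∀ z, x ≤ z → z < f → ¬ P z := by
  obtain ⟨f, ⟨h1, h2⟩, h3⟩ := Int.exists_least_of_bdd (P := fun z => x ≤ z ∧ P z)
    ⟨x, fun z hz => hz.1⟩ ⟨y, hxy, hy⟩
  exact ⟨f, h1, h3 y ⟨hxy, hy⟩, h2, fun z hz hzf hP => absurd (h3 z ⟨hz, hP⟩) (by omega)⟩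

theorem exists_last {P : ℤ → Prop} {x y : ℤ} (hxy : x ≤ y) (hx : P x) :
    ∃ f, x ≤ f ∧ f ≤ y ∧ P f ∧ ∀ z, f < z → z ≤ y → ¬ P z := by
  obtain ⟨f, ⟨h1, h2⟩, h3⟩ := Int.exists_greatest_of_bdd (P := fun z => z ≤ y ∧ P z)
    ⟨y, fun z hz => hz.1⟩ ⟨x, hxy, hx⟩
  exact ⟨f, h3 x ⟨hxy, hx⟩, h1, h2, fun z hz hzf hP => absurd (h3 z ⟨hzf, hP⟩) (by omega)⟩

/-! ### Grids of unit edges -/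

/-- The edges of a mesh, detached from its cells: `V i j` says that the unit edge
`{i} × [j, j+1]` is present, `H i j` that `[i, i+1] × {j}` is. The active region is
`[x0, x1] × [y0, y1]`. -/
structure EdgeGrid where
  V : ℤ → ℤ → Prop
  H : ℤ → ℤ → Prop
  x0 : ℤ
  x1 : ℤ
  y0 : ℤ
  y1 : ℤ

namespace EdgeGrid

variable {G : EdgeGrid}

/-- The grid with the coordinates interchanged. -/
def transpose (G : EdgeGrid) : EdgeGrid :=
  ⟨fun i j => G.H j i, fun i j => G.V j i, G.y0, G.y1, G.x0, G.x1⟩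

/-- The mirror image of the grid under `x ↦ -x`. -/
def flip (G : EdgeGrid) : EdgeGrid :=
  ⟨fun i j => G.V (-i) j, fun i j => G.H (-i - 1) j, -G.x1, -G.x0, G.y0, G.y1⟩

/-- The point `(i, j)` lies on a vertical edge. -/
def Vp (G : EdgeGrid) (i j : ℤ) : Prop := G.V i j ∨ G.V i (j - 1)

/-- The point `(i, j)` lies on a horizontal edge. -/
def Hp (G : EdgeGrid) (i j : ℤ) : Prop := G.transpose.Vp j i

/-- A vertical line ends at the active point `(k, e)`, coming from below. -/
def UpMissing (G : EdgeGrid) (k e : ℤ) : Prop :=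
  (G.x0 ≤ k ∧ k ≤ G.x1 ∧ G.y0 ≤ e ∧ e ≤ G.y1) ∧ G.V k (e - 1) ∧ ¬ G.V k e

/-- A vertical line ends at the active point `(k, e)`, coming from above. -/
def DownMissing (G : EdgeGrid) (k e : ℤ) : Prop :=
  (G.x0 ≤ k ∧ k ≤ G.x1 ∧ G.y0 ≤ e ∧ e ≤ G.y1) ∧ G.V k e ∧ ¬ G.V k (e - 1)

/-- The point `(x, y)` lies in the extension of a vertical T-junction: two lines far on the side
of the missing edge, one line far on the other side. -/
def VExt (G : EdgeGrid) (x y : ℤ) : Prop :=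
  ∃ e, (G.UpMissing x e ∧ ((e ≤ y ∧ AtMostOneBetween (G.Hp x) e y) ∨
        (y ≤ e ∧ NoneBetween (G.Hp x) e y))) ∨
      (G.DownMissing x e ∧ ((y ≤ e ∧ AtMostOneBetween (G.Hp x) e y) ∨
        (e ≤ y ∧ NoneBetween (G.Hp x) e y)))

/-- The point `(x, y)` lies in the extension of a horizontal T-junction. -/
def HExt (G : EdgeGrid) (x y : ℤ) : Prop := G.transpose.VExt y x

/-- The edges are those of a partition into rectangles, at least around the active region:
each unit square there lies in a rectangle whose sides consist of edges and whose interior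
contains no edge. -/
def Cellular (G : EdgeGrid) : Prop :=
  ∀ x y, G.x0 - 1 ≤ x → x ≤ G.x1 → G.y0 - 1 ≤ y → y ≤ G.y1 →
    ∃ l r b t, (l ≤ x ∧ x < r ∧ b ≤ y ∧ y < t) ∧
      (∀ j, b ≤ j → j < t → G.V l j ∧ G.V r j) ∧ (∀ i, l ≤ i → i < r → G.H i b ∧ G.H i t) ∧
      (∀ i j, l < i → i < r → b ≤ j → j < t → ¬ G.V i j) ∧
      (∀ i j, l ≤ i → i < r → b < j → j < t → ¬ G.H i j)

/-- The properties of analysis-suitable meshes that make their index vectors overlap. -/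
structure Suitable (G : EdgeGrid) : Prop where
  cell : G.Cellular
  colFull : ∀ i j, ((G.x0 - 2 ≤ i ∧ i ≤ G.x0 + 1) ∨ (G.x1 - 1 ≤ i ∧ i ≤ G.x1 + 2)) →
    G.y0 ≤ j → j < G.y1 → G.V i j
  colOut : ∀ i j, G.V i j → G.x0 - 2 ≤ i ∧ i ≤ G.x1 + 2
  rowFull : ∀ i j, ((G.y0 - 2 ≤ j ∧ j ≤ G.y0 + 1) ∨ (G.y1 - 1 ≤ j ∧ j ≤ G.y1 + 2)) →
    G.x0 ≤ i → i < G.x1 → G.H i j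
  rowOut : ∀ i j, G.H i j → G.y0 - 2 ≤ j ∧ j ≤ G.y1 + 2
  noCross : ∀ x y, ¬ (G.VExt x y ∧ G.HExt x y)

theorem Cellular.transpose (hG : G.Cellular) : G.transpose.Cellular := by
  intro x y h1 h2 h3 h4
  obtain ⟨l, r, b, t, ⟨a1, a2, a3, a4⟩, hv, hh, nv, nh⟩ := hG y x h3 h4 h1 h2
  exact ⟨b, t, l, r, ⟨a3, a4, a1, a2⟩, hh, hv, fun i j c1 c2 c3 c4 => nh j i c3 c4 c1 c2,
    fun i j c1 c2 c3 c4 => nv j i c3 c4 c1 c2⟩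

theorem Cellular.flip (hG : G.Cellular) : G.flip.Cellular := by
  intro x y h1 h2 h3 h4
  simp only [EdgeGrid.flip] at h1 h2 h3 h4
  obtain ⟨l, r, b, t, ⟨a1, a2, a3, a4⟩, hv, hh, nv, nh⟩ :=
    hG (-x - 1) y (by omega) (by omega) h3 h4
  refine ⟨-r, -l, b, t, ⟨by omega, by omega, a3, a4⟩, fun j c1 c2 => ?_,
    fun i c1 c2 => hh (-i - 1) (by omega) (by omega),
    fun i j c1 c2 c3 c4 => nv (-i) j (by omega) (by omega) c3 c4,
    fun i j c1 c2 c3 c4 => nh (-i - 1) j (by omega) (by omega) c3 c4⟩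
  have := hv j c1 c2
  simp only [EdgeGrid.flip, neg_neg]
  exact ⟨this.2, this.1⟩

theorem flip_Hp {i j : ℤ} : G.flip.Hp i j ↔ G.Hp (-i) j := by
  have h : -(i - 1) - 1 = -i := by ring
  simp only [Hp, Vp, EdgeGrid.transpose, EdgeGrid.flip, h]
  exact or_comm

theorem flip_VExt {x y : ℤ} : G.flip.VExt x y ↔ G.VExt (-x) y := by
  have hH : G.flip.Hp x = G.Hp (-x) := funext fun j => propext flip_Hp
  have hb : (G.flip.x0 ≤ x ∧ x ≤ G.flip.x1) ↔ (G.x0 ≤ -x ∧ -x ≤ G.x1) := by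
    simp only [EdgeGrid.flip]; omega
  have hu : ∀ e, G.flip.UpMissing x e ↔ G.UpMissing (-x) e := fun e => by
    simp only [UpMissing, ← and_assoc, hb]; rfl
  have hd : ∀ e, G.flip.DownMissing x e ↔ G.DownMissing (-x) e := fun e => by
    simp only [DownMissing, ← and_assoc, hb]; rfl
  simp only [VExt, hH, hu, hd]

theorem flip_HExt {x y : ℤ} : G.flip.HExt x y ↔ G.HExt (-x) y := by
  have hH : G.flip.transpose.Hp y = fun p => G.transpose.Hp y (-p) := rfl
  have hu : ∀ e, G.flip.transpose.UpMissing y e ↔ G.transpose.DownMissing y (-e) := fun e => by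
    have h : -(e - 1) - 1 = -e := by ring
    simp only [UpMissing, DownMissing, EdgeGrid.transpose, EdgeGrid.flip, h]
    constructor <;> rintro ⟨h1, h2, h3⟩ <;> exact ⟨by omega, h2, h3⟩
  have hd : ∀ e, G.flip.transpose.DownMissing y e ↔ G.transpose.UpMissing y (-e) := fun e => by
    have h : -(e - 1) - 1 = -e := by ring
    simp only [UpMissing, DownMissing, EdgeGrid.transpose, EdgeGrid.flip, h]
    constructor <;> rintro ⟨h1, h2, h3⟩ <;> exact ⟨by omega, h2, h3⟩
  simp only [HExt, VExt, hH, hu, hd, noneBetween_neg, atMostOneBetween_neg]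
  constructor
  · rintro ⟨e, h⟩
    refine ⟨-e, ?_⟩
    rcases h with ⟨h1, h2⟩ | ⟨h1, h2⟩
    · exact Or.inr ⟨h1, by rcases h2 with ⟨h, h'⟩ | ⟨h, h'⟩
                           · exact Or.inl ⟨by omega, h'⟩
                           · exact Or.inr ⟨by omega, h'⟩⟩
    · exact Or.inl ⟨h1, by rcases h2 with ⟨h, h'⟩ | ⟨h, h'⟩
                           · exact Or.inl ⟨by omega, h'⟩
                           · exact Or.inr ⟨by omega, h'⟩⟩
  · rintro ⟨e, h⟩
    refine ⟨-e, ?_⟩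
    rw [neg_neg]
    rcases h with ⟨h1, h2⟩ | ⟨h1, h2⟩
    · exact Or.inr ⟨h1, by rcases h2 with ⟨h, h'⟩ | ⟨h, h'⟩
                           · exact Or.inl ⟨by omega, h'⟩
                           · exact Or.inr ⟨by omega, h'⟩⟩
    · exact Or.inl ⟨h1, by rcases h2 with ⟨h, h'⟩ | ⟨h, h'⟩
                           · exact Or.inl ⟨by omega, h'⟩
                           · exact Or.inr ⟨by omega, h'⟩⟩

theorem Suitable.transpose (hG : G.Suitable) : G.transpose.Suitable where
  cell := hG.cell.transpose
  colFull := fun i j h1 h2 h3 => hG.rowFull j i h1 h2 h3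
  colOut := fun i j h => hG.rowOut j i h
  rowFull := fun i j h1 h2 h3 => hG.colFull j i h1 h2 h3
  rowOut := fun i j h => hG.colOut j i h
  noCross := fun x y h => hG.noCross y x ⟨h.2, h.1⟩

theorem Suitable.flip (hG : G.Suitable) : G.flip.Suitable where
  cell := hG.cell.flip
  colFull := fun i j h1 h2 h3 => hG.colFull (-i) j
    (by simp only [EdgeGrid.flip] at h1; omega) h2 h3
  colOut := fun i j h => by
    have := hG.colOut (-i) j h
    simp only [EdgeGrid.flip]; omega
  rowFull := fun i j h1 h2 h3 => hG.rowFull (-i - 1) j h1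
    (by simp only [EdgeGrid.flip] at h2 h3; omega) (by simp only [EdgeGrid.flip] at h2 h3; omega)
  rowOut := fun i j h => hG.rowOut (-i - 1) j h
  noCross := fun x y h => hG.noCross (-x) y ⟨flip_VExt.1 h.1, flip_HExt.1 h.2⟩

/-! ### T-junctions and their extensions -/

/-- At an active point where a horizontal line ends, the vertical line passes through. -/
theorem Cellular.vertical_of_right_missing (hG : G.Cellular) {x y : ℤ} (hx : G.x0 ≤ x)
    (hx' : x ≤ G.x1) (hy : G.y0 ≤ y) (hy' : y ≤ G.y1) (h1 : G.H (x - 1) y) (h2 : ¬ G.H x y) :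
    G.V x y ∧ G.V x (y - 1) := by
  obtain ⟨l, r, b, t, ⟨a1, a2, a3, a4⟩, hv, hh, nv, nh⟩ :=
    hG x y (by omega) hx' (by omega) hy'
  have hb : b ≠ y := by rintro rfl; exact h2 (hh x a1 a2).1
  have hl : l = x := by
    by_contra hne
    exact nh (x - 1) y (by omega) (by omega) (by omega) a4 h1
  subst hl
  exact ⟨(hv y a3 a4).1, (hv (y - 1) (by omega) (by omega)).1⟩

theorem Cellular.vertical_of_left_missing (hG : G.Cellular) {x y : ℤ} (hx : G.x0 ≤ x)
    (hx' : x ≤ G.x1) (hy : G.y0 ≤ y) (hy' : y ≤ G.y1) (h1 : G.H x y) (h2 : ¬ G.H (x - 1) y) :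
    G.V x y ∧ G.V x (y - 1) := by
  have e1 : -(-x - 1) - 1 = x := by ring
  have e2 : -(-x) - 1 = x - 1 := by ring
  have := hG.flip.vertical_of_right_missing (x := -x) (y := y)
    (by simp only [EdgeGrid.flip]; omega) (by simp only [EdgeGrid.flip]; omega) hy hy'
    (by simpa only [EdgeGrid.flip, e1] using h1) (by simpa only [EdgeGrid.flip, e2] using h2)
  simpa only [EdgeGrid.flip, neg_neg] using this

/-- All unit edges of row `q` between `p` and `k` are present. -/
def HSeg (G : EdgeGrid) (q p k : ℤ) : Prop :=
  ∀ x, (p ≤ x ∧ x < k) ∨ (k ≤ x ∧ x < p) → G.H x q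

/-- All unit edges of column `p` between `q` and `l` are present. -/
def VSeg (G : EdgeGrid) (p q l : ℤ) : Prop := G.transpose.HSeg p q l

theorem HSeg.hp {q p k : ℤ} (h : G.HSeg q p k) (hne : p ≠ k) : G.Hp p q ∧ G.Hp k q := by
  simp only [Hp, Vp, EdgeGrid.transpose]
  rcases lt_or_gt_of_ne hne with hlt | hlt
  · exact ⟨Or.inl (h p (by omega)), Or.inr (h (k - 1) (by omega))⟩
  · exact ⟨Or.inr (h (p - 1) (by omega)), Or.inl (h k (by omega))⟩

theorem VExt.active {x y : ℤ} (h : G.VExt x y) : G.x0 ≤ x ∧ x ≤ G.x1 := by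
  obtain ⟨e, ⟨⟨h, -⟩, -⟩ | ⟨⟨h, -⟩, -⟩⟩ := h <;> exact ⟨h.1, h.2.1⟩

/-- The case `x ≤ k` of `Suitable.row_edges`. -/
theorem Suitable.row_edges_right (hG : G.Suitable) {x k l : ℤ} (hE : G.VExt k l)
    (hl : G.y0 ≤ l) (hl' : l ≤ G.y1) (hx : G.x0 ≤ x) (hxk : x ≤ k)
    (h2 : AtMostOneBetween (fun i => G.Vp i l) x k) (hH : G.Hp x l ∨ G.Hp k l) :
    G.HSeg l x k := by
  intro y hy
  have hk := hE.active
  by_contra hny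
  refine hG.noCross k l ⟨hE, ?_⟩
  rcases hH with hH | hH
  · obtain ⟨f, f1, f2, f3, f4⟩ := exists_first (P := fun z => ¬ G.H z l)
      (show x ≤ y by omega) hny
    have hf : G.H (f - 1) l := by
      by_cases hfx : f = x
      · subst hfx; exact hH.resolve_left f3
      · exact not_not.1 (f4 (f - 1) (by omega) (by omega))
    exact ⟨f, Or.inl ⟨⟨⟨hl, hl', by simp only [EdgeGrid.transpose]; omega,
      by simp only [EdgeGrid.transpose]; omega⟩, hf, f3⟩,
      Or.inl ⟨by omega, h2.mono fun p hp => by unfold StrictlyBetween at *; omega⟩⟩⟩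
  · obtain ⟨f, f1, f2, f3, f4⟩ := exists_last (P := fun z => ¬ G.H (z - 1) l)
      (show y + 1 ≤ k by omega) (by simpa using hny)
    have hf : G.H f l := by
      by_cases hfk : f = k
      · subst hfk; exact hH.resolve_right f3
      · have := not_not.1 (f4 (f + 1) (by omega) (by omega))
        simpa using this
    have hv := hG.cell.vertical_of_left_missing (x := f) (by omega) (by omega) hl hl' hf f3
    refine ⟨f, Or.inr ⟨⟨⟨hl, hl', by simp only [EdgeGrid.transpose]; omega,
      by simp only [EdgeGrid.transpose]; omega⟩, hf, f3⟩,
      Or.inr ⟨by omega, fun p hp hS => ?_⟩⟩⟩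
    have := h2 p f (by unfold StrictlyBetween at *; omega)
      (by unfold StrictlyBetween at *; omega) hS (Or.inl hv.1)
    unfold StrictlyBetween at hp
    omega

/-- In a row that meets the extension of a vertical T-junction in column `k`, a horizontal line
neither starts nor ends within two lines of `k`: otherwise two extensions would meet. -/
theorem Suitable.row_edges (hG : G.Suitable) {x k l : ℤ} (hE : G.VExt k l)
    (hl : G.y0 ≤ l) (hl' : l ≤ G.y1) (hx : G.x0 ≤ x) (hx' : x ≤ G.x1)
    (h2 : AtMostOneBetween (fun i => G.Vp i l) x k) (hH : G.Hp x l ∨ G.Hp k l) :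
    G.HSeg l x k := by
  rcases le_total x k with h | h
  · exact hG.row_edges_right hE hl hl' hx h h2 hH
  · have := hG.flip.row_edges_right (x := -x) (k := -k) (l := l)
      (by rw [flip_VExt, neg_neg]; exact hE) hl hl'
      (by simp only [EdgeGrid.flip]; omega) (by omega)
      ((atMostOneBetween_neg (S := fun i => G.Vp i l)).2 (by simpa only [neg_neg] using h2))
      (by simpa only [flip_Hp, neg_neg] using hH)
    intro y hy
    have := this (-y - 1) (by omega)
    have e : -(-y - 1) - 1 = y := by ring
    simpa only [EdgeGrid.flip, e] using this

/-- Column `k` contains a T-junction whose missing edge lies in the band of rows `[b, d]`. -/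
def JunctionIn (G : EdgeGrid) (k b d : ℤ) : Prop :=
  ∃ e, (b ≤ e ∧ e < d ∧ G.UpMissing k e) ∨ (b < e ∧ e ≤ d ∧ G.DownMissing k e)

theorem JunctionIn.active {k b d : ℤ} (h : G.JunctionIn k b d) : G.x0 ≤ k ∧ k ≤ G.x1 := by
  obtain ⟨e, ⟨-, -, h, -⟩ | ⟨-, -, h, -⟩⟩ := h <;> exact ⟨h.1, h.2.1⟩

/-- Without T-junctions pointing into a band, a line of the band runs through it. -/
theorem Suitable.full_of_not_junctionIn (hG : G.Suitable) {k b d y : ℤ} (hb : G.y0 ≤ b)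
    (hd : d ≤ G.y1) (hJ : ¬ G.JunctionIn k b d) (hy : b ≤ y) (hy' : y ≤ d) (hV : G.Vp k y) :
    ∀ z, b ≤ z → z < d → G.V k z := by
  intro z hz hz'
  by_contra hnz
  have hout : G.x0 - 2 ≤ k ∧ k ≤ G.x1 + 2 := by
    rcases hV with h | h <;> exact hG.colOut _ _ h
  have hk : G.x0 ≤ k ∧ k ≤ G.x1 := by
    by_contra hcon
    exact hnz (hG.colFull k z (by omega) (by omega) (by omega))
  rcases le_or_gt y z with h | h
  · obtain ⟨f, f1, f2, f3, f4⟩ := exists_first (P := fun w => ¬ G.V k w) h hnz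
    have hf : G.V k (f - 1) := by
      by_cases hfy : f = y
      · subst hfy; exact hV.resolve_left f3
      · exact not_not.1 (f4 (f - 1) (by omega) (by omega))
    exact hJ ⟨f, Or.inl ⟨by omega, by omega, ⟨hk.1, hk.2, by omega, by omega⟩, hf, f3⟩⟩
  · obtain ⟨f, f1, f2, f3, f4⟩ := exists_last (P := fun w => ¬ G.V k (w - 1))
      (show z + 1 ≤ y by omega) (by simpa using hnz)
    have hf : G.V k f := by
      by_cases hfy : f = y
      · subst hfy; exact hV.resolve_right f3
      · have := not_not.1 (f4 (f + 1) (by omega) (by omega))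
        simpa using this
    exact hJ ⟨f, Or.inr ⟨by omega, by omega, ⟨hk.1, hk.2, by omega, by omega⟩, hf, f3⟩⟩

theorem Suitable.vp_of_not_junctionIn (hG : G.Suitable) {k b d y : ℤ} (hb : G.y0 ≤ b)
    (hd : d ≤ G.y1) (hbd : b < d) (hJ : ¬ G.JunctionIn k b d) (hy : b ≤ y) (hy' : y ≤ d)
    (hV : G.Vp k y) : ∀ z, b ≤ z → z ≤ d → G.Vp k z := by
  intro z hz hz'
  have := hG.full_of_not_junctionIn hb hd hJ hy hy' hV
  rcases hz'.lt_or_eq with h | h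
  · exact Or.inl (this z hz h)
  · exact Or.inr (this (z - 1) (by omega) (by omega))

theorem JunctionIn.vExt {k b d : ℤ} (h : G.JunctionIn k b d) :
    ∃ e, b ≤ e ∧ e ≤ d ∧ ∀ y, NoneBetween (G.Hp k) e y → G.VExt k y := by
  obtain ⟨e, ⟨h1, h2, h3⟩ | ⟨h1, h2, h3⟩⟩ := h
  · refine ⟨e, h1, h2.le, fun y hy => ⟨e, Or.inl ⟨h3, ?_⟩⟩⟩
    rcases le_total e y with h | h
    · exact Or.inl ⟨h, hy.atMostOne⟩
    · exact Or.inr ⟨h, hy⟩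
  · refine ⟨e, h1.le, h2, fun y hy => ⟨e, Or.inr ⟨h3, ?_⟩⟩⟩
    rcases le_total e y with h | h
    · exact Or.inr ⟨h, hy⟩
    · exact Or.inl ⟨h, hy.atMostOne⟩

/-! ### Overlap of index vectors -/

/-- The horizontal index vectors of the anchors `(a, b)` and `(a', b')` overlap: a column in the
span of both belongs to both or to neither. -/
def HOverlap (G : EdgeGrid) (a b a' b' : ℤ) : Prop :=
  ∀ k, AtMostOneBetween (fun i => G.Vp i b) a k → AtMostOneBetween (fun i => G.Vp i b') a' k →
    (G.Vp k b ↔ G.Vp k b')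

/-- The vertical index vectors of the anchors `(a, b)` and `(a', b')` overlap. -/
def VOverlap (G : EdgeGrid) (a b a' b' : ℤ) : Prop := G.transpose.HOverlap b a b' a'

theorem HOverlap.symm {a b a' b' : ℤ} (h : G.HOverlap a b a' b') : G.HOverlap a' b' a b :=
  fun k h1 h2 => (h k h2 h1).symm

theorem flip_HOverlap {a b a' b' : ℤ} :
    G.flip.HOverlap a b a' b' ↔ G.HOverlap (-a) b (-a') b' := by
  constructor
  · intro h k h1 h2
    have := h (-k) ((atMostOneBetween_neg (S := fun i => G.Vp i b)).2 (by simpa using h1))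
      ((atMostOneBetween_neg (S := fun i => G.Vp i b')).2 (by simpa using h2))
    simpa only [Vp, EdgeGrid.flip, neg_neg] using this
  · intro h k h1 h2
    exact h (-k) ((atMostOneBetween_neg (S := fun i => G.Vp i b)).1 h1)
      ((atMostOneBetween_neg (S := fun i => G.Vp i b')).1 h2)

theorem flip_VOverlap {a b a' b' : ℤ} :
    G.flip.VOverlap a b a' b' ↔ G.VOverlap (-a) b (-a') b' := by
  have h : ∀ i j, G.flip.transpose.Vp j i ↔ G.transpose.Vp j (-i) := fun i j => flip_Hp
  simp only [VOverlap, HOverlap, h]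

/-- If `k < x ≤ a'` is within the span of the index vector at `(a', b')`, it is within that of an
overlapping index vector at `(x, y)`. -/
theorem HOverlap.atMostOne_of_lt {x y a' b' k : ℤ} (h : G.HOverlap x y a' b') (hx : x ≤ a')
    (hk : k < x) (hk2 : AtMostOneBetween (fun i => G.Vp i b') a' k) :
    AtMostOneBetween (fun i => G.Vp i y) x k := by
  have key : ∀ p q, k < p → p < q → q < x → G.Vp p y → G.Vp q y → False := by
    intro p q hp hpq hq hVp hVq
    -- the two lines of row `y` closest to `x` are inherited by row `b'`
    obtain ⟨q', q1, q2, q3, q4⟩ :=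
      exists_last (P := fun z => G.Vp z y) (show q ≤ x - 1 by omega) hVq
    obtain ⟨p', p1, p2, p3, p4⟩ :=
      exists_last (P := fun z => G.Vp z y) (show p ≤ q' - 1 by omega) hVp
    have hq' := h q' (fun r s hr hs hVr _ => absurd hVr (q4 r
      (by unfold StrictlyBetween at *; omega) (by unfold StrictlyBetween at *; omega)))
      (hk2.mono fun r hr => by unfold StrictlyBetween at *; omega)
    have only : ∀ r, StrictlyBetween x p' r → G.Vp r y → r = q' := by
      intro r hr hVr
      unfold StrictlyBetween at hr
      by_contra hne
      rcases lt_or_gt_of_ne hne with hlt | hlt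
      · exact p4 r (by omega) (by omega) hVr
      · exact q4 r (by omega) (by omega) hVr
    have hp' := h p' (fun r s hr hs hVr hVs => (only r hr hVr).trans (only s hs hVs).symm)
      (hk2.mono fun r hr => by unfold StrictlyBetween at *; omega)
    have := hk2 p' q' (by unfold StrictlyBetween; omega) (by unfold StrictlyBetween; omega)
      (hp'.1 p3) (hq'.1 q3)
    omega
  intro p q hp hq hVp hVq
  by_contra hne
  unfold StrictlyBetween at hp hq
  rcases lt_or_gt_of_ne hne with hlt | hlt
  · exact key p q (by omega) hlt (by omega) hVp hVq
  · exact key q p (by omega) hlt (by omega) hVq hVp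

theorem HOverlap.atMostOne_of_gt {x y a b k : ℤ} (h : G.HOverlap a b x y) (hx : a ≤ x)
    (hk : x < k) (hk2 : AtMostOneBetween (fun i => G.Vp i b) a k) :
    AtMostOneBetween (fun i => G.Vp i y) x k := by
  have h' : G.flip.HOverlap (-x) y (-a) b := flip_HOverlap.2 (by simpa only [neg_neg] using h.symm)
  have := h'.atMostOne_of_lt (k := -k) (by omega) (by omega)
    ((atMostOneBetween_neg (S := fun i => G.Vp i b)).2 (by simpa only [neg_neg] using hk2))
  simpa only [neg_neg] using (atMostOneBetween_neg (S := fun i => G.Vp i y)).1 this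

/-- Overlap is transitive along a chain of increasing columns. -/
theorem HOverlap.trans {a b x y a' b' : ℤ} (h1 : G.HOverlap a b x y) (h2 : G.HOverlap x y a' b')
    (hx : a ≤ x) (hx' : x ≤ a') : G.HOverlap a b a' b' := by
  intro k hk hk'
  have : AtMostOneBetween (fun i => G.Vp i y) x k := by
    rcases lt_trichotomy k x with h | h | h
    · exact h2.atMostOne_of_lt hx' h hk'
    · subst h; intro p q hp; unfold StrictlyBetween at hp; omega
    · exact h1.atMostOne_of_gt hx h hk
  exact (h1 k hk this).trans (h2 k this hk')

/-- `k` is the closest column to the left or to the right of `a` with a T-junction that points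
into the band of rows `[b, d]`, and it lies in the part of the index vectors at column `a` that
matters for overlap with anchors to the right of `a`. -/
structure Obstruction (G : EdgeGrid) (a b d k : ℤ) : Prop where
  ne : k ≠ a
  junction : G.JunctionIn k b d
  clear : ∀ p, StrictlyBetween a k p → ¬ G.JunctionIn p b d
  right : a < k → ∀ y, b ≤ y → y ≤ d → AtMostOneBetween (fun i => G.Vp i y) a k
  left : k < a → ∀ y, b ≤ y → y ≤ d → NoneBetween (fun i => G.Vp i y) a k

/-- If moving the anchor `(a, b)` up to `(a, d)` creates overlap with an anchor further to the
right, some T-junction between the rows `b` and `d` is responsible. -/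
theorem Suitable.exists_obstruction (hG : G.Suitable) {a b d a' b' : ℤ} (haa : a < a')
    (hbd : b < d) (hb : G.y0 ≤ b) (hd : d ≤ G.y1) (hVa : G.Vp a b) (hVd : G.Vp a d)
    (hov : G.HOverlap a d a' b') (hn : ¬ G.HOverlap a b a' b') : ∃ k, G.Obstruction a b d k := by
  unfold HOverlap at hn
  push Not at hn
  obtain ⟨k₀, h1, h2, h3⟩ := hn
  have h3' : ¬ (G.Vp k₀ b ↔ G.Vp k₀ b') := by tauto
  clear h3
  have clean : ∀ p, ¬ G.JunctionIn p b d → ∀ y, b ≤ y → y ≤ d → ∀ z, b ≤ z → z ≤ d →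
      G.Vp p y → G.Vp p z := fun p hp y y1 y2 z z1 z2 hV =>
    hG.vp_of_not_junctionIn hb hd hbd hp y1 y2 hV z z1 z2
  rcases lt_trichotomy a k₀ with hlt | heq | hlt
  · have hex : ∃ k, a + 1 ≤ k ∧ k ≤ k₀ ∧ G.JunctionIn k b d := by
      by_contra hcon
      push Not at hcon
      have same : ∀ p, a < p → p ≤ k₀ → (G.Vp p b ↔ G.Vp p d) := fun p p1 p2 =>
        ⟨clean p (hcon p (by omega) p2) b le_rfl hbd.le d hbd.le le_rfl,
          clean p (hcon p (by omega) p2) d hbd.le le_rfl b le_rfl hbd.le⟩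
      refine h3' ((same k₀ hlt le_rfl).trans (hov k₀ (fun p q hp hq hVp hVq => ?_) h2))
      exact h1 p q hp hq ((same p (by unfold StrictlyBetween at hp; omega)
        (by unfold StrictlyBetween at hp; omega)).2 hVp)
        ((same q (by unfold StrictlyBetween at hq; omega)
        (by unfold StrictlyBetween at hq; omega)).2 hVq)
    obtain ⟨k', k1, k2, hJ'⟩ := hex
    obtain ⟨k, f1, f2, hJ, f4⟩ := exists_first (P := fun z => G.JunctionIn z b d) k1 hJ'
    have hclear : ∀ p, StrictlyBetween a k p → ¬ G.JunctionIn p b d := fun p hp =>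
      f4 p (by unfold StrictlyBetween at hp; omega) (by unfold StrictlyBetween at hp; omega)
    refine ⟨k, by omega, hJ, hclear, fun _ y y1 y2 p q hp hq hVp hVq => ?_, fun h => by omega⟩
    exact h1 p q (by unfold StrictlyBetween at *; omega) (by unfold StrictlyBetween at *; omega)
      (clean p (hclear p hp) y y1 y2 b le_rfl hbd.le hVp)
      (clean q (hclear q hq) y y1 y2 b le_rfl hbd.le hVq)
  · subst heq
    exact absurd (iff_of_true hVa
      ((hov a (fun p q hp => by unfold StrictlyBetween at hp; omega) h2).1 hVd)) h3'
  · have hVab' : G.Vp a b' :=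
      (hov a (fun p q hp => by unfold StrictlyBetween at hp; omega)
        (h2.mono fun p hp => by unfold StrictlyBetween at *; omega)).1 hVd
    have hnone : NoneBetween (fun i => G.Vp i d) a k₀ := by
      intro p hp hVp
      unfold StrictlyBetween at hp
      obtain ⟨q, q1, q2, q3, q4⟩ :=
        exists_last (P := fun z => G.Vp z d) (show p ≤ a - 1 by omega) hVp
      have hq : G.Vp q b' := (hov q
        (NoneBetween.atMostOne fun r hr => q4 r (by unfold StrictlyBetween at hr; omega)
          (by unfold StrictlyBetween at hr; omega))
        (h2.mono fun p hp => by unfold StrictlyBetween at *; omega)).1 q3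
      have := h2 q a (by unfold StrictlyBetween; omega) (by unfold StrictlyBetween; omega) hq hVab'
      omega
    have hex : ∃ k, k₀ ≤ k ∧ k ≤ a - 1 ∧ G.JunctionIn k b d := by
      by_contra hcon
      push Not at hcon
      have hk := hcon k₀ le_rfl (by omega)
      have same : G.Vp k₀ b ↔ G.Vp k₀ d := ⟨clean k₀ hk b le_rfl hbd.le d hbd.le le_rfl,
        clean k₀ hk d hbd.le le_rfl b le_rfl hbd.le⟩
      exact h3' (same.trans (hov k₀ hnone.atMostOne h2))
    obtain ⟨k', k1, k2, hJ'⟩ := hex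
    obtain ⟨k, f1, f2, hJ, f4⟩ := exists_last (P := fun z => G.JunctionIn z b d) k2 hJ'
    have hclear : ∀ p, StrictlyBetween a k p → ¬ G.JunctionIn p b d := fun p hp =>
      f4 p (by unfold StrictlyBetween at hp; omega) (by unfold StrictlyBetween at hp; omega)
    refine ⟨k, by omega, hJ, hclear, fun h => by omega, fun _ y y1 y2 p hp hVp => ?_⟩
    exact hnone p (by unfold StrictlyBetween at *; omega)
      (clean p (hclear p hp) y y1 y2 d hbd.le le_rfl hVp)

/-- What an obstruction in column `k` yields if no horizontal line meets column `a` strictly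
inside the band: the extension of its T-junction covers the band and reaches at least to the
next horizontal lines below and above. -/
structure Covers (G : EdgeGrid) (b d k : ℤ) : Prop where
  mid : ∀ y, b ≤ y → y ≤ d → G.VExt k y
  below : ∀ y, y < b → NoneBetween (G.Hp k) b y → G.VExt k y
  above : ∀ y, d < y → NoneBetween (G.Hp k) d y → G.VExt k y

theorem Obstruction.atMostOne {a b d k : ℤ} (h : G.Obstruction a b d k) {y : ℤ} (hy : b ≤ y)
    (hy' : y ≤ d) : AtMostOneBetween (fun i => G.Vp i y) a k := by
  rcases lt_or_gt_of_ne h.ne with hlt | hlt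
  · exact (h.left hlt y hy hy').atMostOne
  · exact h.right hlt y hy hy'

theorem Suitable.obstruction_covers (hG : G.Suitable) {a b d k : ℤ} (hr : G.Obstruction a b d k)
    (ha : G.x0 ≤ a) (ha' : a ≤ G.x1) (hb : G.y0 ≤ b) (hd : d ≤ G.y1)
    (hno : ∀ y, b < y → y < d → ¬ G.Hp a y) : G.Covers b d k := by
  have habs : ∀ y, b < y → y < d → G.VExt k y → ¬ G.Hp k y := fun y y1 y2 hE hH =>
    hno y y1 y2 ((hG.row_edges hE (by omega) (by omega) ha ha'
      (hr.atMostOne y1.le y2.le) (Or.inr hH)).hp (Ne.symm hr.ne)).1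
  obtain ⟨e, e1, e2, hE⟩ := hr.junction.vExt
  have hnone : ∀ y, b < y → y < d → ¬ G.Hp k y := by
    intro y y1 y2 hH
    rcases le_total e y with h | h
    · obtain ⟨z, z1, z2, ⟨z3, z4⟩, z5⟩ :=
        exists_first (P := fun z => b < z ∧ G.Hp k z) h ⟨y1, hH⟩
      exact habs z z3 (by omega) (hE z fun w hw hHw => z5 w (by unfold StrictlyBetween at hw; omega)
        (by unfold StrictlyBetween at hw; omega)
        ⟨by unfold StrictlyBetween at hw; omega, hHw⟩) z4
    · obtain ⟨z, z1, z2, ⟨z3, z4⟩, z5⟩ :=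
        exists_last (P := fun z => z < d ∧ G.Hp k z) h ⟨y2, hH⟩
      exact habs z (by omega) z3 (hE z fun w hw hHw => z5 w (by unfold StrictlyBetween at hw; omega)
        (by unfold StrictlyBetween at hw; omega)
        ⟨by unfold StrictlyBetween at hw; omega, hHw⟩) z4
  refine ⟨fun y y1 y2 => hE y fun w hw => hnone w (by unfold StrictlyBetween at hw; omega)
    (by unfold StrictlyBetween at hw; omega), fun y hy hN => ?_, fun y hy hN => ?_⟩
  · obtain ⟨e, ⟨h1, h2, h3⟩ | ⟨h1, h2, h3⟩⟩ := hr.junction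
    · refine ⟨e, Or.inl ⟨h3, Or.inr ⟨by omega, fun w hw hHw => ?_⟩⟩⟩
      have heb : e = b := by
        by_contra hne
        have hv := hG.transpose.cell.vertical_of_right_missing (x := e) (y := k)
          h3.1.2.2.1 h3.1.2.2.2 h3.1.1 h3.1.2.1 h3.2.1 h3.2.2
        exact hnone e (by omega) h2 (Or.inl hv.1)
      subst heb
      exact hN w hw hHw
    · refine ⟨e, Or.inr ⟨h3, Or.inl ⟨by omega, ?_⟩⟩⟩
      have only : ∀ w, StrictlyBetween e y w → G.Hp k w → w = b := by
        intro w hw hHw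
        unfold StrictlyBetween at hw
        by_contra hne
        rcases lt_or_gt_of_ne hne with hlt | hlt
        · exact hN w (by unfold StrictlyBetween; omega) hHw
        · exact hnone w hlt (by omega) hHw
      exact fun p q hp hq hp' hq' => (only p hp hp').trans (only q hq hq').symm
  · obtain ⟨e, ⟨h1, h2, h3⟩ | ⟨h1, h2, h3⟩⟩ := hr.junction
    · refine ⟨e, Or.inl ⟨h3, Or.inl ⟨by omega, ?_⟩⟩⟩
      have only : ∀ w, StrictlyBetween e y w → G.Hp k w → w = d := by
        intro w hw hHw
        unfold StrictlyBetween at hw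
        by_contra hne
        rcases lt_or_gt_of_ne hne with hlt | hlt
        · exact hnone w (by omega) hlt hHw
        · exact hN w (by unfold StrictlyBetween; omega) hHw
      exact fun p q hp hq hp' hq' => (only p hp hp').trans (only q hq hq').symm
    · refine ⟨e, Or.inr ⟨h3, Or.inr ⟨by omega, fun w hw hHw => ?_⟩⟩⟩
      have heb : e = d := by
        by_contra hne
        have hv := hG.transpose.cell.vertical_of_left_missing (x := e) (y := k)
          h3.1.2.2.1 h3.1.2.2.2 h3.1.1 h3.1.2.1 h3.2.1 h3.2.2
        exact hnone e h1 (by omega) (Or.inl hv.1)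
      subst heb
      exact hN w hw hHw

/-! ### Crossing extensions -/

/-- The quadrant with corner `(p, q)` that contains `(k, l)`: both lines leaving the corner are
present and free of crossing lines up to `k` and `l`, and the column `k` and the row `l` carry
T-junctions whose extensions are only stopped by a line between them and the corner. -/
structure QuadrantConfig (G : EdgeGrid) (p q k l : ℤ) : Prop where
  hseg : G.HSeg q p k
  vseg : G.VSeg p q l
  hnone : NoneBetween (fun i => G.Vp i q) p k
  vnone : NoneBetween (G.Hp p) q l
  vext : ∀ y, (y = l ∨ StrictlyBetween q l y) → NoneBetween (G.Hp k) q y → G.VExt k y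
  hext : ∀ x, (x = k ∨ StrictlyBetween p k x) → NoneBetween (fun i => G.Vp i l) p x → G.HExt x l

theorem QuadrantConfig.transpose {p q k l : ℤ} (h : G.QuadrantConfig p q k l) :
    G.transpose.QuadrantConfig q p l k :=
  ⟨h.vseg, h.hseg, h.vnone, h.hnone, h.hext, h.vext⟩

theorem QuadrantConfig.flip {p q k l : ℤ} (h : G.QuadrantConfig p q k l) :
    G.flip.QuadrantConfig (-p) q (-k) l where
  hseg := fun x hx => h.hseg (-x - 1) (by omega)
  vseg := fun y hy => by
    have := h.vseg y hy
    simpa only [VSeg, HSeg, EdgeGrid.transpose, EdgeGrid.flip, neg_neg] using this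
  hnone := (noneBetween_neg (S := fun i => G.Vp i q)).2 (by simpa only [neg_neg] using h.hnone)
  vnone := fun y hy hH => h.vnone y hy (by simpa only [flip_Hp, neg_neg] using hH)
  vext := fun y hy hN => by
    rw [flip_VExt, neg_neg]
    exact h.vext y hy fun w hw hH => hN w hw (by simpa only [flip_Hp, neg_neg] using hH)
  hext := fun x hx hN => by
    rw [flip_HExt]
    exact h.hext (-x) (by unfold StrictlyBetween at *; omega) (by
      simpa only [neg_neg] using (noneBetween_neg (S := fun i => G.Vp i l)).1 hN)

/-- In the first quadrant, the extension in row `l` reaches column `k`: the corner is that of a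
cell that contains `]p, k[ × ]q, l[`, so that a vertical line stopping the extension would end at
row `l`, coming from above. But then it would be a T-junction whose extension meets row `l`. -/
theorem QuadrantConfig.hExt_of_lt (hG : G.Suitable) {p q k l : ℤ}
    (h : G.QuadrantConfig p q k l) (hp : G.x0 ≤ p) (hq : G.y0 ≤ q) (hl : l ≤ G.y1)
    (hk' : k ≤ G.x1) (hpk : p < k) (hql : q < l) : G.HExt k l := by
  refine h.hext k (Or.inl rfl) ?_
  intro g' hg' hVg'
  unfold StrictlyBetween at hg'
  obtain ⟨g, g1, g2, g3, g4⟩ :=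
    exists_first (P := fun z => G.Vp z l) (show p + 1 ≤ g' by omega) hVg'
  obtain ⟨x, r, y, t, ⟨a1, a2, a3, a4⟩, hv, hh, nv, nh⟩ :=
    hG.cell p q (by omega) (by omega) (by omega) (by omega)
  have hR : G.H p q := h.hseg p (by omega)
  have hU : G.V p q := h.vseg q (by omega)
  have hy : y = q := by
    by_contra hne; exact nh p q a1 a2 (by omega) a4 hR
  have hx : x = p := by
    by_contra hne; exact nv p q (by omega) a2 a3 a4 hU
  subst hy hx
  have hr : k ≤ r := by
    by_contra hlt
    exact h.hnone r (by unfold StrictlyBetween; omega) (Or.inl (hv y le_rfl a4).2)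
  have ht : l ≤ t := by
    by_contra hlt
    exact h.vnone t (by unfold StrictlyBetween; omega) (Or.inl (hh x le_rfl a2).2)
  have hnV : ¬ G.V g (l - 1) := nv g (l - 1) (by omega) (by omega) (by omega) (by omega)
  have hUg : G.V g l := g3.resolve_right hnV
  have hE : G.VExt g l := ⟨l, Or.inr ⟨⟨⟨by omega, by omega, by omega, hl⟩, hUg, hnV⟩,
    Or.inl ⟨le_rfl, fun w _ hw => by unfold StrictlyBetween at hw; omega⟩⟩⟩
  refine hG.noCross g l ⟨hE, h.hext g (Or.inr (by unfold StrictlyBetween; omega)) ?_⟩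
  intro w hw
  unfold StrictlyBetween at hw
  exact g4 w (by omega) (by omega)

theorem QuadrantConfig.false_of_lt (hG : G.Suitable) {p q k l : ℤ}
    (h : G.QuadrantConfig p q k l) (hp : G.x0 ≤ p) (hq : G.y0 ≤ q) (hl : l ≤ G.y1)
    (hk : k ≤ G.x1) (hpk : p < k) (hql : q < l) : False :=
  hG.noCross k l ⟨h.transpose.hExt_of_lt hG.transpose hq hp hk hl hql hpk,
    h.hExt_of_lt hG hp hq hl hk hpk hql⟩

theorem QuadrantConfig.false_of_lt_right (hG : G.Suitable) {p q k l : ℤ}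
    (h : G.QuadrantConfig p q k l) (hp : G.x0 ≤ p ∧ p ≤ G.x1) (hq : G.y0 ≤ q)
    (hl : l ≤ G.y1) (hk : G.x0 ≤ k ∧ k ≤ G.x1) (hpk : p ≠ k) (hql : q < l) : False := by
  rcases lt_or_gt_of_ne hpk with hlt | hlt
  · exact h.false_of_lt hG hp.1 hq hl hk.2 hlt hql
  · exact h.flip.false_of_lt hG.flip (by simp only [EdgeGrid.flip]; omega) hq hl
      (by simp only [EdgeGrid.flip]; omega) (by omega) hql

theorem QuadrantConfig.false (hG : G.Suitable) {p q k l : ℤ}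
    (h : G.QuadrantConfig p q k l) (hp : G.x0 ≤ p ∧ p ≤ G.x1) (hq : G.y0 ≤ q ∧ q ≤ G.y1)
    (hl : G.y0 ≤ l ∧ l ≤ G.y1) (hk : G.x0 ≤ k ∧ k ≤ G.x1) (hpk : p ≠ k) (hql : q ≠ l) :
    False := by
  rcases lt_or_gt_of_ne hql with hlt | hlt
  · exact h.false_of_lt_right hG hp hq.1 hl.2 hk hpk hlt
  · exact h.transpose.flip.transpose.false_of_lt_right hG.transpose.flip.transpose
      hp (by simp only [EdgeGrid.flip, EdgeGrid.transpose]; omega)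
      (by simp only [EdgeGrid.flip, EdgeGrid.transpose]; omega) hk hpk (by omega)

/-- The situation above an anchor `(a, b)` that does not overlap horizontally with `(a', b')`:
`(a, d)` is the next vertex on column `a`, or the point of row `b'` if the column gets there
without meeting a vertex, and some T-junction in column `k` points into the band `[b, d]`. -/
structure Band (G : EdgeGrid) (a b a' b' d k : ℤ) : Prop where
  lt : b < d
  le : d ≤ b'
  none : ∀ y, b < y → y < d → ¬ G.Hp a y
  seg : G.VSeg a b d
  top : G.Hp a d ∨ d = b'
  overlap : G.HOverlap a d a' b'
  obs : G.Obstruction a b d k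
  cov : G.Covers b d k

/-- An anchor that does not overlap horizontally with `(a', b')`, although those above it on the
same column do, has a band with an obstruction above it. -/
theorem Suitable.exists_band (hG : G.Suitable) {a b a' b' : ℤ} (haa : a < a') (hbb : b < b')
    (ha : G.x0 ≤ a ∧ a ≤ G.x1) (hb : G.y0 ≤ b) (hb' : b' ≤ G.y1) (hV : G.V a b)
    (ih : ∀ d, b < d → d < b' → G.Vp a d → G.Hp a d → G.HOverlap a d a' b')
    (hn : ¬ G.HOverlap a b a' b') : ∃ d k, G.Band a b a' b' d k := by
  obtain ⟨d, d1, d2, d3, d4⟩ :=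
    exists_first (P := fun z => G.Hp a z ∨ z = b') (show b + 1 ≤ b' by omega) (Or.inr rfl)
  have hnone : ∀ y, b < y → y < d → ¬ G.Hp a y := fun y y1 y2 hH =>
    d4 y (by omega) y2 (Or.inl hH)
  have hseg : ∀ y, b ≤ y → y < d → G.V a y := by
    intro y y1 y2
    by_contra hny
    obtain ⟨f, f1, f2, f3, f4⟩ := exists_first (P := fun z => ¬ G.V a z) y1 hny
    have hfb : f ≠ b := by rintro rfl; exact f3 hV
    have hf : G.V a (f - 1) := not_not.1 (f4 (f - 1) (by omega) (by omega))
    have := hG.transpose.cell.vertical_of_right_missing (x := f) (y := a)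
      (by simp only [EdgeGrid.transpose]; omega) (by simp only [EdgeGrid.transpose]; omega)
      ha.1 ha.2 hf f3
    exact hnone f (by omega) (by omega) (Or.inl this.1)
  have hVd : G.Vp a d := Or.inr (hseg (d - 1) (by omega) (by omega))
  have hov : G.HOverlap a d a' b' := by
    rcases eq_or_ne d b' with h | h
    · subst h; exact fun k _ _ => Iff.rfl
    · exact ih d (by omega) (by omega) hVd (d3.resolve_right h)
  obtain ⟨k, hk⟩ := hG.exists_obstruction haa (show b < d by omega) hb (by omega)
    (Or.inl hV) hVd hov hn
  exact ⟨d, k, by omega, d2, hnone, fun y hy => hseg y (by omega) (by omega), d3, hov, hk,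
    hG.obstruction_covers hk ha.1 ha.2 hb (by omega) hnone⟩

/-- An anchor whose right edge is missing overlaps: its extension would meet the one of the
obstruction. -/
theorem Suitable.right_edge (hG : G.Suitable) {a b a' b' : ℤ} (haa : a < a') (hbb : b < b')
    (ha : G.x0 ≤ a ∧ a ≤ G.x1) (hb : G.y0 ≤ b) (hb' : b' ≤ G.y1) (hH : G.Hp a b)
    (ih : ∀ d, b < d → d < b' → G.Vp a d → G.Hp a d → G.HOverlap a d a' b')
    (hn : ¬ G.HOverlap a b a' b') : G.H a b := by
  by_contra hmiss
  have hleft : G.H (a - 1) b := hH.resolve_left hmiss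
  have hV := hG.cell.vertical_of_right_missing ha.1 ha.2 hb (by omega) hleft hmiss
  obtain ⟨d, k, B⟩ := hG.exists_band haa hbb ha hb hb' hV.1 ih hn
  have hd := B.lt
  refine hG.noCross k b ⟨B.cov.mid b le_rfl hd.le,
    a, Or.inl ⟨⟨⟨hb, by simp only [EdgeGrid.transpose]; omega, ha⟩, hleft, hmiss⟩, ?_⟩⟩
  rcases lt_or_gt_of_ne B.obs.ne with h | h
  · exact Or.inr ⟨h.le, B.obs.left h b le_rfl hd.le⟩
  · exact Or.inl ⟨h.le, B.obs.right h b le_rfl hd.le⟩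

/-- If row `b` meets no vertical line between the columns `a` and `a'`, the obstruction can be
chosen between them. -/
theorem Band.exists_near (hG : G.Suitable) {a b a' b' d k : ℤ} (B : G.Band a b a' b' d k)
    (haa : a < a') (ha : G.x0 ≤ a ∧ a ≤ G.x1) (hb : G.y0 ≤ b) (hb' : b' ≤ G.y1)
    (hV' : G.Vp a' b') (hfree : ∀ x, a < x → x ≤ a' → ¬ G.Vp x b) :
    ∃ k', k' ≤ a' ∧ a < k' ∧ G.Band a b a' b' d k' := by
  have hbd := B.lt
  have hd := B.le
  have clean : ∀ p, a < p → p ≤ a' → ¬ G.JunctionIn p b d → ∀ y, b ≤ y → y ≤ d → ¬ G.Vp p y :=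
    fun p p1 p2 hJ y y1 y2 hV => hfree p p1 p2
      (hG.vp_of_not_junctionIn hb (by omega) hbd hJ y1 y2 hV b le_rfl hbd.le)
  have hex : ∃ p, a + 1 ≤ p ∧ p ≤ a' ∧ G.JunctionIn p b d := by
    by_contra hcon
    push Not at hcon
    have h := B.overlap a' (NoneBetween.atMostOne fun p hp =>
      clean p (by unfold StrictlyBetween at hp; omega) (by unfold StrictlyBetween at hp; omega)
        (hcon p (by unfold StrictlyBetween at hp; omega)
          (by unfold StrictlyBetween at hp; omega)) d hbd.le le_rfl)
      (fun p q hp => by unfold StrictlyBetween at hp; omega)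
    exact clean a' haa le_rfl (hcon a' (by omega) le_rfl) d hbd.le le_rfl (h.2 hV')
  obtain ⟨p, p1, p2, hJ⟩ := hex
  obtain ⟨k', f1, f2, f3, f4⟩ := exists_first (P := fun z => G.JunctionIn z b d) p1 hJ
  have hobs : G.Obstruction a b d k' := by
    refine ⟨by omega, f3, fun w hw => f4 w (by unfold StrictlyBetween at hw; omega)
      (by unfold StrictlyBetween at hw; omega), fun _ y y1 y2 => ?_, fun h => by omega⟩
    refine NoneBetween.atMostOne fun w hw => ?_
    unfold StrictlyBetween at hw
    exact clean w (by omega) (by omega) (f4 w (by omega) (by omega)) y y1 y2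
  exact ⟨k', by omega, by omega, hbd, hd, B.none, B.seg, B.top, B.overlap, hobs,
    hG.obstruction_covers hobs ha.1 ha.2 hb (by omega) B.none⟩

/-- An obstruction above the bottom side `[a, c] × {b}` has an extension that meets the one of
the obstruction next to the left side. -/
theorem Band.false_of_near (hG : G.Suitable) {a b a' b' c d k l : ℤ} (B : G.Band a b a' b' d k)
    (B' : G.transpose.Band b a b' a' c l) (ha : G.x0 ≤ a ∧ a ≤ G.x1) (hb : G.y0 ≤ b)
    (hb' : b' ≤ G.y1) (hl : l ≤ d ∨ G.Hp a d) (hk : a < k) (hkc : k ≤ c) : False := by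
  have hbd := B.lt
  have hd := B.le
  refine hG.noCross k l ⟨?_, B'.cov.mid k hk.le hkc⟩
  rcases lt_or_ge l b with h | h
  · exact B.cov.below l h (B'.obs.left h k hk.le hkc)
  rcases le_or_gt l d with h' | h'
  · exact B.cov.mid l h h'
  · refine B.cov.above l h' fun w hw hHw => ?_
    have hHk : G.Hp k d := ((hG.row_edges (B.cov.mid d hbd.le le_rfl) (by omega) (by omega)
      ha.1 ha.2 (B.obs.atMostOne hbd.le le_rfl) (Or.inl (hl.resolve_left (by omega)))).hp
      hk.ne).2
    have := B'.obs.right (by omega) k hk.le hkc w d (by unfold StrictlyBetween at *; omega)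
      (by unfold StrictlyBetween; omega) hHw hHk
    unfold StrictlyBetween at hw
    omega

/-- The corner column next to an obstruction in a column `k` outside of `[a, c]`: this is `a` if
`k` lies to the left and `c` if it lies to the right. -/
theorem Band.exists_corner (hG : G.Suitable) {a b a' b' c d k l : ℤ} (B : G.Band a b a' b' d k)
    (B' : G.transpose.Band b a b' a' c l) (ha : G.x0 ≤ a) (ha' : a' ≤ G.x1)
    (hb : G.y0 ≤ b) (hb' : b' ≤ G.y1) (hVa : G.Vp a b) (hk : k < a ∨ (c < k ∧ G.Vp c b)) :
    ∃ p, p ≠ k ∧ a ≤ p ∧ p ≤ c ∧ G.Vp p b ∧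
      (∀ y, b ≤ y → y ≤ d → G.Hp a y → G.HSeg y p k) ∧
      (∀ y, b ≤ y → y ≤ d → NoneBetween (fun i => G.Vp i y) p k) ∧
      (∀ x, (x = k ∨ StrictlyBetween p k x) → NoneBetween (fun i => G.Vp i l) p x →
        G.HExt x l) := by
  have hbd := B.lt
  have hd := B.le
  have hac := B'.lt
  have hc := B'.le
  have hseg : ∀ y, b ≤ y → y ≤ d → G.Hp a y → G.HSeg y a k := fun y y1 y2 hH =>
    hG.row_edges (B.cov.mid y y1 y2) (by omega) (by omega) ha (by omega)
      (B.obs.atMostOne y1 y2) (Or.inl hH)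
  rcases hk with hk | ⟨hk, hVc⟩
  · exact ⟨a, hk.ne', le_rfl, hac.le, hVa, hseg, B.obs.left hk, fun x hx hN =>
      B'.cov.below x (by unfold StrictlyBetween at hx; omega) hN⟩
  · refine ⟨c, hk.ne, hac.le, le_rfl, hVc, fun y y1 y2 hH x hx => hseg y y1 y2 hH x (by omega),
      fun y y1 y2 p hp hVp => ?_, fun x hx hN =>
      B'.cov.above x (by unfold StrictlyBetween at hx; omega) hN⟩
    have hVcy : G.Vp c y := hG.vp_of_not_junctionIn hb (by omega) hbd
      (B.obs.clear c (by unfold StrictlyBetween; omega)) le_rfl hbd.le hVc y y1 y2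
    have := B.obs.right (by omega) y y1 y2 p c (by unfold StrictlyBetween at *; omega)
      (by unfold StrictlyBetween; omega) hVp hVcy
    unfold StrictlyBetween at hp
    omega

/-- The induction is on the distance of the two anchors. If neither direction overlaps, there are
obstructions `k` above the anchor `(a, b)` and `l` to its right. If `k` lies above the segment from
`a` to `c`, or `l` next to the segment from `b` to `d`, the extensions on column `k` and row `l`
meet at once; otherwise `(k, l)` lies in a quadrant whose corner is one of the points
`(a, b)`, `(c, b)`, `(a, d)` and `(c, d)`. -/
theorem Suitable.overlap_of_lt_lt (hG : G.Suitable) (n : ℕ) : ∀ {a b a' b' : ℤ}, a < a' →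
    b < b' → (a' - a) + (b' - b) ≤ n → G.x0 ≤ a → a' ≤ G.x1 → G.y0 ≤ b → b' ≤ G.y1 →
    G.Vp a b → G.Hp a b → G.Vp a' b' → G.Hp a' b' →
    G.HOverlap a b a' b' ∨ G.VOverlap a b a' b' := by
  induction n with
  | zero => intros; omega
  | succ n ih =>
    intro a b a' b' haa hbb hn ha ha' hb hb' hVA hHA hVA' hHA'
    by_contra hcon
    rw [not_or] at hcon
    -- by minimality, the other anchors on column `a` or on row `b` overlap with `(a', b')`
    have ihH : ∀ d, b < d → d < b' → G.Vp a d → G.Hp a d → G.HOverlap a d a' b' := by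
      intro d d1 d2 hV hH
      refine (ih haa d2 (by omega) ha ha' (by omega) hb' hV hH hVA' hHA').resolve_right fun h => ?_
      have h' : G.transpose.HOverlap b a d a := fun k _ _ => Iff.rfl
      exact hcon.2 (h'.trans h d1.le d2.le)
    have ihV : ∀ c, a < c → c < a' → G.transpose.Vp b c → G.transpose.Hp b c →
        G.transpose.HOverlap b c b' a' := by
      intro c c1 c2 hH hV
      refine (ih c2 hbb (by omega) (by omega) ha' hb hb' hV hH hVA' hHA').resolve_left fun h => ?_
      have h' : G.HOverlap a b c b := fun k _ _ => Iff.rfl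
      exact hcon.1 (h'.trans h c1.le c2.le)
    have hact : G.x0 ≤ a ∧ a ≤ G.x1 := ⟨ha, by omega⟩
    have hactb : G.y0 ≤ b ∧ b ≤ G.y1 := ⟨hb, by omega⟩
    have hR := hG.right_edge haa hbb hact hb hb' hHA ihH hcon.1
    have hU := hG.transpose.right_edge hbb haa hactb ha ha' hVA ihV hcon.2
    obtain ⟨d, k₀, B₀⟩ := hG.exists_band haa hbb hact hb hb' hU ihH hcon.1
    obtain ⟨c, l₀, B₀'⟩ := hG.transpose.exists_band hbb haa hactb ha ha' hR ihV hcon.2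
    obtain ⟨k, hk, B⟩ : ∃ k, ((a < k ∧ k ≤ c) ∨ G.Vp c b) ∧ G.Band a b a' b' d k := by
      by_cases hVc : G.Vp c b
      · exact ⟨k₀, Or.inr hVc, B₀⟩
      · have hca : c = a' := B₀'.top.resolve_left hVc
        subst hca
        obtain ⟨k, k1, k2, B⟩ := B₀.exists_near hG haa hact hb hb' hVA' fun x x1 x2 => by
          rcases x2.lt_or_eq with h | h
          · exact B₀'.none x x1 h
          · subst h; exact hVc
        exact ⟨k, Or.inl ⟨k2, k1⟩, B⟩
    obtain ⟨l, hl, B'⟩ : ∃ l, ((b < l ∧ l ≤ d) ∨ G.Hp a d) ∧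
        G.transpose.Band b a b' a' c l := by
      by_cases hHd : G.Hp a d
      · exact ⟨l₀, Or.inr hHd, B₀'⟩
      · have hdb : d = b' := B₀.top.resolve_left hHd
        subst hdb
        obtain ⟨l, l1, l2, B'⟩ := B₀'.exists_near hG.transpose hbb hactb ha ha' hHA'
          fun x x1 x2 => by
            rcases x2.lt_or_eq with h | h
            · exact B₀.none x x1 h
            · subst h; exact hHd
        exact ⟨l, Or.inl ⟨l2, l1⟩, B'⟩
    by_cases hkc : a < k ∧ k ≤ c
    · exact B.false_of_near hG B' hact hb hb' (hl.imp_left And.right) hkc.1 hkc.2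
    by_cases hld : b < l ∧ l ≤ d
    · exact B'.false_of_near hG.transpose B hactb ha ha' (hk.imp_left And.right) hld.1 hld.2
    have hk' : k < a ∨ (c < k ∧ G.Vp c b) := by
      have hne := B.obs.ne
      have := hk.resolve_left hkc
      rcases lt_or_ge k a with h | h
      · exact Or.inl h
      · exact Or.inr ⟨by omega, this⟩
    have hl' : l < b ∨ (d < l ∧ G.Hp a d) := by
      have hne := B'.obs.ne
      have := hl.resolve_left hld
      rcases lt_or_ge l b with h | h
      · exact Or.inl h
      · exact Or.inr ⟨by omega, this⟩
    obtain ⟨p, p1, p2, p3, p4, p5, p6, p7⟩ := B.exists_corner hG B' ha ha' hb hb' hVA hk'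
    obtain ⟨q, q1, q2, q3, q4, q5, q6, q7⟩ :=
      B'.exists_corner hG.transpose B hb hb' ha ha' hHA hl'
    have hc := B'.le
    have hd := B.le
    exact QuadrantConfig.false hG (p := p) (q := q) (k := k) (l := l)
      ⟨p5 q q2 q3 q4, q5 p p2 p3 p4, p6 q q2 q3, q6 p p2 p3, q7, p7⟩
      ⟨by omega, by omega⟩ ⟨by omega, by omega⟩ B'.obs.junction.active B.obs.junction.active p1 q1

theorem Suitable.overlap_of_lt (hG : G.Suitable) {a b a' b' : ℤ} (haa : a < a') (hbb : b ≠ b')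
    (ha : G.x0 ≤ a) (ha' : a' ≤ G.x1) (hb : G.y0 ≤ b ∧ b ≤ G.y1) (hb' : G.y0 ≤ b' ∧ b' ≤ G.y1)
    (hV : G.Vp a b) (hH : G.Hp a b) (hV' : G.Vp a' b') (hH' : G.Hp a' b') :
    G.HOverlap a b a' b' ∨ G.VOverlap a b a' b' := by
  rcases lt_or_gt_of_ne hbb with h | h
  · exact hG.overlap_of_lt_lt _ haa h (Int.self_le_toNat _) ha ha' hb.1 hb'.2 hV hH hV' hH'
  · have := hG.flip.overlap_of_lt_lt (a := -a') (b := b') (a' := -a) (b' := b) _ (by omega) h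
      (Int.self_le_toNat _) (by simp only [EdgeGrid.flip]; omega)
      (by simp only [EdgeGrid.flip]; omega) hb'.1 hb.2
      (by simpa only [Vp, EdgeGrid.flip, neg_neg] using hV')
      (by rw [flip_Hp, neg_neg]; exact hH')
      (by simpa only [Vp, EdgeGrid.flip, neg_neg] using hV)
      (by rw [flip_Hp, neg_neg]; exact hH)
    rw [flip_HOverlap, flip_VOverlap, neg_neg, neg_neg] at this
    exact this.imp HOverlap.symm HOverlap.symm

/-- In an analysis-suitable grid, the index vectors of any two anchors overlap in at least one
direction in which the anchors differ. -/
theorem Suitable.overlap (hG : G.Suitable) {a b a' b' : ℤ} (haa : a ≠ a') (hbb : b ≠ b')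
    (ha : G.x0 ≤ a ∧ a ≤ G.x1) (ha' : G.x0 ≤ a' ∧ a' ≤ G.x1)
    (hb : G.y0 ≤ b ∧ b ≤ G.y1) (hb' : G.y0 ≤ b' ∧ b' ≤ G.y1)
    (hV : G.Vp a b) (hH : G.Hp a b) (hV' : G.Vp a' b') (hH' : G.Hp a' b') :
    G.HOverlap a b a' b' ∨ G.VOverlap a b a' b' := by
  rcases lt_or_gt_of_ne haa with h | h
  · exact hG.overlap_of_lt h hbb ha.1 ha'.2 hb hb' hV hH hV' hH'
  · exact (hG.overlap_of_lt h hbb.symm ha'.1 ha.2 hb' hb hV' hH' hV hH).imp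
      HOverlap.symm HOverlap.symm

end EdgeGrid

/-! ### Consecutive elements of a set of integers -/

namespace IndexMesh

theorem consecutive_of_gaps {S : Set ℤ} {n : ℕ} {v : Fin (n + 1) → ℤ} (hS : ∀ k, v k ∈ S)
    (hlt : ∀ k : Fin n, v k.castSucc < v k.succ)
    (hgap : ∀ k : Fin n, ∀ x ∈ S, v k.castSucc < x → ¬ x < v k.succ) : Consecutive S v := by
  have hmono : StrictMono v := Fin.strictMono_iff_lt_succ.2 hlt
  refine ⟨hmono, hS, fun x hx k l hk hl => ?_⟩
  by_contra hcon
  push Not at hcon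
  have key : ∀ p : Fin (n + 1), k ≤ p → v p ≤ x := by
    intro p
    induction p using Fin.induction with
    | zero => intro h; have : k = 0 := by simpa using h
              exact this ▸ hk
    | succ p ih =>
      intro h
      rcases h.lt_or_eq with h | h
      · have h1 := ih (Fin.le_castSucc_iff.2 h)
        exact not_lt.1 (hgap p x hx (lt_of_le_of_ne h1 (hcon _)))
      · exact h ▸ hk
  have hkl : k ≤ l := hmono.le_iff_le.1 (hk.trans hl)
  exact hcon l (le_antisymm (key l hkl) hl)

theorem Consecutive.noneBetween {S : Set ℤ} {n : ℕ} {v : Fin n → ℤ} (h : Consecutive S v)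
    {k l : Fin n} (hkl : (k : ℕ) + 1 = l) : ∀ x ∈ S, v k < x → ¬ x < v l := by
  intro x hx h1 h2
  obtain ⟨p, rfl⟩ := h.2.2 x hx k l h1.le h2.le
  have h3 := h.1.lt_iff_lt.1 h1
  have h4 := h.1.lt_iff_lt.1 h2
  rw [Fin.lt_def] at h3 h4
  omega

/-- A consecutive vector is determined by one of its entries. -/
theorem Consecutive.unique {S : Set ℤ} {n : ℕ} {v w : Fin n → ℤ} (hv : Consecutive S v)
    (hw : Consecutive S w) {k : Fin n} (hk : v k = w k) : v = w := by
  have up : ∀ i : ℕ, ∀ l : Fin n, (l : ℕ) = k + i → v l = w l := by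
    intro i
    induction i with
    | zero => intro l hl; have : l = k := Fin.ext (by omega)
              exact this ▸ hk
    | succ i ih =>
      intro l hl
      have hm := ih ⟨k + i, by omega⟩ rfl
      set m : Fin n := ⟨k + i, by omega⟩
      have hml : m < l := Fin.lt_def.2 (by simp only [m]; omega)
      have hml' : (m : ℕ) + 1 = l := by simp only [m]; omega
      by_contra hne
      rcases lt_or_gt_of_ne hne with h | h
      · exact hw.noneBetween hml' _ (hv.2.1 l) (hm ▸ hv.1 hml) h
      · exact hv.noneBetween hml' _ (hw.2.1 l) (hm ▸ hw.1 hml) h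
  have down : ∀ i : ℕ, ∀ l : Fin n, (l : ℕ) + i = k → v l = w l := by
    intro i
    induction i with
    | zero => intro l hl; have : l = k := Fin.ext (by omega)
              exact this ▸ hk
    | succ i ih =>
      intro l hl
      have hm := ih ⟨l + 1, by omega⟩ (by simp only; omega)
      set m : Fin n := ⟨l + 1, by omega⟩
      have hml : l < m := Fin.lt_def.2 (by simp only [m]; omega)
      have hml' : (l : ℕ) + 1 = m := rfl
      by_contra hne
      rcases lt_or_gt_of_ne hne with h | h
      · exact hv.noneBetween hml' _ (hw.2.1 l) h (hm ▸ hw.1 hml)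
      · exact hw.noneBetween hml' _ (hv.2.1 l) h (hm ▸ hv.1 hml)
  funext l
  rcases le_total (k : ℕ) l with h | h
  · exact up (l - k) l (by omega)
  · exact down (k - l) l (by omega)

theorem exists_next {S : Set ℤ} {x z : ℤ} (hxz : x < z) (hz : z ∈ S) :
    ∃ s ∈ S, x < s ∧ s ≤ z ∧ ∀ y ∈ S, x < y → ¬ y < s := by
  obtain ⟨f, f1, f2, f3, f4⟩ := exists_first (P := fun y => y ∈ S) (show x + 1 ≤ z by omega) hz
  exact ⟨f, f3, by omega, f2, fun y hy h1 h2 => f4 y (by omega) h2 hy⟩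

theorem exists_prev {S : Set ℤ} {x z : ℤ} (hxz : z < x) (hz : z ∈ S) :
    ∃ s ∈ S, s < x ∧ z ≤ s ∧ ∀ y ∈ S, s < y → ¬ y < x := by
  obtain ⟨f, f1, f2, f3, f4⟩ := exists_last (P := fun y => y ∈ S) (show z ≤ x - 1 by omega) hz
  exact ⟨f, f3, by omega, f1, fun y hy h1 h2 => f4 y h1 (by omega) hy⟩

/-- Four consecutive elements, the second of which is prescribed. -/
theorem exists_consecutive_four {S : Set ℤ} {f p q r : ℤ} (hf : f ∈ S) (hp : p ∈ S)
    (hpf : p < f) (hq : q ∈ S) (hr : r ∈ S) (hfq : f < q) (hqr : q < r) :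
    ∃ e : Fin 4 → ℤ, Consecutive S e ∧ e 1 = f := by
  obtain ⟨a, a1, a2, -, a4⟩ := exists_prev hpf hp
  obtain ⟨c, c1, c2, c3, c4⟩ := exists_next hfq hq
  obtain ⟨d, d1, d2, -, d4⟩ := exists_next (show c < r by omega) hr
  refine ⟨![a, f, c, d], consecutive_of_gaps ?_ ?_ ?_, rfl⟩
  · intro k; fin_cases k <;> assumption
  · intro k; fin_cases k <;> assumption
  · intro k; fin_cases k <;> assumption

/-- Four consecutive elements, the third of which is prescribed. -/
theorem exists_consecutive_four' {S : Set ℤ} {f p q r : ℤ} (hf : f ∈ S) (hp : p ∈ S)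
    (hfp : f < p) (hq : q ∈ S) (hr : r ∈ S) (hqf : q < f) (hrq : r < q) :
    ∃ e : Fin 4 → ℤ, Consecutive S e ∧ e 2 = f := by
  obtain ⟨d, d1, d2, -, d4⟩ := exists_next hfp hp
  obtain ⟨c, c1, c2, c3, c4⟩ := exists_prev hqf hq
  obtain ⟨a, a1, a2, -, a4⟩ := exists_prev (show r < c by omega) hr
  refine ⟨![a, c, f, d], consecutive_of_gaps ?_ ?_ ?_, rfl⟩
  · intro k; fin_cases k <;> assumption
  · intro k; fin_cases k <;> assumption
  · intro k; fin_cases k <;> assumption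

/-- Five consecutive elements, the middle one of which is prescribed. -/
theorem exists_consecutive_five {S : Set ℤ} {f p p' q q' : ℤ} (hf : f ∈ S) (hp : p ∈ S)
    (hp' : p' ∈ S) (hpf : p < f) (hpp : p' < p) (hq : q ∈ S) (hq' : q' ∈ S) (hfq : f < q)
    (hqq : q < q') : ∃ e : Fin 5 → ℤ, Consecutive S e ∧ e 2 = f := by
  obtain ⟨a, a1, a2, a3, a4⟩ := exists_prev hpf hp
  obtain ⟨b, b1, b2, -, b4⟩ := exists_prev (show p' < a by omega) hp'
  obtain ⟨c, c1, c2, c3, c4⟩ := exists_next hfq hq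
  obtain ⟨d, d1, d2, -, d4⟩ := exists_next (show c < q' by omega) hq'
  refine ⟨![b, a, f, c, d], consecutive_of_gaps ?_ ?_ ?_, rfl⟩
  · intro k; fin_cases k <;> assumption
  · intro k; fin_cases k <;> assumption
  · intro k; fin_cases k <;> assumption

/-- The span of five consecutive elements consists of indices separated from the middle one by at
most one element. -/
theorem Consecutive.atMostOneBetween {S : Set ℤ} {v : Fin 5 → ℤ} (h : Consecutive S v) {x : ℤ}
    (h0 : v 0 ≤ x) (h4 : x ≤ v 4) : AtMostOneBetween (fun i => i ∈ S) (v 2) x := by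
  have key : ∀ p, p ∈ S → StrictlyBetween (v 2) x p →
      (p = v 1 ∧ x < v 2) ∨ (p = v 3 ∧ v 2 < x) := by
    intro p hp hb
    unfold StrictlyBetween at hb
    obtain ⟨r, rfl⟩ := h.2.2 p hp 0 4
      (by have := h.1.monotone (show (0 : Fin 5) ≤ 2 by decide); omega)
      (by have := h.1.monotone (show (2 : Fin 5) ≤ 4 by decide); omega)
    have e : ∀ i, v i < v r ↔ i < r := fun i => h.1.lt_iff_lt
    have e' : ∀ i, v r < v i ↔ r < i := fun i => h.1.lt_iff_lt
    rcases hb with hb | hb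
    · have h1 := (e 2).1 hb.1
      have h2 := (e' 4).1 (by omega)
      refine Or.inr ⟨by congr 1; omega, by omega⟩
    · have h1 := (e' 2).1 hb.2
      have h2 := (e 0).1 (by omega)
      refine Or.inl ⟨by congr 1; omega, by omega⟩
  intro p q hp hq hSp hSq
  have h1 := key p hSp hp
  have h2 := key q hSq hq
  omega

/-! ### The grid of a T-mesh -/

theorem transpose_transpose (T : IndexMesh) : T.transpose.transpose = T := by
  cases T; simp [transpose, Set.image_image]

theorem mem_transpose_cells {T : IndexMesh} {Q : IndexRect} :
    Q ∈ T.transpose.cells ↔ (⟨Q.b, Q.t, Q.l, Q.r⟩ : IndexRect) ∈ T.cells := by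
  constructor
  · rintro ⟨R, hR, rfl⟩; exact hR
  · intro h; exact ⟨_, h, rfl⟩

theorem IsTMesh.transpose {T : IndexMesh} (h : T.IsTMesh) : T.transpose.IsTMesh where
  dom_x := h.dom_y
  dom_y := h.dom_x
  cell := fun Q hQ => by
    have := h.cell _ (mem_transpose_cells.1 hQ)
    simp only [IndexMesh.transpose] at *
    omega
  partition := fun x y h1 h2 h3 h4 => by
    obtain ⟨Q, ⟨q1, q2, q3, q4, q5⟩, hu⟩ := h.partition y x h3 h4 h1 h2
    refine ⟨⟨Q.b, Q.t, Q.l, Q.r⟩, ⟨mem_transpose_cells.2 q1, q4, q5, q2, q3⟩, fun R hR => ?_⟩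
    have := hu ⟨R.b, R.t, R.l, R.r⟩
      ⟨mem_transpose_cells.1 hR.1, hR.2.2.2.1, hR.2.2.2.2, hR.2.1, hR.2.2.1⟩
    rw [← this]

theorem AnalysisSuitable.transpose {T : IndexMesh} (h : T.AnalysisSuitable) :
    T.transpose.AnalysisSuitable where
  isTMesh := h.isTMesh.transpose
  admissible := ⟨h.admissible.2, T.transpose_transpose.symm ▸ h.admissible.1⟩
  no_cross := fun i j i' j' e f he hf hcon => by
    unfold IsVExtension at hf
    rw [T.transpose_transpose] at hf
    exact h.no_cross j' i' j i f e hf he ⟨hcon.2.2.1, hcon.2.2.2, hcon.1, hcon.2.1⟩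

theorem hEdge_iff {T : IndexMesh} {i j : ℤ} :
    T.HEdge i j ↔ ∃ Q ∈ T.cells, (Q.b = j ∨ Q.t = j) ∧ Q.l ≤ i ∧ i + 1 ≤ Q.r := by
  constructor
  · rintro ⟨Q, hQ, h⟩; exact ⟨_, mem_transpose_cells.1 hQ, h⟩
  · rintro ⟨Q, hQ, h⟩; exact ⟨⟨Q.b, Q.t, Q.l, Q.r⟩, mem_transpose_cells.2 hQ, h⟩

theorem transpose_hEdge {T : IndexMesh} {i j : ℤ} : T.transpose.HEdge i j ↔ T.VEdge j i := by
  rw [HEdge, transpose_transpose]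

/-- The edges of a mesh, with its active region. -/
def grid (T : IndexMesh) : EdgeGrid :=
  ⟨T.VEdge, T.HEdge, T.mlo + 2, T.mhi - 2, T.nlo + 2, T.nhi - 2⟩

theorem grid_transpose (T : IndexMesh) : T.transpose.grid = T.grid.transpose := by
  have h : (fun i j => T.transpose.HEdge i j) = fun i j => T.VEdge j i :=
    funext fun i => funext fun j => propext transpose_hEdge
  simp only [grid, EdgeGrid.transpose]
  congr 1

theorem IsTMesh.vEdge_bounds {T : IndexMesh} (h : T.IsTMesh) {i j : ℤ} (hE : T.VEdge i j) :
    T.mlo ≤ i ∧ i ≤ T.mhi ∧ T.nlo ≤ j ∧ j + 1 ≤ T.nhi := by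
  obtain ⟨Q, hQ, h1, h2, h3⟩ := hE
  have := h.cell Q hQ
  omega

theorem IsTMesh.mem_hJ {T : IndexMesh} (h : T.IsTMesh) {i j : ℤ} :
    i ∈ T.hJ j ↔ T.grid.Vp i j := by
  constructor
  · rintro ⟨Q, hQ, h1, h2, h3⟩
    have := h.cell Q hQ
    rcases h3.lt_or_eq with h4 | h4
    · exact Or.inl ⟨Q, hQ, h1, h2, by omega⟩
    · exact Or.inr ⟨Q, hQ, h1, by omega, by omega⟩
  · rintro (⟨Q, hQ, h1, h2, h3⟩ | ⟨Q, hQ, h1, h2, h3⟩)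
    · exact ⟨Q, hQ, h1, h2, by omega⟩
    · exact ⟨Q, hQ, h1, by omega, by omega⟩

theorem IsTMesh.mem_vJ {T : IndexMesh} (h : T.IsTMesh) {i j : ℤ} :
    j ∈ T.vJ i ↔ T.grid.Hp i j := by
  rw [vJ, h.transpose.mem_hJ, grid_transpose]
  rfl

/-- No vertical edge enters the interior of a cell. -/
theorem IsTMesh.not_vEdge {T : IndexMesh} (h : T.IsTMesh) {Q : IndexRect} (hQ : Q ∈ T.cells)
    {i j : ℤ} (h1 : Q.l < i) (h2 : i < Q.r) (h3 : Q.b ≤ j) (h4 : j < Q.t) : ¬ T.VEdge i j := by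
  rintro ⟨R, hR, hi, hb, ht⟩
  have cQ := h.cell Q hQ
  have cR := h.cell R hR
  rcases hi with hi | hi
  · have := (h.partition i j (by omega) (by omega) (by omega) (by omega)).unique
      ⟨hQ, by omega, by omega, by omega, by omega⟩ ⟨hR, by omega, by omega, by omega, by omega⟩
    rw [this] at h1; omega
  · have := (h.partition (i - 1) j (by omega) (by omega) (by omega) (by omega)).unique
      ⟨hQ, by omega, by omega, by omega, by omega⟩ ⟨hR, by omega, by omega, by omega, by omega⟩
    rw [this] at h2; omega

theorem IsTMesh.not_hEdge {T : IndexMesh} (h : T.IsTMesh) {Q : IndexRect} (hQ : Q ∈ T.cells)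
    {i j : ℤ} (h1 : Q.l ≤ i) (h2 : i < Q.r) (h3 : Q.b < j) (h4 : j < Q.t) : ¬ T.HEdge i j :=
  h.transpose.not_vEdge (Q := ⟨Q.b, Q.t, Q.l, Q.r⟩) (mem_transpose_cells.2 hQ) h3 h4 h1 h2

theorem IsTMesh.cellular {T : IndexMesh} (h : T.IsTMesh) : T.grid.Cellular := by
  intro x y h1 h2 h3 h4
  simp only [grid] at h1 h2 h3 h4
  obtain ⟨Q, ⟨hQ, q1, q2, q3, q4⟩, -⟩ :=
    h.partition x y (by omega) (by omega) (by omega) (by omega)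
  refine ⟨Q.l, Q.r, Q.b, Q.t, by omega, fun j j1 j2 =>
    ⟨⟨Q, hQ, Or.inl rfl, j1, by omega⟩, ⟨Q, hQ, Or.inr rfl, j1, by omega⟩⟩, fun i i1 i2 =>
    ⟨hEdge_iff.2 ⟨Q, hQ, Or.inl rfl, i1, by omega⟩,
      hEdge_iff.2 ⟨Q, hQ, Or.inr rfl, i1, by omega⟩⟩,
    fun i j => h.not_vEdge hQ, fun i j => h.not_hEdge hQ⟩

theorem IsTMesh.isVertex_of_ends {T : IndexMesh} {i j : ℤ}
    (h1 : (T.HEdge (i - 1) j ∧ ¬ T.HEdge i j) ∨ (T.HEdge i j ∧ ¬ T.HEdge (i - 1) j)) :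
    T.IsVertex i j := by
  simp only [hEdge_iff] at h1
  rcases h1 with ⟨⟨Q, hQ, h2, h3, h4⟩, h5⟩ | ⟨⟨Q, hQ, h2, h3, h4⟩, h5⟩
  · refine ⟨Q, hQ, Or.inr ?_, h2⟩
    by_contra hne
    exact h5 ⟨Q, hQ, h2, by omega, by omega⟩
  · refine ⟨Q, hQ, Or.inl ?_, h2⟩
    by_contra hne
    exact h5 ⟨Q, hQ, h2, by omega, by omega⟩

/-- In the rows of the active region, the six outermost columns belong to the skeleton. -/
theorem AnalysisSuitable.frame_mem_hJ {T : IndexMesh} (h : T.AnalysisSuitable) {i j : ℤ}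
    (hi : i = T.mlo ∨ i = T.mlo + 1 ∨ i = T.mlo + 2 ∨
      i = T.mhi - 2 ∨ i = T.mhi - 1 ∨ i = T.mhi) (hj : T.nlo ≤ j) (hj' : j + 1 ≤ T.nhi) :
    i ∈ T.hJ j :=
  h.isTMesh.mem_hJ.2 (Or.inl (h.admissible.1.frame i hi j hj hj'))

/-- A point of a horizontal extension in the sense of `EdgeGrid.HExt` lies in the extension of a
T-junction. -/
theorem AnalysisSuitable.exists_hExtension {T : IndexMesh} (h : T.AnalysisSuitable) {x y : ℤ}
    (hx : T.mlo + 2 ≤ x ∧ x ≤ T.mhi - 2) (hE : T.grid.HExt x y) :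
    ∃ i e, T.IsHExtension i y e ∧ e 0 ≤ x ∧ x ≤ e 3 := by
  have hS : T.grid.transpose.Hp y = fun i => i ∈ T.hJ y :=
    funext fun i => propext h.isTMesh.mem_hJ.symm
  obtain ⟨f, hf⟩ := hE
  rw [hS] at hf
  rcases hf with ⟨⟨⟨h1, h2, h3, h4⟩, h5, h6⟩, h7⟩ | ⟨⟨⟨h1, h2, h3, h4⟩, h5, h6⟩, h7⟩
  · simp only [EdgeGrid.transpose, grid] at h1 h2 h3 h4 h5 h6
    have hv := h.isTMesh.cellular.vertical_of_right_missing h3 h4 h1 h2 h5 h6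
    have hfr : ∀ i, (i = T.mlo ∨ i = T.mlo + 1 ∨ i = T.mlo + 2 ∨
      i = T.mhi - 2 ∨ i = T.mhi - 1 ∨ i = T.mhi) → i ∈ T.hJ y := fun i hi =>
      h.frame_mem_hJ hi (by omega) (by omega)
    obtain ⟨e, he, he1⟩ := exists_consecutive_four (S := T.hJ y)
      (h.isTMesh.mem_hJ.2 (Or.inl hv.1)) (hfr (T.mlo + 1) (by omega)) (by omega)
      (hfr (T.mhi - 1) (by omega)) (hfr T.mhi (by omega)) (by omega) (by omega)
    refine ⟨f, e, ⟨he, Or.inr ⟨⟨⟨IsTMesh.isVertex_of_ends (Or.inl ⟨h5, h6⟩),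
      h3, h4, h1, h2⟩, h5, h6, hv.2, hv.1⟩, he1⟩⟩, ?_⟩
    have m01 := he.1 (show (0 : Fin 4) < 1 by decide)
    have m12 := he.1 (show (1 : Fin 4) < 2 by decide)
    have m23 := he.1 (show (2 : Fin 4) < 3 by decide)
    rcases h7 with ⟨h7, h8⟩ | ⟨h7, h8⟩
    · refine ⟨by omega, ?_⟩
      by_contra hcon
      have := h8 (e 2) (e 3) (by unfold StrictlyBetween; omega) (by unfold StrictlyBetween; omega)
        (he.2.1 2) (he.2.1 3)
      omega
    · refine ⟨?_, by omega⟩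
      by_contra hcon
      exact h8 (e 0) (by unfold StrictlyBetween; omega) (he.2.1 0)
  · simp only [EdgeGrid.transpose, grid] at h1 h2 h3 h4 h5 h6
    have hv := h.isTMesh.cellular.vertical_of_left_missing h3 h4 h1 h2 h5 h6
    have hfr : ∀ i, (i = T.mlo ∨ i = T.mlo + 1 ∨ i = T.mlo + 2 ∨
      i = T.mhi - 2 ∨ i = T.mhi - 1 ∨ i = T.mhi) → i ∈ T.hJ y := fun i hi =>
      h.frame_mem_hJ hi (by omega) (by omega)
    obtain ⟨e, he, he1⟩ := exists_consecutive_four' (S := T.hJ y)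
      (h.isTMesh.mem_hJ.2 (Or.inl hv.1)) (hfr (T.mhi - 1) (by omega)) (by omega)
      (hfr (T.mlo + 1) (by omega)) (hfr T.mlo (by omega)) (by omega) (by omega)
    refine ⟨f, e, ⟨he, Or.inl ⟨⟨⟨IsTMesh.isVertex_of_ends (Or.inr ⟨h5, h6⟩),
      h3, h4, h1, h2⟩, h6, h5, hv.2, hv.1⟩, he1⟩⟩, ?_⟩
    have m01 := he.1 (show (0 : Fin 4) < 1 by decide)
    have m12 := he.1 (show (1 : Fin 4) < 2 by decide)
    have m23 := he.1 (show (2 : Fin 4) < 3 by decide)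
    rcases h7 with ⟨h7, h8⟩ | ⟨h7, h8⟩
    · refine ⟨?_, by omega⟩
      by_contra hcon
      have := h8 (e 0) (e 1) (by unfold StrictlyBetween; omega) (by unfold StrictlyBetween; omega)
        (he.2.1 0) (he.2.1 1)
      omega
    · refine ⟨by omega, ?_⟩
      by_contra hcon
      exact h8 (e 3) (by unfold StrictlyBetween; omega) (he.2.1 3)

theorem AnalysisSuitable.exists_vExtension {T : IndexMesh} (h : T.AnalysisSuitable) {x y : ℤ}
    (hy : T.nlo + 2 ≤ y ∧ y ≤ T.nhi - 2) (hE : T.grid.VExt x y) :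
    ∃ j e, T.IsVExtension x j e ∧ e 0 ≤ y ∧ y ≤ e 3 :=
  h.transpose.exists_hExtension hy (by rw [grid_transpose]; exact hE)

theorem VAdmissible.vEdge_near_frame {T : IndexMesh} (h : T.VAdmissible) {i j : ℤ}
    (hi : (T.mlo ≤ i ∧ i ≤ T.mlo + 3) ∨ (T.mhi - 3 ≤ i ∧ i ≤ T.mhi))
    (hj : T.nlo + 2 ≤ j) (hj' : j + 1 ≤ T.nhi - 2) : T.VEdge i j := by
  by_cases h3 : i = T.mlo + 3 ∨ i = T.mhi - 3
  · exact h.active i (by omega) j hj hj'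
  · exact h.frame i (by omega) j (by omega) (by omega)

/-- Admissibility and the absence of crossing extensions carry over to the grid of edges. -/
theorem AnalysisSuitable.grid_suitable {T : IndexMesh} (h : T.AnalysisSuitable) :
    T.grid.Suitable where
  cell := h.isTMesh.cellular
  colFull := fun i j h1 h2 h3 => h.admissible.1.vEdge_near_frame
    (by simp only [grid] at h1; omega) h2 (by simp only [grid] at h3; omega)
  colOut := fun i j hV => by
    have := h.isTMesh.vEdge_bounds hV
    simp only [grid]; omega
  rowFull := fun i j h1 h2 h3 => h.admissible.2.vEdge_near_frame
    (by simp only [grid, IndexMesh.transpose] at h1 ⊢; omega) h2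
    (by simp only [grid, IndexMesh.transpose] at h3 ⊢; omega)
  rowOut := fun i j hV => by
    have := h.isTMesh.transpose.vEdge_bounds hV
    simp only [grid, IndexMesh.transpose] at *; omega
  noCross := fun x y ⟨hV, hH⟩ => by
    obtain ⟨j, f, hf, f1, f2⟩ := h.exists_vExtension
      (EdgeGrid.VExt.active (G := T.grid.transpose) hH) hV
    obtain ⟨i, e, he, e1, e2⟩ := h.exists_hExtension hV.active hH
    exact h.no_cross i y x j e f he hf ⟨e1, e2, f1, f2⟩

theorem IsTMesh.anchor_grid {T : IndexMesh} (h : T.IsTMesh) {a b : ℤ} (hA : T.IsAnchor a b) :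
    T.grid.Vp a b ∧ T.grid.Hp a b := by
  obtain ⟨⟨Q, hQ, h1, h2⟩, -⟩ := hA
  have := h.cell Q hQ
  exact ⟨h.mem_hJ.1 ⟨Q, hQ, h1, by omega, by omega⟩,
    h.mem_vJ.1 ⟨⟨Q.b, Q.t, Q.l, Q.r⟩, mem_transpose_cells.2 hQ, h2, by simp only; omega,
      by simp only; omega⟩⟩

theorem AnalysisSuitable.exists_hVector {T : IndexMesh} (h : T.AnalysisSuitable) {a b : ℤ}
    (ha : a ∈ T.hJ b) (hact : T.InActive a b) :
    ∃ v : Fin 5 → ℤ, Consecutive (T.hJ b) v ∧ v 2 = a := by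
  obtain ⟨h1, h2, h3, h4⟩ := hact
  have hfr : ∀ i, (i = T.mlo ∨ i = T.mlo + 1 ∨ i = T.mlo + 2 ∨
    i = T.mhi - 2 ∨ i = T.mhi - 1 ∨ i = T.mhi) → i ∈ T.hJ b := fun i hi =>
    h.frame_mem_hJ hi (by omega) (by omega)
  exact exists_consecutive_five ha (hfr (T.mlo + 1) (by omega)) (hfr T.mlo (by omega))
    (by omega) (by omega) (hfr (T.mhi - 1) (by omega)) (hfr T.mhi (by omega)) (by omega)
    (by omega)

end IndexMesh

/-- Overlap of two index vectors: an index in the span of both belongs to both or to neither. -/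
def IndexOverlap (v v' : Fin 5 → ℤ) : Prop :=
  ∀ k, v 0 ≤ k → k ≤ v 4 → v' 0 ≤ k → k ≤ v' 4 → (k ∈ Set.range v ↔ k ∈ Set.range v')

open IndexMesh in
theorem indexOverlap_of_consecutive {S S' : Set ℤ} {v v' : Fin 5 → ℤ} (hv : Consecutive S v)
    (hv' : Consecutive S' v')
    (h : ∀ k, AtMostOneBetween (fun i => i ∈ S) (v 2) k →
      AtMostOneBetween (fun i => i ∈ S') (v' 2) k → (k ∈ S ↔ k ∈ S')) : IndexOverlap v v' := by
  intro k h0 h4 h0' h4'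
  have := h k (hv.atMostOneBetween h0 h4) (hv'.atMostOneBetween h0' h4')
  constructor
  · rintro ⟨p, rfl⟩
    exact hv'.2.2 _ (this.1 (hv.2.1 p)) 0 4 h0' h4'
  · rintro ⟨p, rfl⟩
    exact hv.2.2 _ (this.2 (hv'.2.1 p)) 0 4 h0 h4

open IndexMesh in
/-- Analysis-suitable T-splines are dual-compatible: two different anchors have different and
overlapping index vectors in at least one of the two directions. -/
theorem TSpline.IsAnalysisSuitable.dualCompatible {T : TSpline} (hT : T.IsAnalysisSuitable)
    {a b a' b' : ℤ} {v w v' w' : Fin 5 → ℤ} (hA : T.mesh.IsAnchor a b)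
    (hI : T.IsIndexVectors a b v w) (hA' : T.mesh.IsAnchor a' b')
    (hI' : T.IsIndexVectors a' b' v' w') (hne : (a, b) ≠ (a', b')) :
    (v ≠ v' ∧ IndexOverlap v v') ∨ (w ≠ w' ∧ IndexOverlap w w') := by
  have hM := hT.mesh.isTMesh
  obtain ⟨hv, rfl, hw, rfl⟩ := hI
  obtain ⟨hv', rfl, hw', rfl⟩ := hI'
  by_cases haa : v 2 = v' 2
  · have hbb : w 2 ≠ w' 2 := fun h => hne (by rw [haa, h])
    refine Or.inr ⟨fun h => hbb (by rw [h]), indexOverlap_of_consecutive hw hw' ?_⟩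
    rw [haa]; exact fun k _ _ => Iff.rfl
  by_cases hbb : w 2 = w' 2
  · refine Or.inl ⟨fun h => haa (by rw [h]), indexOverlap_of_consecutive hv hv' ?_⟩
    rw [hbb]; exact fun k _ _ => Iff.rfl
  have hG := hM.anchor_grid hA
  have hG' := hM.anchor_grid hA'
  obtain ⟨-, h1, h2, h3, h4⟩ := hA
  obtain ⟨-, h1', h2', h3', h4'⟩ := hA'
  have e : ∀ j, (fun i => i ∈ T.mesh.hJ j) = fun i => T.mesh.grid.Vp i j := fun j =>
    funext fun i => propext hM.mem_hJ
  have e' : ∀ i, (fun j => j ∈ T.mesh.vJ i) = fun j => T.mesh.grid.transpose.Vp j i := fun i =>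
    funext fun j => propext hM.mem_vJ
  rcases hT.mesh.grid_suitable.overlap haa hbb ⟨h1, h2⟩ ⟨h1', h2'⟩ ⟨h3, h4⟩ ⟨h3', h4'⟩
    hG.1 hG.2 hG'.1 hG'.2 with h | h
  · refine Or.inl ⟨fun h => haa (by rw [h]), indexOverlap_of_consecutive hv hv' ?_⟩
    intro k hk hk'
    rw [e] at hk hk'
    rw [hM.mem_hJ, hM.mem_hJ]
    exact h k hk hk'
  · refine Or.inr ⟨fun h => hbb (by rw [h]), indexOverlap_of_consecutive hw hw' ?_⟩
    intro k hk hk'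
    rw [e'] at hk hk'
    rw [hM.mem_vJ, hM.mem_vJ]
    exact h k hk hk'

/-! ### The perturbed mesh -/

namespace IndexMesh

variable {T : IndexMesh}

theorem IsTMesh.segments_finite (h : T.IsTMesh) : {s | T.IsVSegment s}.Finite := by
  refine ((Set.finite_Icc T.mlo T.mhi).prod (Set.finite_Icc T.nlo T.nhi)).subset fun s hs => ?_
  have := h.vEdge_bounds hs.1
  simp only [Set.mem_prod, Set.mem_Icc]
  omega

theorem IsTMesh.colIndex_mono (h : T.IsTMesh) {i j i' j' : ℤ}
    (hlex : i < i' ∨ (i = i' ∧ j ≤ j')) : T.colIndex i j ≤ T.colIndex i' j' := by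
  unfold colIndex
  have := Set.ncard_le_ncard (s := {s : ℤ × ℤ | T.IsVSegment s ∧ (s.1 < i ∨ s.1 = i ∧ s.2 ≤ j)})
    (t := {s : ℤ × ℤ | T.IsVSegment s ∧ (s.1 < i' ∨ s.1 = i' ∧ s.2 ≤ j')})
    (fun s hs => ⟨hs.1, by have := hs.2; omega⟩) (h.segments_finite.subset fun s hs => hs.1)
  omega

/-- The segment through a point of the vertical skeleton. -/
theorem IsTMesh.exists_segment (h : T.IsTMesh) {i j : ℤ} (hi : i ∈ T.hJ j) :
    ∃ s, s ≤ j ∧ T.IsVSegment (i, s) ∧ ∀ z, s ≤ z → z < j → T.VEdge i z := by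
  have key : ∀ j', T.VEdge i j' → ∃ s, s ≤ j' ∧ T.IsVSegment (i, s) ∧
      ∀ z, s ≤ z → z ≤ j' → T.VEdge i z := by
    intro j' hj'
    have hb := h.vEdge_bounds hj'
    obtain ⟨s, s1, s2, s3, s4⟩ := exists_last (P := fun z => ¬ T.VEdge i (z - 1))
      (show T.nlo ≤ j' by omega) fun hcon => by have := h.vEdge_bounds hcon; omega
    have hedge : ∀ z, s ≤ z → z ≤ j' → T.VEdge i z := fun z z1 z2 => by
      rcases z2.lt_or_eq with hz | hz
      · have := not_not.1 (s4 (z + 1) (by omega) (by omega))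
        simpa using this
      · exact hz ▸ hj'
    exact ⟨s, s2, ⟨hedge s le_rfl s2, s3⟩, hedge⟩
  rcases h.mem_hJ.1 hi with hE | hE
  · obtain ⟨s, s1, s2, s3⟩ := key j hE
    exact ⟨s, s1, s2, fun z z1 z2 => s3 z z1 z2.le⟩
  · obtain ⟨s, s1, s2, s3⟩ := key (j - 1) hE
    exact ⟨s, by omega, s2, fun z z1 z2 => s3 z z1 (by omega)⟩

theorem IsTMesh.colIndex_lt (h : T.IsTMesh) {i j i' j' : ℤ} (hlt : i < i') (hi : i' ∈ T.hJ j') :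
    T.colIndex i j < T.colIndex i' j' := by
  obtain ⟨s, s1, s2, -⟩ := h.exists_segment hi
  unfold colIndex
  have := Set.ncard_lt_ncard (s := {s : ℤ × ℤ | T.IsVSegment s ∧ (s.1 < i ∨ s.1 = i ∧ s.2 ≤ j)})
    (t := {s : ℤ × ℤ | T.IsVSegment s ∧ (s.1 < i' ∨ s.1 = i' ∧ s.2 ≤ j')})
    (ssubset_of_subset_not_subset (fun s hs => ⟨hs.1, by have := hs.2; omega⟩) fun hsub => by
      have := (hsub (show (i', s) ∈ _ from ⟨s2, Or.inr ⟨rfl, s1⟩⟩)).2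
      simp only at this
      omega) (h.segments_finite.subset fun s hs => hs.1)
  omega

theorem IsTMesh.le_of_colIndex_le (h : T.IsTMesh) {i j i' j' : ℤ} (hi : i ∈ T.hJ j)
    (hle : T.colIndex i j ≤ T.colIndex i' j') : i ≤ i' := by
  by_contra hlt
  exact absurd (h.colIndex_lt (j := j') (not_le.1 hlt) hi) (not_lt.2 hle)

/-- Points joined by vertical edges lie on the same segment. -/
theorem colIndex_eq_of_edges {i j j' : ℤ} (hj : j ≤ j') (hE : ∀ z, j ≤ z → z < j' → T.VEdge i z) :
    T.colIndex i j = T.colIndex i j' := by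
  unfold colIndex
  congr 3
  ext s
  refine and_congr_right fun hs => ?_
  have : s.1 = i → j < s.2 → ¬ s.2 ≤ j' := by
    rintro rfl h1 h2
    exact hs.2 (hE (s.2 - 1) (by omega) (by omega))
  omega

theorem rowIndex_eq_of_edges {i i' j : ℤ} (hi : i ≤ i') (hE : ∀ z, i ≤ z → z < i' → T.HEdge z j) :
    T.rowIndex i j = T.rowIndex i' j :=
  colIndex_eq_of_edges hi hE

theorem IsTMesh.colOf_colIndex (h : T.IsTMesh) {i j : ℤ} (hi : i ∈ T.hJ j) :
    T.colOf (T.colIndex i j) = i := by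
  obtain ⟨s, s1, s2, s3⟩ := h.exists_segment hi
  obtain ⟨j', hseg, hj'⟩ := Classical.epsilon_spec
    (p := fun x => ∃ y, T.IsVSegment (x, y) ∧ T.colIndex x y = T.colIndex i j)
    ⟨i, s, s2, colIndex_eq_of_edges s1 s3⟩
  change T.colIndex (T.colOf (T.colIndex i j)) j' = T.colIndex i j at hj'
  exact le_antisymm (h.le_of_colIndex_le (h.mem_hJ.2 (Or.inl hseg.1)) hj'.le)
    (h.le_of_colIndex_le hi hj'.ge)

theorem perturb_transpose (T : IndexMesh) : T.transpose.perturb = T.perturb.transpose := by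
  have hcol : ∀ i j, T.transpose.colIndex i j = T.rowIndex j i := fun i j => rfl
  have hrow : ∀ i j, T.transpose.rowIndex i j = T.colIndex j i := fun i j => by
    rw [rowIndex, T.transpose_transpose]
  have hcells : T.transpose.perturb.cells = T.perturb.transpose.cells := by
    change (fun Q : IndexRect => (⟨T.transpose.colIndex Q.l Q.b, T.transpose.colIndex Q.r Q.b,
      T.transpose.rowIndex Q.l Q.b, T.transpose.rowIndex Q.l Q.t⟩ : IndexRect)) ''
        ((fun Q : IndexRect => ⟨Q.b, Q.t, Q.l, Q.r⟩) '' T.cells) =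
      (fun Q : IndexRect => (⟨Q.b, Q.t, Q.l, Q.r⟩ : IndexRect)) ''
        ((fun Q : IndexRect => ⟨T.colIndex Q.l Q.b, T.colIndex Q.r Q.b,
          T.rowIndex Q.l Q.b, T.rowIndex Q.l Q.t⟩) '' T.cells)
    simp only [Set.image_image, hcol, hrow]
  have hmk : T.transpose.perturb = ⟨T.nlo, T.nlo - 1 + T.transpose.numVSegments, T.mlo,
      T.mlo - 1 + T.transpose.transpose.numVSegments, T.transpose.perturb.cells⟩ := rfl
  rw [hmk, hcells, T.transpose_transpose]
  rfl

theorem mem_perturb_hJ {k r : ℤ} : k ∈ T.perturb.hJ r ↔ ∃ Q ∈ T.cells,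
    (T.colIndex Q.l Q.b = k ∨ T.colIndex Q.r Q.b = k) ∧ T.rowIndex Q.l Q.b ≤ r ∧
      r ≤ T.rowIndex Q.l Q.t := by
  constructor
  · rintro ⟨_, ⟨Q, hQ, rfl⟩, h⟩; exact ⟨Q, hQ, h⟩
  · rintro ⟨Q, hQ, h⟩; exact ⟨_, ⟨Q, hQ, rfl⟩, h⟩

theorem colIndex_side {Q : IndexRect} (hQ : Q ∈ T.cells) {i j : ℤ}
    (hi : Q.l = i ∨ Q.r = i) (h1 : Q.b ≤ j) (h2 : j ≤ Q.t) :
    T.colIndex i Q.b = T.colIndex i j :=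
  colIndex_eq_of_edges h1 fun z z1 z2 => ⟨Q, hQ, hi, z1, by omega⟩

theorem rowIndex_side {Q : IndexRect} (hQ : Q ∈ T.cells) {i j : ℤ}
    (hj : Q.b = j ∨ Q.t = j) (h1 : Q.l ≤ i) (h2 : i ≤ Q.r) :
    T.rowIndex Q.l j = T.rowIndex i j :=
  rowIndex_eq_of_edges h1 fun z z1 z2 => hEdge_iff.2 ⟨Q, hQ, hj, z1, by omega⟩

theorem IsTMesh.isVertex_perturb (h : T.IsTMesh) {k r : ℤ} :
    T.perturb.IsVertex k r ↔
      ∃ i j, T.IsVertex i j ∧ T.colIndex i j = k ∧ T.rowIndex i j = r := by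
  constructor
  · rintro ⟨_, ⟨Q, hQ, rfl⟩, hk, hr⟩
    have hc := h.cell Q hQ
    obtain ⟨i, hi, hk⟩ : ∃ i, (Q.l = i ∨ Q.r = i) ∧ T.colIndex i Q.b = k := by
      rcases hk with hk | hk
      exacts [⟨_, Or.inl rfl, hk⟩, ⟨_, Or.inr rfl, hk⟩]
    obtain ⟨j, hj, hr⟩ : ∃ j, (Q.b = j ∨ Q.t = j) ∧ T.rowIndex Q.l j = r := by
      rcases hr with hr | hr
      exacts [⟨_, Or.inl rfl, hr⟩, ⟨_, Or.inr rfl, hr⟩]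
    exact ⟨i, j, ⟨Q, hQ, hi, hj⟩, by rw [← colIndex_side hQ hi (by omega) (by omega), hk],
      by rw [← rowIndex_side hQ hj (by omega) (by omega), hr]⟩
  · rintro ⟨i, j, ⟨Q, hQ, hi, hj⟩, rfl, rfl⟩
    have hc := h.cell Q hQ
    refine ⟨_, ⟨Q, hQ, rfl⟩, ?_, ?_⟩
    · rw [← colIndex_side hQ hi (by omega) (by omega)]
      exact hi.imp (fun e => by rw [← e]) (fun e => by rw [← e])
    · rw [← rowIndex_side hQ hj (by omega) (by omega)]
      exact hj.imp (fun e => by rw [← e]) (fun e => by rw [← e])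

/-! Each of the outermost columns is a single segment, so that the perturbation only shifts the
frame of the mesh. -/

theorem AnalysisSuitable.isVSegment_frame (h : T.AnalysisSuitable) {i s : ℤ}
    (hi : i = T.mlo ∨ i = T.mlo + 1 ∨ i = T.mlo + 2 ∨
      i = T.mhi - 2 ∨ i = T.mhi - 1 ∨ i = T.mhi) : T.IsVSegment (i, s) ↔ s = T.nlo := by
  have hd := h.isTMesh.dom_y
  constructor
  · rintro ⟨h1, h2⟩
    have hb := h.isTMesh.vEdge_bounds h1
    simp only at hb
    by_contra hne
    exact h2 (h.admissible.1.frame i hi (s - 1) (by omega) (by omega))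
  · rintro rfl
    exact ⟨h.admissible.1.frame i hi _ le_rfl (by omega), fun hcon => by
      have hb := h.isTMesh.vEdge_bounds hcon
      simp only at hb
      omega⟩

theorem ncard_frame (m M n : ℤ) :
    (((fun x : ℤ => (x, n)) '' Set.Icc m M).ncard : ℤ) = max (M + 1 - m) 0 := by
  rw [Set.ncard_image_of_injective _ fun x y hxy => (Prod.ext_iff.1 hxy).1,
    Set.ncard_eq_toFinset_card', Set.toFinset_Icc, Int.card_Icc, Int.ofNat_toNat]

theorem AnalysisSuitable.colIndex_low (h : T.AnalysisSuitable) {i j : ℤ} (hi : T.mlo ≤ i)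
    (hi' : i ≤ T.mlo + 2) (hj : T.nlo ≤ j) : T.colIndex i j = i := by
  have hset : {s : ℤ × ℤ | T.IsVSegment s ∧ (s.1 < i ∨ s.1 = i ∧ s.2 ≤ j)} =
      (fun x : ℤ => (x, T.nlo)) '' Set.Icc T.mlo i := by
    ext ⟨x, y⟩
    simp only [Set.mem_ofPred_eq, Set.mem_image, Set.mem_Icc, Prod.mk.injEq]
    constructor
    · rintro ⟨hs, hlex⟩
      have hb := h.isTMesh.vEdge_bounds hs.1
      simp only at hb
      exact ⟨x, by omega, rfl, ((h.isVSegment_frame (by omega)).1 hs).symm⟩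
    · rintro ⟨x, hx, rfl, rfl⟩
      exact ⟨(h.isVSegment_frame (by omega)).2 rfl, by omega⟩
  rw [colIndex, hset, ncard_frame]
  omega

theorem AnalysisSuitable.colIndex_top (h : T.AnalysisSuitable) {i : ℤ} (hi : T.mhi - 3 ≤ i)
    (hi' : i ≤ T.mhi) : T.colIndex i T.nhi = T.perturb.mhi - (T.mhi - i) := by
  have hset : {s | T.IsVSegment s} \
      {s : ℤ × ℤ | T.IsVSegment s ∧ (s.1 < i ∨ s.1 = i ∧ s.2 ≤ T.nhi)} =
      (fun x : ℤ => (x, T.nlo)) '' Set.Icc (i + 1) T.mhi := by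
    ext ⟨x, y⟩
    simp only [Set.mem_sdiff, Set.mem_ofPred_eq, Set.mem_image, Set.mem_Icc, Prod.mk.injEq]
    constructor
    · rintro ⟨hs, hlex⟩
      have hb := h.isTMesh.vEdge_bounds hs.1
      simp only at hb
      have hlex' : ¬ (x < i ∨ x = i ∧ y ≤ T.nhi) := fun h => hlex ⟨hs, h⟩
      exact ⟨x, by omega, rfl, ((h.isVSegment_frame (by omega)).1 hs).symm⟩
    · rintro ⟨x, hx, rfl, rfl⟩
      exact ⟨(h.isVSegment_frame (by omega)).2 rfl, fun hcon => by have := hcon.2; omega⟩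
  have hcard := Set.ncard_sdiff_add_ncard_of_subset
    (show {s : ℤ × ℤ | T.IsVSegment s ∧ (s.1 < i ∨ s.1 = i ∧ s.2 ≤ T.nhi)} ⊆
      {s | T.IsVSegment s} from fun s hs => hs.1) h.isTMesh.segments_finite
  have hf := ncard_frame (i + 1) T.mhi T.nlo
  rw [← hset] at hf
  simp only [colIndex, perturb, numVSegments]
  omega

theorem AnalysisSuitable.colIndex_high (h : T.AnalysisSuitable) {i j : ℤ} (hi : T.mhi - 2 ≤ i)
    (hi' : i ≤ T.mhi) (hj : T.nlo ≤ j) (hj' : j ≤ T.nhi) :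
    T.colIndex i j = T.perturb.mhi - (T.mhi - i) := by
  rw [← h.colIndex_top (by omega) hi']
  exact colIndex_eq_of_edges hj' fun z z1 z2 =>
    h.admissible.1.frame i (by omega) z (by omega) (by omega)

/-- The lowest segment of column `mlo + 3` is the first one after the left frame. -/
theorem AnalysisSuitable.exists_colIndex_mlo_add_three (h : T.AnalysisSuitable)
    (hd : T.mlo + 3 < T.mhi - 3) (hd' : T.nlo + 3 < T.nhi - 3) :
    ∃ j, T.mlo + 3 ∈ T.hJ j ∧ T.colIndex (T.mlo + 3) j = T.mlo + 3 := by
  have hE := h.admissible.1.vEdge_near_frame (i := T.mlo + 3) (j := T.nlo + 2)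
    (by omega) le_rfl (by omega)
  obtain ⟨s, s1, s2, s3, s4⟩ := exists_first (P := fun z => T.VEdge (T.mlo + 3) z)
    (show T.nlo ≤ T.nlo + 2 by omega) hE
  have hseg : T.IsVSegment (T.mlo + 3, s) := ⟨s3, fun hcon => s4 (s - 1)
    (by have hb := h.isTMesh.vEdge_bounds hcon; simp only at hb; omega) (by simp) hcon⟩
  refine ⟨s, h.isTMesh.mem_hJ.2 (Or.inl s3), ?_⟩
  have hset : {x : ℤ × ℤ | T.IsVSegment x ∧ (x.1 < T.mlo + 3 ∨ x.1 = T.mlo + 3 ∧ x.2 ≤ s)} =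
      insert (T.mlo + 3, s)
        {x : ℤ × ℤ | T.IsVSegment x ∧ (x.1 < T.mlo + 2 ∨ x.1 = T.mlo + 2 ∧ x.2 ≤ T.nhi)} := by
    ext ⟨x, y⟩
    simp only [Set.mem_ofPred_eq, Set.mem_insert_iff, Prod.mk.injEq]
    constructor
    · rintro ⟨hs, hlex⟩
      have hb := h.isTMesh.vEdge_bounds hs.1
      simp only at hb
      by_cases hx : x = T.mlo + 3
      · subst hx
        refine Or.inl ⟨rfl, ?_⟩
        by_contra hne
        exact s4 y (by omega) (by omega) hs.1
      · exact Or.inr ⟨hs, by omega⟩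
    · rintro (⟨rfl, rfl⟩ | ⟨hs, hlex⟩)
      · exact ⟨hseg, by omega⟩
      · exact ⟨hs, by omega⟩
  have hlow := h.colIndex_low (i := T.mlo + 2) (j := T.nhi) (by omega) le_rfl (by omega)
  rw [colIndex] at hlow ⊢
  rw [hset, Set.ncard_insert_of_notMem (by
    rintro ⟨-, hcon⟩; simp only at hcon; omega) (h.isTMesh.segments_finite.subset fun s hs => hs.1)]
  push_cast
  omega

theorem AnalysisSuitable.inActive_col (h : T.AnalysisSuitable) {a b : ℤ} (hb : T.nlo ≤ b)
    (hb' : b ≤ T.nhi) :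
    (T.perturb.mlo + 2 ≤ T.colIndex a b ∧ T.colIndex a b ≤ T.perturb.mhi - 2) ↔
      (T.mlo + 2 ≤ a ∧ a ≤ T.mhi - 2) := by
  have e : T.perturb.mlo = T.mlo := rfl
  have l1 := h.colIndex_low (i := T.mlo + 1) (j := T.nhi) (by omega) (by omega) (by omega)
  have l2 := h.colIndex_low (i := T.mlo + 2) (j := T.nlo) (by omega) (by omega) (by omega)
  have l3 := h.colIndex_high (i := T.mhi - 1) (j := T.nlo) (by omega) (by omega) (by omega)
    (by omega)
  have l4 := h.colIndex_high (i := T.mhi - 2) (j := T.nhi) (by omega) (by omega) (by omega)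
    (by omega)
  constructor
  · rintro ⟨h1, h2⟩
    constructor
    · by_contra hcon
      have := h.isTMesh.colIndex_mono (i := a) (j := b) (i' := T.mlo + 1) (j' := T.nhi) (by omega)
      omega
    · by_contra hcon
      have := h.isTMesh.colIndex_mono (i := T.mhi - 1) (j := T.nlo) (i' := a) (j' := b) (by omega)
      omega
  · rintro ⟨h1, h2⟩
    have k1 := h.isTMesh.colIndex_mono (i := T.mlo + 2) (j := T.nlo) (i' := a) (j' := b) (by omega)
    have k2 := h.isTMesh.colIndex_mono (i := a) (j := b) (i' := T.mhi - 2) (j' := T.nhi) (by omega)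
    omega

theorem IsTMesh.isVertex_bounds (h : T.IsTMesh) {a b : ℤ} (hV : T.IsVertex a b) :
    (T.mlo ≤ a ∧ a ≤ T.mhi) ∧ T.nlo ≤ b ∧ b ≤ T.nhi := by
  obtain ⟨Q, hQ, h1, h2⟩ := hV
  have := h.cell Q hQ
  omega

/-- The perturbation induces a correspondence of anchors. -/
theorem AnalysisSuitable.isAnchor_perturb (h : T.AnalysisSuitable) {k r : ℤ} :
    T.perturb.IsAnchor k r ↔
      ∃ a b, T.IsAnchor a b ∧ T.colIndex a b = k ∧ T.rowIndex a b = r := by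
  have key : ∀ a b, T.IsVertex a b →
      (T.perturb.InActive (T.colIndex a b) (T.rowIndex a b) ↔ T.InActive a b) := by
    intro a b hV
    have hb := h.isTMesh.isVertex_bounds hV
    have h1 := h.inActive_col (a := a) hb.2.1 hb.2.2
    have h2 := h.transpose.inActive_col (a := b) (b := a) hb.1.1 hb.1.2
    rw [perturb_transpose] at h2
    have e1 : T.perturb.transpose.mlo = T.perturb.nlo := rfl
    have e2 : T.perturb.transpose.mhi = T.perturb.nhi := rfl
    have e3 : T.transpose.mlo = T.nlo := rfl
    have e4 : T.transpose.mhi = T.nhi := rfl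
    rw [e1, e2, e3, e4] at h2
    unfold InActive rowIndex
    tauto
  constructor
  · rintro ⟨hV, hA⟩
    obtain ⟨a, b, hab, rfl, rfl⟩ := h.isTMesh.isVertex_perturb.1 hV
    exact ⟨a, b, ⟨hab, (key a b hab).1 hA⟩, rfl, rfl⟩
  · rintro ⟨a, b, hA, rfl, rfl⟩
    exact ⟨h.isTMesh.isVertex_perturb.2 ⟨a, b, hA.1, rfl, rfl⟩, (key a b hA.1).2 hA.2⟩

/-- If column `i` occurs near the anchor `(a, b)`, then either the vertical line runs through
`(i, b)` or row `b` contains a horizontal line from `a` to `i`: a vertical T-junction at `(i, b)`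
must not meet the extension of a horizontal line that ends before it. -/
theorem AnalysisSuitable.rowIndex_eq_or (h : T.AnalysisSuitable) {a b i : ℤ}
    (hA : T.IsAnchor a b) (hi : i ∈ T.hJ b)
    (hnear : AtMostOneBetween (fun x => x ∈ T.hJ b) a i) :
    T.rowIndex i b = T.rowIndex a b ∨ (T.VEdge i (b - 1) ∧ T.VEdge i b) := by
  by_cases hE : T.VEdge i (b - 1) ∧ T.VEdge i b
  · exact Or.inr hE
  left
  obtain ⟨-, h1, h2, h3, h4⟩ := id hA
  have hb : T.mlo ≤ i ∧ i ≤ T.mhi := by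
    rcases h.isTMesh.mem_hJ.1 hi with hV | hV <;> have := h.isTMesh.vEdge_bounds hV <;> omega
  have hact : T.mlo + 2 ≤ i ∧ i ≤ T.mhi - 2 := by
    by_contra hcon
    exact hE ⟨h.admissible.1.frame i (by omega) _ (by omega) (by omega),
      h.admissible.1.frame i (by omega) _ (by omega) (by omega)⟩
  have hExt : T.grid.VExt i b := by
    have hN : AtMostOneBetween (T.grid.Hp i) b b := fun p q hp => by
      unfold StrictlyBetween at hp; omega
    rcases h.isTMesh.mem_hJ.1 hi with hV | hV
    · exact ⟨b, Or.inr ⟨⟨⟨hact.1, hact.2, h3, h4⟩, hV, fun hc => hE ⟨hc, hV⟩⟩,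
        Or.inl ⟨le_rfl, hN⟩⟩⟩
    · exact ⟨b, Or.inl ⟨⟨⟨hact.1, hact.2, h3, h4⟩, hV, fun hc => hE ⟨hV, hc⟩⟩,
        Or.inl ⟨le_rfl, hN⟩⟩⟩
  have e : (fun x => x ∈ T.hJ b) = fun x => T.grid.Vp x b :=
    funext fun x => propext h.isTMesh.mem_hJ
  rw [e] at hnear
  have hseg := h.grid_suitable.row_edges hExt h3 h4 h1 h2 hnear
    (Or.inl (h.isTMesh.anchor_grid hA).2)
  rcases le_total a i with hai | hai
  · exact (rowIndex_eq_of_edges hai fun z z1 z2 => hseg z (by omega)).symm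
  · exact rowIndex_eq_of_edges hai fun z z1 z2 => hseg z (by omega)

theorem AnalysisSuitable.colIndex_mem_perturb_hJ (h : T.AnalysisSuitable) {a b i : ℤ}
    (hA : T.IsAnchor a b) (hi : i ∈ T.hJ b)
    (hnear : AtMostOneBetween (fun x => x ∈ T.hJ b) a i) :
    T.colIndex i b ∈ T.perturb.hJ (T.rowIndex a b) := by
  have hM := h.isTMesh
  have hMt := h.isTMesh.transpose
  have hba : b ∈ T.vJ a := hM.mem_vJ.2 (hM.anchor_grid hA).2
  have key : ∀ Q ∈ T.cells, (Q.l = i ∨ Q.r = i) → Q.b ≤ b → b ≤ Q.t →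
      (T.rowIndex i b ≤ T.rowIndex a b ∨ Q.b < b) → (T.rowIndex a b ≤ T.rowIndex i b ∨ b < Q.t) →
      T.colIndex i b ∈ T.perturb.hJ (T.rowIndex a b) := by
    intro Q hQ hQi hb ht h1 h2
    have hc := hM.cell Q hQ
    refine mem_perturb_hJ.2 ⟨Q, hQ, ?_, ?_, ?_⟩
    · rw [← colIndex_side hQ hQi hb ht]
      exact hQi.imp (fun e => by rw [e]) (fun e => by rw [e])
    · rcases hb.lt_or_eq with hlt | heq
      · exact (hMt.colIndex_lt hlt hba).le
      · rw [rowIndex_side hQ (Or.inl rfl) (i := i) (by omega) (by omega), heq]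
        exact h1.resolve_right (by omega)
    · rcases ht.lt_or_eq with hlt | heq
      · refine (hMt.colIndex_lt hlt ⟨⟨Q.b, Q.t, Q.l, Q.r⟩, mem_transpose_cells.2 hQ, Or.inr rfl,
          le_rfl, ?_⟩).le
        simp only; omega
      · rw [rowIndex_side hQ (Or.inr rfl) (i := i) (by omega) (by omega), ← heq]
        exact h2.resolve_right (by omega)
  rcases h.rowIndex_eq_or hA hi hnear with heq | ⟨⟨Q, hQ, q1, q2, q3⟩, R, hR, r1, r2, r3⟩
  · obtain ⟨Q, hQ, q1, q2, q3⟩ := hi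
    exact key Q hQ q1 q2 q3 (Or.inl heq.le) (Or.inl heq.ge)
  · rcases le_total (T.rowIndex i b) (T.rowIndex a b) with hle | hle
    · exact key R hR r1 r2 (by omega) (Or.inl hle) (Or.inr (by omega))
    · exact key Q hQ q1 (by omega) (by omega) (Or.inr (by omega)) (Or.inl hle)

/-- The index vector of an anchor is moved entry by entry to that of the perturbed anchor. -/
theorem AnalysisSuitable.consecutive_perturb (h : T.AnalysisSuitable) {a b : ℤ}
    (hA : T.IsAnchor a b) {v : Fin 5 → ℤ} (hv : Consecutive (T.hJ b) v) (hva : v 2 = a) :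
    Consecutive (T.perturb.hJ (T.rowIndex a b)) fun k => T.colIndex (v k) b := by
  have hM := h.isTMesh
  refine ⟨fun k l hkl => hM.colIndex_lt (hv.1 hkl) (hv.2.1 l), fun k => ?_, ?_⟩
  · exact h.colIndex_mem_perturb_hJ hA (hv.2.1 k) (hva ▸ hv.atMostOneBetween
      (hv.1.monotone (Fin.zero_le _)) (hv.1.monotone (Fin.le_last _)))
  · intro x hx k l hk hl
    obtain ⟨Q, hQ, hx, h1, h2⟩ := mem_perturb_hJ.1 hx
    have hc := hM.cell Q hQ
    have hb : Q.b ≤ b := hM.transpose.le_of_colIndex_le (i := Q.b) (j := Q.l)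
      ⟨⟨Q.b, Q.t, Q.l, Q.r⟩, mem_transpose_cells.2 hQ, Or.inl rfl, le_rfl, by simp only; omega⟩ h1
    have ht : b ≤ Q.t := hM.transpose.le_of_colIndex_le
      (hM.mem_vJ.2 (hM.anchor_grid hA).2) h2
    obtain ⟨i, hi, rfl⟩ : ∃ i, (Q.l = i ∨ Q.r = i) ∧ T.colIndex i b = x := by
      rcases hx with hx | hx
      · exact ⟨_, Or.inl rfl, by rw [← colIndex_side hQ (Or.inl rfl) hb ht, hx]⟩
      · exact ⟨_, Or.inr rfl, by rw [← colIndex_side hQ (Or.inr rfl) hb ht, hx]⟩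
    have hib : i ∈ T.hJ b := ⟨Q, hQ, hi, hb, ht⟩
    obtain ⟨p, hp⟩ := hv.2.2 i hib k l (hM.le_of_colIndex_le (hv.2.1 k) hk)
      (hM.le_of_colIndex_le hib hl)
    exact ⟨p, by simp only [hp]⟩

/-- The sum of the original knot intervals telescopes, and the inserted ones vanish in the
limit. -/
theorem perturbKnots_tendsto (T : IndexMesh) (ξ c : ℤ → ℝ) (hlo : T.colOf T.mlo = T.mlo) {k : ℤ}
    (hk : T.mlo ≤ k) :
    Tendsto (fun δ => T.perturbKnots ξ c δ k) (𝓝[>] 0) (𝓝 (ξ (T.colOf k))) := by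
  have hsum : ξ (T.colOf k) = ξ T.mlo +
      ∑ p ∈ Finset.Ioc T.mlo k, (ξ (T.colOf p) - ξ (T.colOf (p - 1))) := by
    induction k, hk using Int.leInduction with
    | base => simp [hlo]
    | succ k hk ih =>
      have : Finset.Ioc T.mlo (k + 1) = insert (k + 1) (Finset.Ioc T.mlo k) := by
        ext x; simp only [Finset.mem_Ioc, Finset.mem_insert]; omega
      rw [this, Finset.sum_insert (by simp)]
      simp only [add_sub_cancel_right]
      linarith
  rw [hsum]
  refine tendsto_const_nhds.add (tendsto_finsetSum _ fun p _ => ?_)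
  split_ifs with h0
  · rw [h0]
    have : Tendsto (fun δ : ℝ => c p * δ) (𝓝 0) (𝓝 (c p * 0)) :=
      (continuous_const.mul continuous_id).tendsto 0
    rw [mul_zero] at this
    exact this.mono_left nhdsWithin_le_nhds
  · exact tendsto_const_nhds

theorem AnalysisSuitable.colOf_mlo (h : T.AnalysisSuitable) : T.colOf T.mlo = T.mlo := by
  have hd := h.isTMesh.dom_y
  have := h.isTMesh.colOf_colIndex (i := T.mlo) (j := T.nlo)
    (h.frame_mem_hJ (by omega) le_rfl (by omega))
  rwa [h.colIndex_low le_rfl (by omega) le_rfl] at this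

theorem AnalysisSuitable.mlo_le_colIndex (h : T.AnalysisSuitable) {i j : ℤ} (hi : i ∈ T.hJ j) :
    T.mlo ≤ T.colIndex i j := by
  have hM := h.isTMesh
  have hd := hM.dom_y
  have hb : T.mlo ≤ i ∧ T.nlo ≤ j := by
    rcases hM.mem_hJ.1 hi with hV | hV <;> have := hM.vEdge_bounds hV <;> omega
  have := hM.colIndex_mono (i := T.mlo) (j := T.nlo) (i' := i) (j' := j) (by omega)
  rwa [h.colIndex_low le_rfl (by omega) le_rfl] at this

theorem AnalysisSuitable.perturbKnots_colIndex (h : T.AnalysisSuitable) (ξ c : ℤ → ℝ) {i j : ℤ}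
    (hi : i ∈ T.hJ j) :
    Tendsto (fun δ => T.perturbKnots ξ c δ (T.colIndex i j)) (𝓝[>] 0) (𝓝 (ξ i)) := by
  have := T.perturbKnots_tendsto ξ c h.colOf_mlo (h.mlo_le_colIndex hi)
  rwa [h.isTMesh.colOf_colIndex hi] at this

theorem AnalysisSuitable.perturbKnots_left (h : T.AnalysisSuitable) (ξ c : ℤ → ℝ)
    (hd : T.mlo + 3 < T.mhi - 3) (hd' : T.nlo + 3 < T.nhi - 3) :
    Tendsto (fun δ => T.perturbKnots ξ c δ (T.perturb.mlo + 3)) (𝓝[>] 0)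
      (𝓝 (ξ (T.mlo + 3))) := by
  obtain ⟨j, hj, he⟩ := h.exists_colIndex_mlo_add_three hd hd'
  have := h.perturbKnots_colIndex ξ c hj
  rwa [he] at this

theorem AnalysisSuitable.perturbKnots_right (h : T.AnalysisSuitable) (ξ c : ℤ → ℝ)
    (hd : T.nlo + 3 < T.nhi - 3) :
    Tendsto (fun δ => T.perturbKnots ξ c δ (T.perturb.mhi - 3)) (𝓝[>] 0)
      (𝓝 (ξ (T.mhi - 3))) := by
  obtain ⟨z, z1, z2, z3, z4⟩ := exists_last (P := fun z => T.VEdge (T.mhi - 3) (z - 1))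
    (show T.nlo + 3 ≤ T.nhi by omega)
    (h.admissible.1.vEdge_near_frame (by omega) (by omega) (by omega))
  have hz : T.mhi - 3 ∈ T.hJ z := h.isTMesh.mem_hJ.2 (Or.inr z3)
  have he : T.colIndex (T.mhi - 3) z = T.perturb.mhi - 3 := by
    have htop := h.colIndex_top (i := T.mhi - 3) le_rfl (by omega)
    have heq : T.colIndex (T.mhi - 3) z = T.colIndex (T.mhi - 3) T.nhi := by
      unfold colIndex
      congr 3
      ext s
      refine and_congr_right fun hs => ?_
      have hb := h.isTMesh.vEdge_bounds hs.1
      have : s.1 = T.mhi - 3 → ¬ z < s.2 := fun e hlt =>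
        z4 (s.2 + 1) (by omega) (by omega) (by simpa [← e] using hs.1)
      omega
    omega
  have := h.perturbKnots_colIndex ξ c hz
  rwa [he] at this

end IndexMesh

namespace TSpline

open IndexMesh

theorem IsAnalysisSuitable.exists_indexVectors {T : TSpline} (hT : T.IsAnalysisSuitable) {a b : ℤ}
    (hA : T.mesh.IsAnchor a b) : ∃ v w, T.IsIndexVectors a b v w := by
  have hM := hT.mesh.isTMesh
  have hG := hM.anchor_grid hA
  obtain ⟨v, hv, hva⟩ := hT.mesh.exists_hVector (hM.mem_hJ.2 hG.1) hA.2
  obtain ⟨w, hw, hwb⟩ := hT.mesh.transpose.exists_hVector (a := b) (b := a) (hM.mem_vJ.2 hG.2)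
    ⟨hA.2.2.2.1, hA.2.2.2.2, hA.2.1, hA.2.2.1⟩
  exact ⟨v, w, hv, hva, hw, hwb⟩

/-- The perturbed blending functions are indexed by the original anchors. -/
theorem IsAnalysisSuitable.space_perturb {T : TSpline} (hT : T.IsAnalysisSuitable) (c d : ℤ → ℝ)
    (δ : ℝ) : (T.perturb c d δ).space = Submodule.span ℝ {f | ∃ (a b : ℤ) (v w : Fin 5 → ℤ),
      T.mesh.IsAnchor a b ∧ T.IsIndexVectors a b v w ∧ f = (T.perturb c d δ).blending
        (fun k => T.mesh.colIndex (v k) b) (fun k => T.mesh.rowIndex a (w k))} := by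
  have hmove : ∀ {a b v w}, T.mesh.IsAnchor a b → T.IsIndexVectors a b v w →
      (T.perturb c d δ).IsIndexVectors (T.mesh.colIndex a b) (T.mesh.rowIndex a b)
        (fun k => T.mesh.colIndex (v k) b) (fun k => T.mesh.rowIndex a (w k)) := by
    rintro a b v w hA ⟨hv, hva, hw, hwb⟩
    refine ⟨hT.mesh.consecutive_perturb hA hv hva, by simp only [hva], ?_, by simp only [hwb]⟩
    have hAt : T.mesh.transpose.IsAnchor b a := by
      obtain ⟨⟨Q, hQ, h1, h2⟩, h3, h4, h5, h6⟩ := hA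
      exact ⟨⟨⟨Q.b, Q.t, Q.l, Q.r⟩, mem_transpose_cells.2 hQ, h2, h1⟩, h5, h6, h3, h4⟩
    have := hT.mesh.transpose.consecutive_perturb hAt hw hwb
    rw [perturb_transpose, rowIndex, transpose_transpose] at this
    exact this
  unfold space
  congr 1
  ext f
  constructor
  · rintro ⟨a', b', v', w', hA', hI', rfl⟩
    obtain ⟨a, b, hA, rfl, rfl⟩ := hT.mesh.isAnchor_perturb.1 hA'
    obtain ⟨v, w, hI⟩ := hT.exists_indexVectors hA
    obtain ⟨m1, m2, m3, m4⟩ := hmove hA hI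
    obtain ⟨n1, n2, n3, n4⟩ := hI'
    refine ⟨a, b, v, w, hA, hI, ?_⟩
    rw [n1.unique m1 (n2.trans m2.symm), n3.unique m3 (n4.trans m4.symm)]
  · rintro ⟨a, b, v, w, hA, hI, rfl⟩
    exact ⟨_, _, _, _, hT.mesh.isAnchor_perturb.2
      ⟨a, b, hA, rfl, rfl⟩, hmove hA hI, rfl⟩

end TSpline

/-! ### Continuity of B-splines -/

theorem coxDeBoor_eq_zero {R x : ℝ} {t : ℕ → ℝ} (hx : x ≠ R) : ∀ {p i : ℕ},
    ((∀ k, i ≤ k → k ≤ i + p + 1 → t k < x) ∨ (∀ k, i ≤ k → k ≤ i + p + 1 → x < t k)) →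
    coxDeBoor R t p i x = 0
  | 0, i, h => by
    simp only [coxDeBoor, if_neg hx]
    refine if_neg ?_
    rintro ⟨h1, h2⟩
    rcases h with h | h
    · exact (h (i + 1) (by omega) (by omega)).not_gt h2
    · exact (h i le_rfl (by omega)).not_ge h1
  | p + 1, i, h => by
    rw [coxDeBoor, coxDeBoor_eq_zero hx (p := p) (i := i),
      coxDeBoor_eq_zero hx (p := p) (i := i + 1)]
    · simp
    · exact h.imp (fun h k h1 h2 => h k (by omega) (by omega))
        (fun h k h1 h2 => h k (by omega) (by omega))
    · exact h.imp (fun h k h1 h2 => h k (by omega) (by omega))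
        (fun h k h1 h2 => h k (by omega) (by omega))

/-- Away from the limit knots, B-splines depend continuously on the knots. Where knots coalesce, the
lower order B-spline multiplied by a vanishing denominator is eventually zero. -/
theorem coxDeBoor_tendsto {ι : Type*} {l : Filter ι} {R' : ι → ℝ} {R x : ℝ} {t' : ι → ℕ → ℝ}
    {t : ℕ → ℝ} (hR : Tendsto R' l (𝓝 R)) (ht : ∀ k, Tendsto (fun d => t' d k) l (𝓝 (t k)))
    (hxR : x ≠ R) (hxt : ∀ k, x ≠ t k) : ∀ {p i : ℕ},
    (∀ k k', i ≤ k → k ≤ k' → k' ≤ i + p + 1 → t k ≤ t k') →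
    Tendsto (fun d => coxDeBoor (R' d) (t' d) p i x) l (𝓝 (coxDeBoor R t p i x)) := by
  have hne : ∀ᶠ d in l, x ≠ R' d := (hR.eventually_ne hxR.symm).mono fun d h => h.symm
  have hpos : ∀ k, ∀ᶠ d in l, (t' d k < x ↔ t k < x) ∧ (x < t' d k ↔ x < t k) := by
    intro k
    rcases lt_or_gt_of_ne (hxt k) with h | h
    · filter_upwards [(ht k).eventually_const_lt h] with d hd
      exact ⟨iff_of_false hd.not_gt h.not_gt, iff_of_true hd h⟩
    · filter_upwards [(ht k).eventually_lt_const h] with d hd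
      exact ⟨iff_of_true hd h, iff_of_false hd.not_gt h.not_gt⟩
  -- one summand of the recursion, for the knots from `i` to `i + p + 1`
  have term : ∀ {p i : ℕ} {f : ι → ℝ} {y : ℝ}, Tendsto f l (𝓝 y) →
      (∀ k k', i ≤ k → k ≤ k' → k' ≤ i + p + 1 → t k ≤ t k') →
      Tendsto (fun d => coxDeBoor (R' d) (t' d) p i x) l (𝓝 (coxDeBoor R t p i x)) →
      Tendsto (fun d => f d / (t' d (i + p + 1) - t' d i) * coxDeBoor (R' d) (t' d) p i x) l
        (𝓝 (y / (t (i + p + 1) - t i) * coxDeBoor R t p i x)) := by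
    intro p i f y hf hmono hB
    by_cases hd : t (i + p + 1) = t i
    · have hsame : ∀ k, i ≤ k → k ≤ i + p + 1 → t k = t i := fun k h1 h2 =>
        le_antisymm (hd ▸ hmono k (i + p + 1) h1 h2 le_rfl) (hmono i k le_rfl h1 h2)
      have hside : (∀ k, i ≤ k → k ≤ i + p + 1 → t k < x) ∨
          (∀ k, i ≤ k → k ≤ i + p + 1 → x < t k) := by
        rcases lt_or_gt_of_ne (hxt i) with h | h
        · exact Or.inr fun k h1 h2 => by rw [hsame k h1 h2]; exact h
        · exact Or.inl fun k h1 h2 => by rw [hsame k h1 h2]; exact h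
      rw [coxDeBoor_eq_zero hxR hside, mul_zero]
      refine tendsto_const_nhds.congr' ?_
      have hall : ∀ᶠ d in l, ∀ k ∈ Finset.Icc i (i + p + 1),
          (t' d k < x ↔ t k < x) ∧ (x < t' d k ↔ x < t k) :=
        (Finset.eventually_all _).2 fun k _ => hpos k
      filter_upwards [hne, hall] with d h1 h2
      rw [coxDeBoor_eq_zero h1, mul_zero]
      exact hside.imp (fun h k k1 k2 => (h2 k (Finset.mem_Icc.2 ⟨k1, k2⟩)).1.2 (h k k1 k2))
        (fun h k k1 k2 => (h2 k (Finset.mem_Icc.2 ⟨k1, k2⟩)).2.2 (h k k1 k2))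
    · exact (hf.div ((ht _).sub (ht _)) (sub_ne_zero.2 hd)).mul hB
  intro p
  induction p with
  | zero =>
    intro i _
    refine tendsto_const_nhds.congr' ?_
    filter_upwards [hne, hpos i, hpos (i + 1)] with d h1 h2 h3
    have e1 : t' d i ≤ x ↔ t i ≤ x := by rw [← not_lt, h2.2, not_lt]
    simp only [coxDeBoor, if_neg h1, if_neg hxR, e1, h3.2]
  | succ p ih =>
    intro i hmono
    have h1 := term (p := p) (i := i) ((tendsto_const_nhds (x := x)).sub (ht i))
      (fun k k' a b c => hmono k k' a b (by omega))
      (ih fun k k' a b c => hmono k k' a b (by omega))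
    have h2 := term (p := p) (i := i + 1) ((ht (i + p + 2)).sub (tendsto_const_nhds (x := x)))
      (fun k k' a b c => hmono k k' (by omega) b (by omega))
      (ih fun k k' a b c => hmono k k' (by omega) b (by omega))
    have e : i + 1 + p + 1 = i + p + 2 := by omega
    rw [e] at h2
    exact h1.add h2

theorem coxDeBoor_tendsto_right {R x : ℝ} (t : ℕ → ℝ) (hx : x < R) : ∀ p i : ℕ,
    Tendsto (coxDeBoor R t p i) (𝓝[>] x) (𝓝 (coxDeBoor R t p i x))
  | 0, i => by
    have hev : ∀ᶠ y in 𝓝[>] x, coxDeBoor R t 0 i x = coxDeBoor R t 0 i y := by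
      have h1 : ∀ k, ∀ᶠ y in 𝓝[>] x, (y < t k ↔ x < t k) := fun k => by
        rcases lt_or_ge x (t k) with h | h
        · filter_upwards [Ioo_mem_nhdsGT h] with y hy
          exact iff_of_true hy.2 h
        · filter_upwards [self_mem_nhdsWithin] with y hy
          exact iff_of_false (h.trans_lt hy).not_gt h.not_gt
      filter_upwards [h1 i, h1 (i + 1), Ioo_mem_nhdsGT hx] with y h2 h3 h4
      have e1 : t i ≤ y ↔ t i ≤ x := by rw [← not_lt, h2, not_lt]
      simp only [coxDeBoor, if_neg hx.ne, if_neg h4.2.ne, e1, h3]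
    exact tendsto_const_nhds.congr' hev
  | p + 1, i => by
    have c1 : Tendsto (fun y : ℝ => (y - t i) / (t (i + p + 1) - t i)) (𝓝[>] x)
        (𝓝 ((x - t i) / (t (i + p + 1) - t i))) :=
      (((continuous_id.sub continuous_const).div_const _).tendsto x).mono_left nhdsWithin_le_nhds
    have c2 : Tendsto (fun y : ℝ => (t (i + p + 2) - y) / (t (i + p + 2) - t (i + 1))) (𝓝[>] x)
        (𝓝 ((t (i + p + 2) - x) / (t (i + p + 2) - t (i + 1)))) :=
      (((continuous_const.sub continuous_id).div_const _).tendsto x).mono_left nhdsWithin_le_nhds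
    exact (c1.mul (coxDeBoor_tendsto_right t hx p i)).add
      (c2.mul (coxDeBoor_tendsto_right t hx p (i + 1)))

theorem coxDeBoor_tendsto_left (R : ℝ) (t : ℕ → ℝ) : ∀ p i : ℕ,
    Tendsto (coxDeBoor R t p i) (𝓝[<] R) (𝓝 (coxDeBoor R t p i R))
  | 0, i => by
    have hev : ∀ᶠ y in 𝓝[<] R, coxDeBoor R t 0 i R = coxDeBoor R t 0 i y := by
      have h1 : ∀ k, ∀ᶠ y in 𝓝[<] R, (t k ≤ y ↔ t k < R) := fun k => by
        rcases lt_or_ge (t k) R with h | h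
        · filter_upwards [Ioo_mem_nhdsLT h] with y hy
          exact iff_of_true hy.1.le h
        · filter_upwards [self_mem_nhdsWithin] with y hy
          exact iff_of_false (lt_of_lt_of_le hy h).not_ge h.not_gt
      filter_upwards [h1 i, h1 (i + 1), self_mem_nhdsWithin] with y h2 h3 h4
      have e1 : y < t (i + 1) ↔ R ≤ t (i + 1) := by rw [← not_le, h3, not_lt]
      have h5 : y ≠ R := ne_of_lt (show y < R from h4)
      simp only [coxDeBoor, if_true, if_neg h5, e1, h2]
    exact tendsto_const_nhds.congr' hev
  | p + 1, i => by
    have c1 : Tendsto (fun y : ℝ => (y - t i) / (t (i + p + 1) - t i)) (𝓝[<] R)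
        (𝓝 ((R - t i) / (t (i + p + 1) - t i))) :=
      (((continuous_id.sub continuous_const).div_const _).tendsto R).mono_left nhdsWithin_le_nhds
    have c2 : Tendsto (fun y : ℝ => (t (i + p + 2) - y) / (t (i + p + 2) - t (i + 1))) (𝓝[<] R)
        (𝓝 ((t (i + p + 2) - R) / (t (i + p + 2) - t (i + 1)))) :=
      (((continuous_const.sub continuous_id).div_const _).tendsto R).mono_left nhdsWithin_le_nhds
    exact (c1.mul (coxDeBoor_tendsto_left R t p i)).add
      (c2.mul (coxDeBoor_tendsto_left R t p (i + 1)))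

theorem cubicBSpline_tendsto {ι : Type*} {l : Filter ι} {R' : ι → ℝ} {R x : ℝ}
    {t' : ι → Fin 5 → ℝ} {t : Fin 5 → ℝ} (hR : Tendsto R' l (𝓝 R))
    (ht : ∀ k, Tendsto (fun d => t' d k) l (𝓝 (t k))) (hxR : x ≠ R) (hxt : ∀ k, x ≠ t k)
    (hmono : Monotone t) :
    Tendsto (fun d => cubicBSpline (R' d) (t' d) x) l (𝓝 (cubicBSpline R t x)) := by
  refine coxDeBoor_tendsto (t' := fun d k => t' d (Fin.ofNat 5 k)) hR (fun k => ht _) hxR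
    (fun k => hxt _) fun k k' _ h1 h2 => hmono ?_
  rw [Fin.le_def]
  simp only [Fin.ofNat]
  omega

theorem cubicBSpline_eq_zero {R x : ℝ} {t : Fin 5 → ℝ} (hx : x ≠ R)
    (h : (∀ k, t k < x) ∨ (∀ k, x < t k)) : cubicBSpline R t x = 0 :=
  coxDeBoor_eq_zero hx (h.imp (fun h _ _ _ => h _) (fun h _ _ _ => h _))

/-! ### Polynomial pieces and dual functionals -/

/-- The cubic polynomial with coefficients `κ`. -/
def cubicEval (κ : Fin 4 → ℝ) (x : ℝ) : ℝ := κ 0 + κ 1 * x + κ 2 * x ^ 2 + κ 3 * x ^ 3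

/-- The coefficients of `(x - a) (x - b) (x - c)`. -/
def cubicOfRoots (a b c : ℝ) : Fin 4 → ℝ :=
  ![-(a * b * c), a * b + b * c + c * a, -(a + b + c), 1]

/-- The blossom of a cubic polynomial at the three inner knots of `[t 0, …, t 4]`. It is the
functional dual to the B-spline with these knots among the B-splines of any knot vector in which
they are consecutive. -/
noncomputable def dualFunctional (t : Fin 5 → ℝ) : (Fin 4 → ℝ) →ₗ[ℝ] ℝ where
  toFun κ := κ 0 + κ 1 * ((t 1 + t 2 + t 3) / 3) +
    κ 2 * ((t 1 * t 2 + t 2 * t 3 + t 3 * t 1) / 3) + κ 3 * (t 1 * t 2 * t 3)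
  map_add' κ κ' := by simp only [Pi.add_apply]; ring
  map_smul' c κ := by simp only [Pi.smul_apply, smul_eq_mul, RingHom.id_apply]; ring

theorem cubicEval_cubicOfRoots (a b c x : ℝ) :
    cubicEval (cubicOfRoots a b c) x = (x - a) * (x - b) * (x - c) := by
  simp only [cubicEval, cubicOfRoots, Matrix.cons_val]; ring

theorem cubicEval_add (κ κ' : Fin 4 → ℝ) (x : ℝ) :
    cubicEval (κ + κ') x = cubicEval κ x + cubicEval κ' x := by
  simp only [cubicEval, Pi.add_apply]; ring

theorem cubicEval_smul (c : ℝ) (κ : Fin 4 → ℝ) (x : ℝ) :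
    cubicEval (c • κ) x = c * cubicEval κ x := by
  simp only [cubicEval, Pi.smul_apply, smul_eq_mul]; ring

theorem dualFunctional_cubicOfRoots (t : Fin 5 → ℝ) (a b c : ℝ) :
    dualFunctional t (cubicOfRoots a b c) =
      ((t 1 - a) * ((t 2 - b) * (t 3 - c) + (t 2 - c) * (t 3 - b)) +
        (t 1 - b) * ((t 2 - a) * (t 3 - c) + (t 2 - c) * (t 3 - a)) +
        (t 1 - c) * ((t 2 - a) * (t 3 - b) + (t 2 - b) * (t 3 - a))) / 6 := by
  simp only [dualFunctional, cubicOfRoots, Matrix.cons_val, LinearMap.coe_mk, AddHom.coe_mk]; ring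

/-- The polynomial piece of the cubic B-spline on its knot interval `[t r, t (r + 1)]`. -/
noncomputable def bsplinePiece (t : Fin 5 → ℝ) : Fin 4 → Fin 4 → ℝ
  | 0 => ((t 3 - t 0) * (t 2 - t 0) * (t 1 - t 0))⁻¹ • cubicOfRoots (t 0) (t 0) (t 0)
  | 1 => (-((t 3 - t 0) * (t 2 - t 0) * (t 2 - t 1))⁻¹) • cubicOfRoots (t 0) (t 0) (t 2) +
      (-((t 3 - t 0) * (t 3 - t 1) * (t 2 - t 1))⁻¹) • cubicOfRoots (t 0) (t 3) (t 1) +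
      (-((t 4 - t 1) * (t 3 - t 1) * (t 2 - t 1))⁻¹) • cubicOfRoots (t 4) (t 1) (t 1)
  | 2 => ((t 3 - t 0) * (t 3 - t 1) * (t 3 - t 2))⁻¹ • cubicOfRoots (t 0) (t 3) (t 3) +
      ((t 4 - t 1) * (t 3 - t 1) * (t 3 - t 2))⁻¹ • cubicOfRoots (t 4) (t 1) (t 3) +
      ((t 4 - t 1) * (t 4 - t 2) * (t 3 - t 2))⁻¹ • cubicOfRoots (t 4) (t 4) (t 2)
  | 3 => (-((t 4 - t 1) * (t 4 - t 2) * (t 4 - t 3))⁻¹) • cubicOfRoots (t 4) (t 4) (t 4)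

theorem cubicBSpline_eq_piece {R x : ℝ} {t : Fin 5 → ℝ} (hx : x ≠ R) (hmono : Monotone t)
    {r : Fin 4} (h1 : t r.castSucc < x) (h2 : x < t r.succ) :
    cubicBSpline R t x = cubicEval (bsplinePiece t r) x := by
  have m01 := hmono (show (0 : Fin 5) ≤ 1 by decide)
  have m12 := hmono (show (1 : Fin 5) ≤ 2 by decide)
  have m23 := hmono (show (2 : Fin 5) ≤ 3 by decide)
  have m34 := hmono (show (3 : Fin 5) ≤ 4 by decide)
  have e0 : Fin.ofNat 5 0 = 0 := rfl
  have e1 : Fin.ofNat 5 1 = 1 := rfl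
  have e2 : Fin.ofNat 5 2 = 2 := rfl
  have e3 : Fin.ofNat 5 3 = 3 := rfl
  have e4 : Fin.ofNat 5 4 = 4 := rfl
  simp only [cubicBSpline, coxDeBoor, if_neg hx, Nat.zero_add, Nat.reduceAdd, e0, e1, e2, e3, e4]
  fin_cases r
  · have h1 : t 0 < x := h1
    have h2 : x < t 1 := h2
    rw [if_pos ⟨h1.le, h2⟩, if_neg fun h => absurd h.1 (by linarith),
      if_neg fun h => absurd h.1 (by linarith), if_neg fun h => absurd h.1 (by linarith)]
    simp only [bsplinePiece, cubicEval_smul, cubicEval_cubicOfRoots, mul_inv_rev, div_eq_mul_inv]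
    ring
  · have h1 : t 1 < x := h1
    have h2 : x < t 2 := h2
    rw [if_neg fun h => absurd h.2 (by linarith), if_pos ⟨h1.le, h2⟩,
      if_neg fun h => absurd h.1 (by linarith), if_neg fun h => absurd h.1 (by linarith)]
    simp only [bsplinePiece, cubicEval_add, cubicEval_smul, cubicEval_cubicOfRoots,
      mul_inv_rev, div_eq_mul_inv]
    ring
  · have h1 : t 2 < x := h1
    have h2 : x < t 3 := h2
    rw [if_neg fun h => absurd h.2 (by linarith), if_neg fun h => absurd h.2 (by linarith),
      if_pos ⟨h1.le, h2⟩, if_neg fun h => absurd h.1 (by linarith)]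
    simp only [bsplinePiece, cubicEval_add, cubicEval_smul, cubicEval_cubicOfRoots,
      mul_inv_rev, div_eq_mul_inv]
    ring
  · have h1 : t 3 < x := h1
    have h2 : x < t 4 := h2
    rw [if_neg fun h => absurd h.2 (by linarith), if_neg fun h => absurd h.2 (by linarith),
      if_neg fun h => absurd h.2 (by linarith), if_pos ⟨h1.le, h2⟩]
    simp only [bsplinePiece, cubicEval_smul, cubicEval_cubicOfRoots, mul_inv_rev, div_eq_mul_inv]
    ring

/-- Duality on a knot interval that is the `r`-th one of `t` and the `r'`-th one of `s`, if the
two knot vectors agree wherever both are defined. -/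
theorem dualFunctional_bsplinePiece {t s : Fin 5 → ℝ} (hs : Monotone s) {r r' : Fin 4}
    (hlt : s r'.castSucc < s r'.succ)
    (hst : ∀ k k' : Fin 5, (k : ℕ) + r' = k' + r → t k = s k') :
    dualFunctional t (bsplinePiece s r') = if r = r' then 1 else 0 := by
  have m01 := hs (show (0 : Fin 5) ≤ 1 by decide)
  have m12 := hs (show (1 : Fin 5) ≤ 2 by decide)
  have m23 := hs (show (2 : Fin 5) ≤ 3 by decide)
  have m34 := hs (show (3 : Fin 5) ≤ 4 by decide)
  fin_cases r'
  · have hlt : s 0 < s 1 := hlt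
    have d1 : s 1 - s 0 ≠ 0 := by linarith
    have d2 : s 2 - s 0 ≠ 0 := by linarith
    have d3 : s 3 - s 0 ≠ 0 := by linarith
    simp only [bsplinePiece, map_smul, dualFunctional_cubicOfRoots, smul_eq_mul]
    fin_cases r
    · rw [hst 1 1 rfl, hst 2 2 rfl, hst 3 3 rfl]; simp; field_simp; ring
    · rw [hst 1 0 rfl]; simp
    · rw [hst 2 0 rfl]; simp
    · rw [hst 3 0 rfl]; simp
  · have hlt : s 1 < s 2 := hlt
    have d1 : s 2 - s 1 ≠ 0 := by linarith
    have d2 : s 2 - s 0 ≠ 0 := by linarith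
    have d3 : s 3 - s 0 ≠ 0 := by linarith
    have d4 : s 3 - s 1 ≠ 0 := by linarith
    have d5 : s 4 - s 1 ≠ 0 := by linarith
    simp only [bsplinePiece, map_add, map_smul, dualFunctional_cubicOfRoots, smul_eq_mul]
    fin_cases r
    · rw [hst 1 2 rfl, hst 2 3 rfl, hst 3 4 rfl]; simp; field_simp; ring
    · rw [hst 1 1 rfl, hst 2 2 rfl, hst 3 3 rfl]; simp; field_simp; ring
    · rw [hst 1 0 rfl, hst 2 1 rfl, hst 3 2 rfl]; simp; field_simp; ring
    · rw [hst 2 0 rfl, hst 3 1 rfl]; simp; field_simp; ring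
  · have hlt : s 2 < s 3 := hlt
    have d1 : s 3 - s 2 ≠ 0 := by linarith
    have d2 : s 3 - s 0 ≠ 0 := by linarith
    have d3 : s 3 - s 1 ≠ 0 := by linarith
    have d4 : s 4 - s 1 ≠ 0 := by linarith
    have d5 : s 4 - s 2 ≠ 0 := by linarith
    simp only [bsplinePiece, map_add, map_smul, dualFunctional_cubicOfRoots, smul_eq_mul]
    fin_cases r
    · rw [hst 1 3 rfl, hst 2 4 rfl]; simp; field_simp; ring
    · rw [hst 1 2 rfl, hst 2 3 rfl, hst 3 4 rfl]; simp; field_simp; ring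
    · rw [hst 1 1 rfl, hst 2 2 rfl, hst 3 3 rfl]; simp; field_simp; ring
    · rw [hst 1 0 rfl, hst 2 1 rfl, hst 3 2 rfl]; simp; field_simp; ring
  · have hlt : s 3 < s 4 := hlt
    have d1 : s 4 - s 3 ≠ 0 := by linarith
    have d2 : s 4 - s 2 ≠ 0 := by linarith
    have d3 : s 4 - s 1 ≠ 0 := by linarith
    simp only [bsplinePiece, map_smul, dualFunctional_cubicOfRoots, smul_eq_mul]
    fin_cases r
    · rw [hst 1 4 rfl]; simp
    · rw [hst 2 4 rfl]; simp
    · rw [hst 3 4 rfl]; simp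
    · rw [hst 1 1 rfl, hst 2 2 rfl, hst 3 3 rfl]; simp; field_simp; ring

theorem cubicEval_eq_zero {κ : Fin 4 → ℝ} {α β : ℝ} (hαβ : α < β)
    (h : ∀ x ∈ Set.Ioo α β, cubicEval κ x = 0) : κ = 0 := by
  open Polynomial in
  have hP : (C (κ 0) + C (κ 1) * X + C (κ 2) * X ^ 2 + C (κ 3) * X ^ 3 : ℝ[X]) = 0 := by
    refine eq_zero_of_infinite_isRoot _ ((Set.Ioo_infinite hαβ).mono fun x hx => ?_)
    have := h x hx
    simpa [IsRoot, cubicEval] using this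
  funext k
  have hc := congrArg (fun p => Polynomial.coeff p k) hP
  fin_cases k <;> simpa [Polynomial.coeff_X, Polynomial.coeff_C, Polynomial.coeff_X_pow] using hc

/-- A linear functional of cubic polynomials respects linear relations that hold on an
interval. -/
theorem sum_functional_eq_zero {ι : Type*} [Fintype ι] {κ : ι → Fin 4 → ℝ} {c : ι → ℝ} {α β : ℝ}
    (hαβ : α < β) (h : ∀ x ∈ Set.Ioo α β, ∑ q, c q * cubicEval (κ q) x = 0)
    (L : (Fin 4 → ℝ) →ₗ[ℝ] ℝ) : ∑ q, c q * L (κ q) = 0 := by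
  have h0 : ∑ q, c q • κ q = 0 := cubicEval_eq_zero hαβ fun x hx => by
    rw [← h x hx]
    simp only [cubicEval, Finset.sum_apply, Pi.smul_apply, smul_eq_mul, Finset.sum_mul,
      ← Finset.sum_add_distrib]
    exact Finset.sum_congr rfl fun q _ => by ring
  have := congrArg L h0
  simpa only [map_sum, map_smul, smul_eq_mul, map_zero] using this

/-- Overlapping index vectors that both contain an interval coincide around it: their entries
agree if counted from the interval. -/
theorem IndexOverlap.eq_of_shift {v v' : Fin 5 → ℤ} (h : IndexOverlap v v') (hv : StrictMono v)
    (hv' : StrictMono v') {r r' : Fin 4} (h1 : v r.castSucc < v' r'.succ)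
    (h2 : v' r'.castSucc < v r.succ) (k k' : Fin 5) (hk : (k : ℕ) + r' = k' + r) :
    v k = v' k' := by
  have gap : ∀ (k : Fin 5) (p : Fin 4), v' p.castSucc < v k → v k < v' p.succ → False := by
    intro k p a b
    obtain ⟨q, hq⟩ := (h (v k) (hv.monotone (Fin.zero_le _)) (hv.monotone (Fin.le_last _))
      ((hv'.monotone (Fin.zero_le _)).trans a.le)
      (b.le.trans (hv'.monotone (Fin.le_last _)))).1 ⟨k, rfl⟩
    rw [← hq] at a b
    have a' := hv'.lt_iff_lt.1 a
    have b' := hv'.lt_iff_lt.1 b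
    rw [Fin.lt_def] at a' b'
    simp only [Fin.val_castSucc, Fin.val_succ] at a' b'
    omega
  have gap' : ∀ (k : Fin 5) (p : Fin 4), v p.castSucc < v' k → v' k < v p.succ → False := by
    intro k p a b
    obtain ⟨q, hq⟩ := (h (v' k) ((hv.monotone (Fin.zero_le _)).trans a.le)
      (b.le.trans (hv.monotone (Fin.le_last _))) (hv'.monotone (Fin.zero_le _))
      (hv'.monotone (Fin.le_last _))).2 ⟨k, rfl⟩
    rw [← hq] at a b
    have a' := hv.lt_iff_lt.1 a
    have b' := hv.lt_iff_lt.1 b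
    rw [Fin.lt_def] at a' b'
    simp only [Fin.val_castSucc, Fin.val_succ] at a' b'
    omega
  have down : ∀ m : ℕ, ∀ k k' : Fin 5, (k : ℕ) + m = r → (k' : ℕ) + m = r' → v k = v' k' := by
    intro m
    induction m with
    | zero =>
      intro k k' e e'
      obtain rfl : k = r.castSucc := Fin.ext (by simpa using e)
      obtain rfl : k' = r'.castSucc := Fin.ext (by simpa using e')
      exact le_antisymm (not_lt.1 fun hc => gap _ r' hc h1) (not_lt.1 fun hc => gap' _ r hc h2)
    | succ m ih =>
      intro k k' e e'
      have hm := ih ⟨k + 1, by omega⟩ ⟨k' + 1, by omega⟩ (by simp only; omega)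
        (by simp only; omega)
      have l1 : v k < v ⟨k + 1, by omega⟩ := hv (Fin.lt_def.2 (by simp only; omega))
      have l2 : v' k' < v' ⟨k' + 1, by omega⟩ := hv' (Fin.lt_def.2 (by simp only; omega))
      exact le_antisymm (not_lt.1 fun hc => gap k ⟨k', by omega⟩ hc (hm ▸ l1))
        (not_lt.1 fun hc => gap' k' ⟨k, by omega⟩ hc (hm ▸ l2))
  have up : ∀ m : ℕ, ∀ k k' : Fin 5, (k : ℕ) = r + 1 + m → (k' : ℕ) = r' + 1 + m →
      v k = v' k' := by
    intro m
    induction m with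
    | zero =>
      intro k k' e e'
      obtain rfl : k = r.succ := Fin.ext (by simpa using e)
      obtain rfl : k' = r'.succ := Fin.ext (by simpa using e')
      exact le_antisymm (not_lt.1 fun hc => gap' _ r h1 hc) (not_lt.1 fun hc => gap _ r' h2 hc)
    | succ m ih =>
      intro k k' e e'
      have ek : k = (⟨r + 1 + m, by omega⟩ : Fin 4).succ :=
        Fin.ext (by simp only [Fin.val_succ]; omega)
      have ek' : k' = (⟨r' + 1 + m, by omega⟩ : Fin 4).succ :=
        Fin.ext (by simp only [Fin.val_succ]; omega)
      have hm := ih (⟨r + 1 + m, by omega⟩ : Fin 4).castSucc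
        (⟨r' + 1 + m, by omega⟩ : Fin 4).castSucc rfl rfl
      have l1 := hv (Fin.castSucc_lt_succ (i := (⟨r + 1 + m, by omega⟩ : Fin 4)))
      have l2 := hv' (Fin.castSucc_lt_succ (i := (⟨r' + 1 + m, by omega⟩ : Fin 4)))
      rw [← ek] at l1
      rw [← ek'] at l2
      exact le_antisymm (not_lt.1 fun hc => gap' k' ⟨r + 1 + m, by omega⟩ (hm ▸ l2) (by rwa [← ek]))
        (not_lt.1 fun hc => gap k ⟨r' + 1 + m, by omega⟩ (hm ▸ l1) (by rwa [← ek']))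
  rcases le_or_gt (k : ℕ) r with hkr | hkr
  · exact down (r - k) k k' (by omega) (by omega)
  · exact up (k - r - 1) k k' (by omega) (by omega)

/-! ### Limits of spans -/

/-- Linear independence of finitely many functions is visible on finitely many points. -/
theorem LinearIndependent.exists_finset_restrict {X ι : Type*} [Finite ι] {f : ι → X → ℝ}
    (hf : LinearIndependent ℝ f) :
    ∃ Z : Finset X, LinearIndependent ℝ fun i => fun z : Z => f i z := by
  cases nonempty_fintype ι
  let K : Finset X → Submodule ℝ (ι → ℝ) := fun Z =>
    LinearMap.ker (Fintype.linearCombination ℝ fun i => fun z : Z => f i z)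
  have hK : ∀ Z c, c ∈ K Z ↔ ∀ z ∈ Z, ∑ i, c i * f i z = 0 := fun Z c => by
    simp [K, LinearMap.mem_ker, funext_iff, Fintype.linearCombination_apply]
  obtain ⟨_, ⟨Z, rfl⟩, hmin⟩ :=
    wellFounded_lt.has_min (Set.range K) ⟨_, ⟨(∅ : Finset X), rfl⟩⟩
  refine ⟨Z, Fintype.linearIndependent_iff.2 fun c hc => ?_⟩
  have hcZ : c ∈ K Z := by
    rw [hK]
    intro z hz
    simpa using congrFun hc ⟨z, hz⟩
  refine Fintype.linearIndependent_iff.1 hf c (funext fun z => ?_)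
  classical
  have hle : K (insert z Z) ≤ K Z := fun c' hc' => by
    rw [hK] at hc' ⊢
    exact fun y hy => hc' y (Finset.mem_insert_of_mem hy)
  have heq : K (insert z Z) = K Z := by
    by_contra hne
    exact hmin _ ⟨_, rfl⟩ (lt_of_le_of_ne hle hne)
  rw [← heq, hK] at hcZ
  simpa using hcZ z (Finset.mem_insert_self _ _)

/-- Membership in a span survives pointwise limits if the limits of the spanning functions are
linearly independent: otherwise, linear independence being an open condition, the approximations
would be linearly independent as well. -/
theorem mem_span_of_tendsto {X ι α : Type*} [Fintype ι] {l : Filter α} {F : α → X → ℝ}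
    {F₀ : X → ℝ} {M : α → ι → X → ℝ} {M₀ : ι → X → ℝ}
    (hF : ∀ x, Tendsto (fun d => F d x) l (𝓝 (F₀ x)))
    (hM : ∀ i x, Tendsto (fun d => M d i x) l (𝓝 (M₀ i x))) (hli : LinearIndependent ℝ M₀)
    (hmem : ∀ Z : Finset X, ∃ᶠ d in l, ∃ c : ι → ℝ, ∀ z ∈ Z, F d z = ∑ i, c i * M d i z) :
    ∃ c : ι → ℝ, ∀ x, F₀ x = ∑ i, c i * M₀ i x := by
  have hspan : F₀ ∈ Submodule.span ℝ (Set.range M₀) := by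
    by_contra hnot
    obtain ⟨Z, hZ⟩ := (linearIndependent_option'.2 ⟨hli, hnot⟩).exists_finset_restrict
    have hlim : Tendsto (fun d => fun o : Option ι => fun z : Z =>
        (Option.casesOn' o (F d) (M d) : X → ℝ) z) l
        (𝓝 fun o => fun z : Z => (Option.casesOn' o F₀ M₀ : X → ℝ) z) := by
      rw [tendsto_pi_nhds]
      intro o
      rw [tendsto_pi_nhds]
      intro z
      cases o with
      | none => exact hF z
      | some i => exact hM i z
    obtain ⟨d, ⟨c, hc⟩, hd⟩ := ((hmem Z).and_eventually (hlim.eventually hZ.eventually)).exists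
    have := Fintype.linearIndependent_iff.1 hd (fun o => o.elim (-1) c) (by
      funext z
      rw [Fintype.sum_option]
      simp [hc z z.2]) none
    simp at this
  obtain ⟨c, hc⟩ := (Submodule.mem_span_range_iff_exists_fun ℝ).1 hspan
  exact ⟨c, fun x => by rw [← hc]; simp⟩

/-! ### Linear independence of the blending functions -/

/-- To the right of `α` there is an interval inside `[α, β]` free of points of `K`. -/
theorem exists_knot_interval {K : Set ℝ} (hK : K.Finite) {α β : ℝ} (hαβ : α < β) :
    ∃ β', α < β' ∧ β' ≤ β ∧ ∀ k ∈ K, k ≤ α ∨ β' ≤ k := by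
  obtain ⟨m, hm, hmin⟩ := (insert β {k ∈ K | α < k}).exists_min_image id
    ((hK.subset fun k hk => hk.1).insert β) ⟨β, Set.mem_insert _ _⟩
  refine ⟨m, ?_, hmin β (Set.mem_insert _ _), fun k hk => ?_⟩
  · rcases hm with rfl | hm
    exacts [hαβ, hm.2]
  · rcases le_or_gt k α with h | h
    · exact Or.inl h
    · exact Or.inr (hmin k (Set.mem_insert_of_mem _ ⟨hk, h⟩))

theorem exists_span_of_knots {t : Fin 5 → ℝ} {α β : ℝ} (hK : ∀ k, t k ≤ α ∨ β ≤ t k)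
    (h0 : t 0 ≤ α) (h4 : β ≤ t 4) : ∃ r : Fin 4, t r.castSucc ≤ α ∧ β ≤ t r.succ := by
  rcases hK 1 with h1 | h1
  · rcases hK 2 with h2 | h2
    · rcases hK 3 with h3 | h3
      · exact ⟨3, h3, h4⟩
      · exact ⟨2, h2, h3⟩
    · exact ⟨1, h1, h2⟩
  · exact ⟨0, h0, h1⟩

/-- On a knot-free interval inside the support of the B-spline with index vector `v'`, every
B-spline is a cubic polynomial, on which the dual functional of `v'` takes the value `1` if it has
index vector `v'` and `0` if it has any other index vector that overlaps with `v'`. -/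
theorem exists_piece_dual {ξ : ℤ → ℝ} {lo hi : ℤ} (hξ : MonotoneOn ξ (Set.Icc lo hi))
    {α β R : ℝ} (hαβ : α < β) (hK : ∀ i ∈ Set.Icc lo hi, ξ i ≤ α ∨ β ≤ ξ i) (hR : β ≤ R)
    {v' : Fin 5 → ℤ} (hv' : StrictMono v') (hm' : ∀ k, v' k ∈ Set.Icc lo hi)
    (h0 : ξ (v' 0) ≤ α) (h4 : β ≤ ξ (v' 4)) {v : Fin 5 → ℤ} (hv : StrictMono v)
    (hm : ∀ k, v k ∈ Set.Icc lo hi) :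
    ∃ κ : Fin 4 → ℝ,
      (∀ x ∈ Set.Ioo α β, cubicBSpline R (fun k => ξ (v k)) x = cubicEval κ x) ∧
      (v = v' → dualFunctional (fun k => ξ (v' k)) κ = 1) ∧
      (v ≠ v' → IndexOverlap v v' → dualFunctional (fun k => ξ (v' k)) κ = 0) := by
  have mono : ∀ {w : Fin 5 → ℤ}, StrictMono w → (∀ k, w k ∈ Set.Icc lo hi) →
      Monotone fun k => ξ (w k) := fun hw hwm k l hkl => hξ (hwm k) (hwm l) (hw.monotone hkl)
  have hdead : ((∀ k, ξ (v k) ≤ α) ∨ ∀ k, β ≤ ξ (v k)) → v ≠ v' := by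
    rintro h rfl
    rcases h with h | h
    · linarith [h 4]
    · linarith [h 0]
  by_cases hsupp : ξ (v 0) ≤ α ∧ β ≤ ξ (v 4)
  · obtain ⟨r, r1, r2⟩ := exists_span_of_knots (t := fun k => ξ (v k)) (fun k => hK _ (hm k))
      hsupp.1 hsupp.2
    obtain ⟨r', r1', r2'⟩ := exists_span_of_knots (t := fun k => ξ (v' k))
      (fun k => hK _ (hm' k)) h0 h4
    have dual : ∀ hov : IndexOverlap v v', (∀ k k' : Fin 5, (k : ℕ) + r = k' + r' →
        v' k = v k') := fun hov k k' e => by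
      refine (hov.eq_of_shift hv hv' (r := r) (r' := r') ?_ ?_ k' k e.symm).symm
      · by_contra hle
        have := hξ (hm' _) (hm _) (not_lt.1 hle)
        linarith
      · by_contra hle
        have := hξ (hm _) (hm' _) (not_lt.1 hle)
        linarith
    have dual' : ∀ hov : IndexOverlap v v', dualFunctional (fun k => ξ (v' k))
        (bsplinePiece (fun k => ξ (v k)) r) = if r' = r then 1 else 0 := fun hov =>
      dualFunctional_bsplinePiece (mono hv hm) (by show ξ (v r.castSucc) < ξ (v r.succ); linarith)
        fun k k' e => by simp only [dual hov k k' e]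
    refine ⟨bsplinePiece (fun k => ξ (v k)) r, fun x hx => cubicBSpline_eq_piece
      (by linarith [hx.2]) (mono hv hm) (r1.trans_lt hx.1)
      (hx.2.trans_le r2), ?_, fun hne hov => ?_⟩
    · rintro rfl
      have hov : IndexOverlap v v := fun k _ _ _ _ => Iff.rfl
      have hr : r' = r := by
        have := dual hov r'.castSucc r.castSucc (by simp [add_comm])
        have := hv.injective this
        exact Fin.castSucc_injective _ this
      rw [dual' hov, if_pos hr]
    · rw [dual' hov, if_neg]
      rintro rfl
      exact hne (funext fun k => (dual hov k k rfl).symm)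
  · have hside : (∀ k, ξ (v k) ≤ α) ∨ ∀ k, β ≤ ξ (v k) := by
      rw [not_and_or] at hsupp
      rcases hsupp with h | h
      · exact Or.inr fun k => ((hK _ (hm 0)).resolve_left h).trans (mono hv hm (Fin.zero_le k))
      · exact Or.inl fun k =>
          (mono hv hm (Fin.le_last k)).trans ((hK _ (hm 4)).resolve_right h)
    refine ⟨0, fun x hx => ?_, fun h => absurd h (hdead hside), fun _ _ => map_zero _⟩
    rw [cubicBSpline_eq_zero (by linarith [hx.2])]
    · simp [cubicEval]
    · exact hside.imp (fun h k => (h k).trans_lt hx.1) (fun h k => hx.2.trans_le (h k))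

namespace TSpline

open IndexMesh

/-- The anchors of a T-spline. -/
def Anchor (T : TSpline) : Type := {p : ℤ × ℤ // T.mesh.IsAnchor p.1 p.2}

instance (T : TSpline) : Finite T.Anchor := by
  have hfin : {p : ℤ × ℤ | T.mesh.IsAnchor p.1 p.2}.Finite :=
    ((Set.finite_Icc (T.mesh.mlo + 2) (T.mesh.mhi - 2)).prod
      (Set.finite_Icc (T.mesh.nlo + 2) (T.mesh.nhi - 2))).subset
      fun p ⟨_, h1, h2, h3, h4⟩ => ⟨⟨h1, h2⟩, h3, h4⟩
  exact hfin.to_subtype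

noncomputable instance (T : TSpline) : Fintype T.Anchor := Fintype.ofFinite _

/-- `v` and `w` assign to each anchor its index vectors. -/
def IsIndexing (T : TSpline) (v w : T.Anchor → Fin 5 → ℤ) : Prop :=
  ∀ q : T.Anchor, T.IsIndexVectors q.1.1 q.1.2 (v q) (w q)

theorem IsAnalysisSuitable.exists_indexing {T : TSpline} (hT : T.IsAnalysisSuitable) :
    ∃ v w, T.IsIndexing v w := by
  choose v w h using fun q : T.Anchor => hT.exists_indexVectors q.2
  exact ⟨v, w, h⟩

theorem IsIndexing.setOf_eq_range {T : TSpline} {v w : T.Anchor → Fin 5 → ℤ}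
    (h : T.IsIndexing v w) (Φ : ℤ → ℤ → (Fin 5 → ℤ) → (Fin 5 → ℤ) → ℝ × ℝ → ℝ) :
    {f | ∃ (a b : ℤ) (v w : Fin 5 → ℤ),
      T.mesh.IsAnchor a b ∧ T.IsIndexVectors a b v w ∧ f = Φ a b v w} =
    Set.range fun q : T.Anchor => Φ q.1.1 q.1.2 (v q) (w q) := by
  ext f
  constructor
  · rintro ⟨a, b, v', w', hA, ⟨m1, m2, m3, m4⟩, rfl⟩
    obtain ⟨n1, n2, n3, n4⟩ := h ⟨(a, b), hA⟩
    exact ⟨⟨(a, b), hA⟩, by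
      simp only [n1.unique m1 (n2.trans m2.symm), n3.unique m3 (n4.trans m4.symm)]⟩
  · rintro ⟨q, rfl⟩
    exact ⟨_, _, _, _, q.2, h q, rfl⟩

theorem IsAnalysisSuitable.mem_bounds {T : TSpline} (hT : T.IsAnalysisSuitable)
    {v w : T.Anchor → Fin 5 → ℤ} (h : T.IsIndexing v w) (q : T.Anchor) :
    (∀ k, v q k ∈ Set.Icc T.mesh.mlo T.mesh.mhi) ∧
      ∀ k, w q k ∈ Set.Icc T.mesh.nlo T.mesh.nhi := by
  have key : ∀ {M : IndexMesh} {i j : ℤ}, M.IsTMesh → i ∈ M.hJ j → i ∈ Set.Icc M.mlo M.mhi := by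
    rintro M i j hM ⟨Q, hQ, h1, -⟩
    have := hM.cell Q hQ
    exact ⟨by omega, by omega⟩
  exact ⟨fun k => key hT.mesh.isTMesh ((h q).1.2.1 k),
    fun k => key hT.mesh.isTMesh.transpose ((h q).2.2.1.2.1 k)⟩

/-- The interiors of the supports of the two B-splines of the anchor `q` meet the parametric
domain. -/
def IsActive (T : TSpline) (v w : T.Anchor → Fin 5 → ℤ) (q : T.Anchor) : Prop :=
  max (T.xi (v q 0)) (T.xi (T.mesh.mlo + 3)) < min (T.xi (v q 4)) (T.xi (T.mesh.mhi - 3)) ∧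
    max (T.eta (w q 0)) (T.eta (T.mesh.nlo + 3)) < min (T.eta (w q 4)) (T.eta (T.mesh.nhi - 3))

/-- The points of the open parametric domain on no line `x = k` with `k ∈ K` and on no line
`y = k` with `k ∈ L`. -/
def genericPoints (T : TSpline) (K L : Set ℝ) : Set (ℝ × ℝ) :=
  {z | (z.1 ∈ Set.Ioo (T.xi (T.mesh.mlo + 3)) (T.xi (T.mesh.mhi - 3)) ∧ z.1 ∉ K) ∧
    z.2 ∈ Set.Ioo (T.eta (T.mesh.nlo + 3)) (T.eta (T.mesh.nhi - 3)) ∧ z.2 ∉ L}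

theorem blending_of_generic {T : TSpline} {K L : Set ℝ} {z : ℝ × ℝ} (hz : z ∈ T.genericPoints K L)
    (v w : Fin 5 → ℤ) : T.blending v w z =
      cubicBSpline (T.xi (T.mesh.mhi - 3)) (fun k => T.xi (v k)) z.1 *
        cubicBSpline (T.eta (T.mesh.nhi - 3)) (fun k => T.eta (w k)) z.2 :=
  Set.indicator_of_mem (show z ∈ T.domain from
    ⟨⟨hz.1.1.1.le, hz.1.1.2.le⟩, ⟨hz.2.1.1.le, hz.2.1.2.le⟩⟩) _

/-- The blending functions that do not vanish on the parametric domain are linearly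
independent, even on the complement of finitely many lines: tensor products of the univariate dual
functionals form a dual basis, because any two anchors overlap in a suitable direction. -/
theorem IsAnalysisSuitable.linearIndependent {T : TSpline} (hT : T.IsAnalysisSuitable)
    {v w : T.Anchor → Fin 5 → ℤ} (h : T.IsIndexing v w) {K L : Set ℝ} (hK : K.Finite)
    (hL : L.Finite) (hKT : T.xi '' Set.Icc T.mesh.mlo T.mesh.mhi ⊆ K)
    (hLT : T.eta '' Set.Icc T.mesh.nlo T.mesh.nhi ⊆ L) :
    LinearIndependent ℝ fun q : {q // T.IsActive v w q} =>
      fun z : T.genericPoints K L => T.blending (v q.1) (w q.1) z := by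
  classical
  refine Fintype.linearIndependent_iff.2 fun c hc A => ?_
  obtain ⟨⟨hact1, hact2⟩⟩ : Nonempty (T.IsActive v w A.1) := ⟨A.2⟩
  obtain ⟨β₁, i1, i2, i3⟩ := exists_knot_interval hK hact1
  obtain ⟨β₂, j1, j2, j3⟩ := exists_knot_interval hL hact2
  set α₁ := max (T.xi (v A.1 0)) (T.xi (T.mesh.mlo + 3))
  set α₂ := max (T.eta (w A.1 0)) (T.eta (T.mesh.nlo + 3))
  have hmemA := hT.mem_bounds h A.1
  have hA := h A.1
  have hgen : ∀ x ∈ Set.Ioo α₁ β₁, ∀ y ∈ Set.Ioo α₂ β₂, (x, y) ∈ T.genericPoints K L := by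
    intro x hx y hy
    refine ⟨⟨⟨(le_max_right _ _).trans_lt hx.1, hx.2.trans_le (i2.trans (min_le_right _ _))⟩,
      fun hk => ?_⟩, ⟨(le_max_right _ _).trans_lt hy.1,
      hy.2.trans_le (j2.trans (min_le_right _ _))⟩, fun hk => ?_⟩
    · rcases i3 x hk with h | h
      exacts [h.not_gt hx.1, h.not_gt hx.2]
    · rcases j3 y hk with h | h
      exacts [h.not_gt hy.1, h.not_gt hy.2]
  choose κ hκ using fun q : T.Anchor => exists_piece_dual hT.xi.mono i1
    (fun i hi => i3 _ (hKT ⟨i, hi, rfl⟩)) (i2.trans (min_le_right _ _)) hA.1.1 hmemA.1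
    (le_max_left _ _) (i2.trans (min_le_left _ _)) (h q).1.1 (hT.mem_bounds h q).1
  choose κ' hκ' using fun q : T.Anchor => exists_piece_dual hT.eta.mono j1
    (fun i hi => j3 _ (hLT ⟨i, hi, rfl⟩)) (j2.trans (min_le_right _ _)) hA.2.2.1.1 hmemA.2
    (le_max_left _ _) (j2.trans (min_le_left _ _)) (h q).2.2.1.1 (hT.mem_bounds h q).2
  have hzero : ∀ x ∈ Set.Ioo α₁ β₁, ∀ y ∈ Set.Ioo α₂ β₂,
      ∑ q : {q // T.IsActive v w q}, c q * cubicEval (κ' q.1) y * cubicEval (κ q.1) x = 0 := by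
    intro x hx y hy
    have := congrFun hc ⟨(x, y), hgen x hx y hy⟩
    simp only [Finset.sum_apply, Pi.smul_apply, smul_eq_mul, Pi.zero_apply] at this
    rw [← this]
    refine Finset.sum_congr rfl fun q _ => ?_
    rw [blending_of_generic (hgen x hx y hy), (hκ q.1).1 x hx, (hκ' q.1).1 y hy]
    ring
  have h1 : ∀ y ∈ Set.Ioo α₂ β₂, ∑ q : {q // T.IsActive v w q},
      c q * dualFunctional (fun k => T.xi (v A.1 k)) (κ q.1) * cubicEval (κ' q.1) y = 0 := by
    intro y hy
    have := sum_functional_eq_zero i1 (fun x hx => hzero x hx y hy)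
      (dualFunctional fun k => T.xi (v A.1 k))
    rw [← this]
    exact Finset.sum_congr rfl fun q _ => by ring
  have h2 := sum_functional_eq_zero j1 h1 (dualFunctional fun k => T.eta (w A.1 k))
  rw [Finset.sum_eq_single A] at h2
  · rw [(hκ A.1).2.1 rfl, (hκ' A.1).2.1 rfl] at h2
    simpa using h2
  · intro q _ hq
    have hne : (q.1.1.1, q.1.1.2) ≠ (A.1.1.1, A.1.1.2) := fun he =>
      hq (Subtype.ext (Subtype.ext he))
    rcases hT.dualCompatible q.1.2 (h q.1) A.1.2 hA hne with ⟨hne, hov⟩ | ⟨hne, hov⟩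
    · rw [(hκ q.1).2.2 hne hov]; ring
    · rw [(hκ' q.1).2.2 hne hov]; ring
  · exact fun hA => absurd (Finset.mem_univ _) hA

end TSpline

/-! ### Convergence of the perturbed blending functions -/

namespace IndexMesh

theorem AnalysisSuitable.cubicBSpline_perturb_tendsto {T : IndexMesh} (h : T.AnalysisSuitable)
    {ξ : ℤ → ℝ} (hξ : IsKnotVector T.mlo T.mhi ξ) (hd : T.nlo + 3 < T.nhi - 3) (c : ℤ → ℝ) {b : ℤ}
    {v : Fin 5 → ℤ} (hv : StrictMono v) (hJ : ∀ k, v k ∈ T.hJ b)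
    (hm : ∀ k, v k ∈ Set.Icc T.mlo T.mhi) {x : ℝ} (hx : x ∉ ξ '' Set.Icc T.mlo T.mhi) :
    Tendsto (fun δ => cubicBSpline (T.perturbKnots ξ c δ (T.perturb.mhi - 3))
      (fun k => T.perturbKnots ξ c δ (T.colIndex (v k) b)) x) (𝓝[>] 0)
      (𝓝 (cubicBSpline (ξ (T.mhi - 3)) (fun k => ξ (v k)) x)) := by
  have hi := hξ.index
  refine cubicBSpline_tendsto (h.perturbKnots_right ξ c hd)
    (fun k => h.perturbKnots_colIndex ξ c (hJ k)) (fun he => hx ⟨_, ⟨?_, ?_⟩, he.symm⟩)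
    (fun k he => hx ⟨_, hm k, he.symm⟩) fun k l hkl => hξ.mono (hm k) (hm l) (hv.monotone hkl)
  all_goals omega

/-- If the interior of the support of a B-spline does not meet the parametric interval, then the
perturbed B-splines have all their knots on one side of a given point, eventually. -/
theorem AnalysisSuitable.cubicBSpline_perturb_eq_zero {T : IndexMesh} (h : T.AnalysisSuitable)
    {ξ : ℤ → ℝ} (hξ : IsKnotVector T.mlo T.mhi ξ) (hd : T.nlo + 3 < T.nhi - 3) (c : ℤ → ℝ) {b : ℤ}
    {v : Fin 5 → ℤ} (hv : StrictMono v) (hJ : ∀ k, v k ∈ T.hJ b)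
    (hm : ∀ k, v k ∈ Set.Icc T.mlo T.mhi) {x : ℝ} (hx : x ∉ ξ '' Set.Icc T.mlo T.mhi)
    (hxI : x ∈ Set.Ioo (ξ (T.mlo + 3)) (ξ (T.mhi - 3)))
    (hna : ¬ max (ξ (v 0)) (ξ (T.mlo + 3)) < min (ξ (v 4)) (ξ (T.mhi - 3))) :
    ∀ᶠ δ in 𝓝[>] 0, cubicBSpline (T.perturbKnots ξ c δ (T.perturb.mhi - 3))
      (fun k => T.perturbKnots ξ c δ (T.colIndex (v k) b)) x = 0 := by
  have mono : ∀ k l, k ≤ l → ξ (v k) ≤ ξ (v l) := fun k l hkl =>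
    hξ.mono (hm k) (hm l) (hv.monotone hkl)
  have hside : (∀ k, ξ (v k) < x) ∨ ∀ k, x < ξ (v k) := by
    rcases lt_or_gt_of_ne (fun he => hx ⟨_, hm 0, he⟩ : ξ (v 0) ≠ x) with h0 | h0
    · rcases lt_or_gt_of_ne (fun he => hx ⟨_, hm 4, he⟩ : ξ (v 4) ≠ x) with h4 | h4
      · exact Or.inl fun k => (mono k 4 (Fin.le_last k)).trans_lt h4
      · exact absurd ((max_lt h0 hxI.1).trans (lt_min h4 hxI.2)) hna
    · exact Or.inr fun k => h0.trans_le (mono 0 k (Fin.zero_le k))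
  have hR := (h.perturbKnots_right ξ c hd).eventually_const_lt hxI.2
  have hk := fun k => h.perturbKnots_colIndex ξ c (hJ k)
  rcases hside with hs | hs
  · filter_upwards [hR, eventually_all.2 fun k => (hk k).eventually_lt_const (hs k)] with δ h1 h2
    exact cubicBSpline_eq_zero h1.ne (Or.inl h2)
  · filter_upwards [hR, eventually_all.2 fun k => (hk k).eventually_const_lt (hs k)] with δ h1 h2
    exact cubicBSpline_eq_zero h1.ne (Or.inr h2)

end IndexMesh

namespace TSpline

open IndexMesh

variable {T : TSpline}

theorem IsAnalysisSuitable.perturb_xi_left (hT : T.IsAnalysisSuitable) (c d : ℤ → ℝ) :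
    Tendsto (fun δ => (T.perturb c d δ).xi ((T.perturb c d δ).mesh.mlo + 3)) (𝓝[>] 0)
      (𝓝 (T.xi (T.mesh.mlo + 3))) :=
  hT.mesh.perturbKnots_left T.xi c hT.xi.index hT.eta.index

theorem IsAnalysisSuitable.perturb_xi_right (hT : T.IsAnalysisSuitable) (c d : ℤ → ℝ) :
    Tendsto (fun δ => (T.perturb c d δ).xi ((T.perturb c d δ).mesh.mhi - 3)) (𝓝[>] 0)
      (𝓝 (T.xi (T.mesh.mhi - 3))) :=
  hT.mesh.perturbKnots_right T.xi c hT.eta.index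

theorem IsAnalysisSuitable.perturb_eta_left (hT : T.IsAnalysisSuitable) (c d : ℤ → ℝ) :
    Tendsto (fun δ => (T.perturb c d δ).eta ((T.perturb c d δ).mesh.nlo + 3)) (𝓝[>] 0)
      (𝓝 (T.eta (T.mesh.nlo + 3))) :=
  hT.mesh.transpose.perturbKnots_left T.eta d hT.eta.index hT.xi.index

theorem IsAnalysisSuitable.perturb_eta_right (hT : T.IsAnalysisSuitable) (c d : ℤ → ℝ) :
    Tendsto (fun δ => (T.perturb c d δ).eta ((T.perturb c d δ).mesh.nhi - 3)) (𝓝[>] 0)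
      (𝓝 (T.eta (T.mesh.nhi - 3))) :=
  hT.mesh.transpose.perturbKnots_right T.eta d hT.xi.index

/-- The blending function of the perturbed spline that corresponds to the anchor `q`. -/
noncomputable def perturbBlending (T : TSpline) (v w : T.Anchor → Fin 5 → ℤ) (c d : ℤ → ℝ) (δ : ℝ)
    (q : T.Anchor) : ℝ × ℝ → ℝ :=
  (T.perturb c d δ).blending (fun k => T.mesh.colIndex (v q k) q.1.2)
    (fun k => T.mesh.rowIndex q.1.1 (w q k))

variable {v w : T.Anchor → Fin 5 → ℤ} {K L : Set ℝ} {z : ℝ × ℝ}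

theorem IsAnalysisSuitable.eventually_mem_perturb_domain (hT : T.IsAnalysisSuitable)
    (c d : ℤ → ℝ) (hz : z ∈ T.genericPoints K L) :
    ∀ᶠ δ in 𝓝[>] 0, z ∈ (T.perturb c d δ).domain := by
  filter_upwards [(hT.perturb_xi_left c d).eventually_lt_const hz.1.1.1,
    (hT.perturb_xi_right c d).eventually_const_lt hz.1.1.2,
    (hT.perturb_eta_left c d).eventually_lt_const hz.2.1.1,
    (hT.perturb_eta_right c d).eventually_const_lt hz.2.1.2] with δ h1 h2 h3 h4
  exact ⟨⟨h1.le, h2.le⟩, ⟨h3.le, h4.le⟩⟩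

theorem IsAnalysisSuitable.perturbBlending_tendsto (hT : T.IsAnalysisSuitable)
    (h : T.IsIndexing v w) (c d : ℤ → ℝ) (hKT : T.xi '' Set.Icc T.mesh.mlo T.mesh.mhi ⊆ K)
    (hLT : T.eta '' Set.Icc T.mesh.nlo T.mesh.nhi ⊆ L) (hz : z ∈ T.genericPoints K L)
    (q : T.Anchor) :
    Tendsto (fun δ => T.perturbBlending v w c d δ q z) (𝓝[>] 0)
      (𝓝 (T.blending (v q) (w q) z)) := by
  have hm := hT.mem_bounds h q
  have hq := h q
  rw [blending_of_generic hz]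
  refine ((hT.mesh.cubicBSpline_perturb_tendsto hT.xi hT.eta.index c hq.1.1 hq.1.2.1 hm.1
    fun hx => hz.1.2 (hKT hx)).mul (hT.mesh.transpose.cubicBSpline_perturb_tendsto hT.eta
    hT.xi.index d hq.2.2.1.1 hq.2.2.1.2.1 hm.2 fun hx => hz.2.2 (hLT hx))).congr' ?_
  filter_upwards [hT.eventually_mem_perturb_domain c d hz] with δ hδ
  rw [perturbBlending, blending, Set.indicator_of_mem hδ]
  rfl

theorem IsAnalysisSuitable.perturbBlending_eq_zero (hT : T.IsAnalysisSuitable)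
    (h : T.IsIndexing v w) (c d : ℤ → ℝ) (hKT : T.xi '' Set.Icc T.mesh.mlo T.mesh.mhi ⊆ K)
    (hLT : T.eta '' Set.Icc T.mesh.nlo T.mesh.nhi ⊆ L) (hz : z ∈ T.genericPoints K L)
    {q : T.Anchor} (hna : ¬ T.IsActive v w q) :
    ∀ᶠ δ in 𝓝[>] 0, T.perturbBlending v w c d δ q z = 0 := by
  have hm := hT.mem_bounds h q
  have hq := h q
  rcases not_and_or.1 hna with hna | hna
  · filter_upwards [hT.mesh.cubicBSpline_perturb_eq_zero hT.xi hT.eta.index c hq.1.1 hq.1.2.1 hm.1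
      (fun hx => hz.1.2 (hKT hx)) hz.1.1 hna] with δ hδ
    rw [perturbBlending, blending]
    exact Set.indicator_apply_eq_zero.2 fun _ => mul_eq_zero_of_left hδ _
  · filter_upwards [hT.mesh.transpose.cubicBSpline_perturb_eq_zero hT.eta hT.xi.index d
      hq.2.2.1.1 hq.2.2.1.2.1 hm.2 (fun hx => hz.2.2 (hLT hx)) hz.2.1 hna] with δ hδ
    rw [perturbBlending, blending]
    exact Set.indicator_apply_eq_zero.2 fun _ => mul_eq_zero_of_right _ hδ

theorem IsIndexing.space_eq_range (h : T.IsIndexing v w) :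
    T.space = Submodule.span ℝ (Set.range fun q => T.blending (v q) (w q)) := by
  rw [space, h.setOf_eq_range fun _ _ v w => T.blending v w]

theorem IsAnalysisSuitable.space_perturb_eq_range (hT : T.IsAnalysisSuitable)
    (h : T.IsIndexing v w) (c d : ℤ → ℝ) (δ : ℝ) :
    (T.perturb c d δ).space = Submodule.span ℝ (Set.range (T.perturbBlending v w c d δ)) := by
  rw [hT.space_perturb, h.setOf_eq_range fun a b v w => (T.perturb c d δ).blending
    (fun k => T.mesh.colIndex (v k) b) (fun k => T.mesh.rowIndex a (w k))]
  rfl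

/-! ### Comparison of the parametric domains -/

/-- If the perturbed parametric domains agree for arbitrarily small perturbations, then the
limits of their corners agree. -/
theorem IsAnalysisSuitable.endpoints_eq {T₁ T₂ : TSpline} (hT₁ : T₁.IsAnalysisSuitable)
    (hT₂ : T₂.IsAnalysisSuitable) {c₁ d₁ c₂ d₂ : ℤ → ℝ}
    (hdom : ∃ᶠ δ in 𝓝[>] (0 : ℝ), (T₁.perturb c₁ d₁ δ).domain = (T₂.perturb c₂ d₂ δ).domain) :
    (T₁.xi (T₁.mesh.mlo + 3) = T₂.xi (T₂.mesh.mlo + 3) ∧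
      T₁.xi (T₁.mesh.mhi - 3) = T₂.xi (T₂.mesh.mhi - 3)) ∧
    T₁.eta (T₁.mesh.nlo + 3) = T₂.eta (T₂.mesh.nlo + 3) ∧
      T₁.eta (T₁.mesh.nhi - 3) = T₂.eta (T₂.mesh.nhi - 3) := by
  have lim : ∀ {f g : ℝ → ℝ} {a b : ℝ}, Tendsto f (𝓝[>] 0) (𝓝 a) → Tendsto g (𝓝[>] 0) (𝓝 b) →
      (∃ᶠ δ in 𝓝[>] (0 : ℝ), f δ = g δ) → a = b := by
    intro f g a b hf hg hfg
    by_contra hne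
    obtain ⟨U, V, hU, hV, haU, hbV, hUV⟩ := t2_separation hne
    obtain ⟨δ, h1, h2, h3⟩ := (hfg.and_eventually
      ((hf.eventually (hU.mem_nhds haU)).and (hg.eventually (hV.mem_nhds hbV)))).exists
    exact Set.disjoint_left.1 hUV h2 (h1 ▸ h3)
  have hx := (hT₁.perturb_xi_left c₁ d₁).eventually_lt (hT₁.perturb_xi_right c₁ d₁)
    hT₁.xi.nondegenerate
  have hy := (hT₁.perturb_eta_left c₁ d₁).eventually_lt (hT₁.perturb_eta_right c₁ d₁)
    hT₁.eta.nondegenerate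
  have key := (hdom.and_eventually (hx.and hy)).mono fun δ ⟨he, h1, h2⟩ => by
    have hne := (Set.nonempty_Icc.2 h1.le).prod (Set.nonempty_Icc.2 h2.le)
    obtain ⟨e1, e2⟩ := (Set.prod_eq_prod_iff_of_nonempty hne).1 he
    exact And.intro ((Set.Icc_eq_Icc_iff h1.le).1 e1) ((Set.Icc_eq_Icc_iff h2.le).1 e2)
  exact ⟨⟨lim (hT₁.perturb_xi_left c₁ d₁) (hT₂.perturb_xi_left c₂ d₂) (key.mono fun _ h => h.1.1),
    lim (hT₁.perturb_xi_right c₁ d₁) (hT₂.perturb_xi_right c₂ d₂) (key.mono fun _ h => h.1.2)⟩,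
    lim (hT₁.perturb_eta_left c₁ d₁) (hT₂.perturb_eta_left c₂ d₂) (key.mono fun _ h => h.2.1),
    lim (hT₁.perturb_eta_right c₁ d₁) (hT₂.perturb_eta_right c₂ d₂) (key.mono fun _ h => h.2.2)⟩

end TSpline

/-! ### From generic points to all points -/

/-- Each point of a closed interval is approached by a one-sided filter along which the B-splines
that take left limits at the right end are continuous. -/
theorem exists_filter_cubicBSpline_tendsto {α β x : ℝ} (hαβ : α < β) (hx : x ∈ Set.Icc α β)
    {K : Set ℝ} (hK : K.Finite) : ∃ l : Filter ℝ, l.NeBot ∧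
      (∀ᶠ y in l, y ∈ Set.Ioo α β ∧ y ∉ K) ∧
      ∀ t, Tendsto (cubicBSpline β t) l (𝓝 (cubicBSpline β t x)) := by
  have avoid : ∀ s : Set ℝ, x ∉ s → ∀ᶠ y in 𝓝[s] x, y ∉ K := fun s hs => by
    have h1 : ∀ᶠ y in 𝓝[s] x, y ∉ K \ {x} :=
      nhdsWithin_le_nhds ((hK.subset Set.sdiff_subset).isClosed.isOpen_compl.mem_nhds (by simp))
    filter_upwards [h1, self_mem_nhdsWithin] with y hy hys hyK
    exact hy ⟨hyK, fun he => hs (he ▸ hys)⟩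
  rcases hx.2.lt_or_eq with h | rfl
  · refine ⟨𝓝[>] x, inferInstance, ?_, fun t => coxDeBoor_tendsto_right _ h 3 0⟩
    filter_upwards [Ioo_mem_nhdsGT h, avoid _ (lt_irrefl x)] with y h1 h2
    exact ⟨⟨hx.1.trans_lt h1.1, h1.2⟩, h2⟩
  · refine ⟨𝓝[<] x, inferInstance, ?_, fun t => coxDeBoor_tendsto_left _ _ 3 0⟩
    filter_upwards [Ioo_mem_nhdsLT hαβ, avoid _ (lt_irrefl x)] with y h1 h2
    exact ⟨h1, h2⟩

namespace TSpline

/-- A linear relation between blending functions on a common parametric domain that holds off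
finitely many lines holds everywhere. -/
theorem blending_eq_sum_of_generic {T₁ T₂ : TSpline}
    (hξ : T₁.xi (T₁.mesh.mlo + 3) = T₂.xi (T₂.mesh.mlo + 3) ∧
      T₁.xi (T₁.mesh.mhi - 3) = T₂.xi (T₂.mesh.mhi - 3))
    (hη : T₁.eta (T₁.mesh.nlo + 3) = T₂.eta (T₂.mesh.nlo + 3) ∧
      T₁.eta (T₁.mesh.nhi - 3) = T₂.eta (T₂.mesh.nhi - 3))
    (hξ' : T₂.xi (T₂.mesh.mlo + 3) < T₂.xi (T₂.mesh.mhi - 3))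
    (hη' : T₂.eta (T₂.mesh.nlo + 3) < T₂.eta (T₂.mesh.nhi - 3))
    {K L : Set ℝ} (hK : K.Finite) (hL : L.Finite) {ι : Type*} [Fintype ι] {c : ι → ℝ}
    {v₁ w₁ : Fin 5 → ℤ} {v w : ι → Fin 5 → ℤ}
    (h : ∀ z ∈ T₂.genericPoints K L, T₁.blending v₁ w₁ z = ∑ q, c q * T₂.blending (v q) (w q) z) :
    T₁.blending v₁ w₁ = ∑ q, c q • T₂.blending (v q) (w q) := by
  have hdom : T₁.domain = T₂.domain := by simp only [domain, hξ.1, hξ.2, hη.1, hη.2]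
  funext z
  simp only [Finset.sum_apply, Pi.smul_apply, smul_eq_mul]
  by_cases hz : z ∈ T₂.domain
  · obtain ⟨l, hl, hl1, hl2⟩ := exists_filter_cubicBSpline_tendsto hξ' hz.1 hK
    obtain ⟨l', hl', hl1', hl2'⟩ := exists_filter_cubicBSpline_tendsto hη' hz.2 hL
    have lim : ∀ (t s : Fin 5 → ℝ), Tendsto (fun y : ℝ × ℝ =>
        cubicBSpline (T₂.xi (T₂.mesh.mhi - 3)) t y.1 *
          cubicBSpline (T₂.eta (T₂.mesh.nhi - 3)) s y.2) (l ×ˢ l')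
        (𝓝 (cubicBSpline (T₂.xi (T₂.mesh.mhi - 3)) t z.1 *
          cubicBSpline (T₂.eta (T₂.mesh.nhi - 3)) s z.2)) := fun t s =>
      ((hl2 t).comp tendsto_fst).mul ((hl2' s).comp tendsto_snd)
    have hgen : ∀ᶠ y in l ×ˢ l', y ∈ T₂.genericPoints K L := hl1.prod_mk hl1'
    have hin : ∀ y ∈ T₂.domain, ∀ v w, T₁.blending v w y =
        cubicBSpline (T₂.xi (T₂.mesh.mhi - 3)) (fun k => T₁.xi (v k)) y.1 *
          cubicBSpline (T₂.eta (T₂.mesh.nhi - 3)) (fun k => T₁.eta (w k)) y.2 := by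
      intro y hy v w
      rw [blending, hdom, Set.indicator_of_mem hy, hξ.2, hη.2]
    have hin' : ∀ v w, T₂.blending v w z =
        cubicBSpline (T₂.xi (T₂.mesh.mhi - 3)) (fun k => T₂.xi (v k)) z.1 *
          cubicBSpline (T₂.eta (T₂.mesh.nhi - 3)) (fun k => T₂.eta (w k)) z.2 := fun v w =>
      Set.indicator_of_mem hz _
    simp only [hin z hz, hin']
    refine tendsto_nhds_unique (lim _ _) ((tendsto_finsetSum _ fun q _ =>
      (lim (fun k => T₂.xi (v q k)) (fun k => T₂.eta (w q k))).const_mul (c q)).congr' ?_)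
    filter_upwards [hgen] with y hy
    rw [← hin y ⟨⟨hy.1.1.1.le, hy.1.1.2.le⟩, ⟨hy.2.1.1.le, hy.2.1.2.le⟩⟩, h y hy]
    exact Finset.sum_congr rfl fun q _ => by rw [blending_of_generic hy]
  · rw [blending, Set.indicator_of_notMem (hdom ▸ hz)]
    refine (Finset.sum_eq_zero fun q _ => ?_).symm
    rw [blending, Set.indicator_of_notMem hz, mul_zero]

end TSpline

theorem mainTheorem6 (T₁ T₂ : TSpline)
    (hT₁ : T₁.IsAnalysisSuitable) (hT₂ : T₂.IsAnalysisSuitable)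
    (c₁ d₁ c₂ d₂ : ℤ → ℝ)
    (hc₁ : ∀ k, 0 ≤ c₁ k) (hd₁ : ∀ k, 0 ≤ d₁ k) (hc₂ : ∀ k, 0 ≤ c₂ k) (hd₂ : ∀ k, 0 ≤ d₂ k)
    (hnested : ∃ᶠ δ in 𝓝[>] (0 : ℝ),
      TSpline.Nested (T₁.perturb c₁ d₁ δ) (T₂.perturb c₂ d₂ δ)) :
    TSpline.Nested T₁ T₂ := by
  classical
  obtain ⟨hξ, hη⟩ := hT₁.endpoints_eq hT₂ (hnested.mono fun _ h => h.1)
  obtain ⟨v₁, w₁, h₁⟩ := hT₁.exists_indexing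
  obtain ⟨v₂, w₂, h₂⟩ := hT₂.exists_indexing
  refine ⟨by simp only [TSpline.domain, hξ.1, hξ.2, hη.1, hη.2], ?_⟩
  rw [h₁.space_eq_range, h₂.space_eq_range, Submodule.span_le]
  rintro _ ⟨s, rfl⟩
  beta_reduce
  -- generic points avoid the knot lines of both splines
  let K : Set ℝ := T₁.xi '' Set.Icc T₁.mesh.mlo T₁.mesh.mhi ∪
    T₂.xi '' Set.Icc T₂.mesh.mlo T₂.mesh.mhi
  let L : Set ℝ := T₁.eta '' Set.Icc T₁.mesh.nlo T₁.mesh.nhi ∪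
    T₂.eta '' Set.Icc T₂.mesh.nlo T₂.mesh.nhi
  have hK : K.Finite := ((Set.finite_Icc _ _).image _).union ((Set.finite_Icc _ _).image _)
  have hL : L.Finite := ((Set.finite_Icc _ _).image _).union ((Set.finite_Icc _ _).image _)
  have hgen : T₂.genericPoints K L = T₁.genericPoints K L := by
    simp only [TSpline.genericPoints, hξ.1, hξ.2, hη.1, hη.2]
  obtain ⟨c, hc⟩ := mem_span_of_tendsto (X := T₂.genericPoints K L)
    (ι := {q // T₂.IsActive v₂ w₂ q}) (l := 𝓝[>] (0 : ℝ))
    (F := fun δ z => T₁.perturbBlending v₁ w₁ c₁ d₁ δ s z)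
    (F₀ := fun z => T₁.blending (v₁ s) (w₁ s) z)
    (M := fun δ q z => T₂.perturbBlending v₂ w₂ c₂ d₂ δ q.1 z)
    (M₀ := fun q z => T₂.blending (v₂ q.1) (w₂ q.1) z)
    (fun z => hT₁.perturbBlending_tendsto h₁ c₁ d₁ Set.subset_union_left Set.subset_union_left
      (hgen.subset z.2) s)
    (fun q z => hT₂.perturbBlending_tendsto h₂ c₂ d₂ Set.subset_union_right
      Set.subset_union_right z.2 q.1)
    (hT₂.linearIndependent h₂ hK hL Set.subset_union_right Set.subset_union_right) (by
      intro Z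
      -- for small perturbations, only the active anchors contribute on `Z`
      have hvanish : ∀ᶠ δ in 𝓝[>] (0 : ℝ), ∀ z ∈ Z, ∀ q : {q // ¬ T₂.IsActive v₂ w₂ q},
          T₂.perturbBlending v₂ w₂ c₂ d₂ δ q.1 z = 0 :=
        (Finset.eventually_all _).2 fun z _ => eventually_all.2 fun q =>
          hT₂.perturbBlending_eq_zero h₂ c₂ d₂ Set.subset_union_right Set.subset_union_right z.2 q.2
      refine (hnested.and_eventually hvanish).mono fun δ ⟨hn, hv⟩ => ?_
      have hmem : T₁.perturbBlending v₁ w₁ c₁ d₁ δ s ∈ (T₂.perturb c₂ d₂ δ).space :=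
        hn.2 (by
          rw [hT₁.space_perturb_eq_range h₁]
          exact Submodule.subset_span ⟨s, rfl⟩)
      rw [hT₂.space_perturb_eq_range h₂, Submodule.mem_span_range_iff_exists_fun] at hmem
      obtain ⟨e, he⟩ := hmem
      refine ⟨fun q => e q.1, fun z hz => ?_⟩
      rw [← he, Finset.sum_apply, ← Fintype.sum_subtype_add_sum_subtype (T₂.IsActive v₂ w₂)]
      simp [hv z hz])
  rw [SetLike.mem_coe, TSpline.blending_eq_sum_of_generic hξ hη hT₂.xi.nondegenerate
    hT₂.eta.nondegenerate hK hL (c := c)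
    (v := fun q : {q // T₂.IsActive v₂ w₂ q} => v₂ q.1) (w := fun q => w₂ q.1)
    fun z hz => hc ⟨z, hz⟩]
  exact Submodule.sum_mem _ fun q _ => Submodule.smul_mem _ _ (Submodule.subset_span ⟨q.1, rfl⟩)
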